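/- Let $f:\mathbb{R}\to\mathbb{R}$ be smooth and let $u$ be the profile of a periodic traveling wave $(t,x)\mapsto u(x-ct)$, of speed $c$ and period $1/k$ ($k>0$), of $\partial_t u+\partial_x(\partial_x^2u+f(u))=0$. Set $v(x):=u(x/k)$ and, for $\xi\in[-\pi,\pi]$, let \[ L_\xi:=-k\,(\partial_x+i\xi)\big((k^2(\partial_x+i\xi)^2+f'(v)-c)\,\cdot\,\big) \] on $L^2(\mathbb{R}/\mathbb{Z})$ with domain $H^3(\mathbb{R}/\mathbb{Z})$. Let $\langle\cdot,\cdot\rangle$ be the scalar product of $L^2(\mathbb{R}/\mathbb{Z})$, skew-linear in its first argument. There are $j_0\ge1$ and numbers $\lambda_j(\xi)$, $j\in\mathbb{Z}_{j_0}:=\{j\in\mathbb{Z}:|j|\ge j_0\}$, $\xi\in[-\pi,\pi]$, smooth in $\xi$, which for each $\xi$ are pairwise distinct, purely imaginary, algebraically simple eigenvalues of $L_\xi$, which exhaust the spectrum of $L_\xi$ outside some ball independent of $\xi$, and which satisfy $\lambda_j(\xi)=ik^3(2\pi j+\xi)^3+\mathcal{O}(|j|)$ uniformly in $\xi$, $\lambda_j(\xi)=-\lambda_{-j}(-\xi)$,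 and $\lambda_j^{(m)}(\pi)=\lambda_{j+1}^{(m)}(-\pi)$ for all $m\in\mathbb{N}$ when $j,j+1\in\mathbb{Z}_{j_0}$. By a choice of direct and dual eigenfunctions we mean families $\phi_j(\xi,x)$, $\tilde\phi_j(\xi,x)$, $j\in\mathbb{Z}_{j_0}$, smooth in $(\xi,x)\in[-\pi,\pi]\times\mathbb{R}$, of period one in $x$, such that \[ L_\xi\phi_j(\xi,\cdot)=\lambda_j(\xi)\phi_j(\xi,\cdot),\qquad L_\xi^*\tilde\phi_j(\xi,\cdot)=\overline{\lambda_j(\xi)}\,\tilde\phi_j(\xi,\cdot),\qquad \|\phi_j(\xi,\cdot)\|_{L^2}=\|\tilde\phi_j(\xi,\cdot)\|_{L^2},\qquad \langle\tilde\phi_j(\xi,\cdot),\phi_j(\xi,\cdot)\rangle=1, \] $\overline{\phi_j(\xi,\cdot)}=\phi_{-j}(-\xi,\cdot)$ and, when $j,j+1\in\mathbb{Z}_{j_0}$, $e^{2i\pi x}\partial_\xi^m\phi_j(\pi,x)=\partial_\xi^m\phi_{j+1}(-\pi,x)$ for all $m\in\mathbb{N}$, and likewise for $\tilde\phi$. Then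 there exist two families $(r_\ell)_{\ell\ge1}$, $(\tilde r_\ell)_{\ell\ge1}$ of smooth functions on $\mathbb{R}$ of period one, and two families of coefficients $b_\ell(j,\xi)$, $\tilde b_\ell(j,\xi)$, $\ell\ge1$, $j\in\mathbb{Z}_{j_0}$, $\xi\in[-\pi,\pi]$, smooth in $\xi$, such that the following holds. 1. For any $\ell\ge1$ and $\alpha\in\mathbb{N}$, uniformly in $\xi$, as $|j|\to\infty$, $\partial_\xi^\alpha b_\ell(j,\xi)=\mathcal{O}(|j|^{-(\ell+\alpha)})$ and $\partial_\xi^\alpha\tilde b_\ell(j,\xi)=\mathcal{O}(|j|^{-(\ell+\alpha)})$. 2. $r_1=\tilde r_1$ and $b_1=\tilde b_1$. 3. For any $M\ge1$ and $N\ge1$, there is a choice of direct and dual eigenfunctions such that the remainders \[ R_M(j,\xi,x):=\phi_j(\xi,x)-e^{2i\pi jx}\Big(1+\sum_{\ell=1}^M b_\ell(j,\xi)r_\ell(x)\Big),\qquad \tilde R_M(j,\xi,x):=\tilde\phi_j(\xi,x)-e^{2i\pi jx}\Big(1+\sum_{\ell=1}^M \tilde b_\ell(j,\xi)\tilde r_\ell(x)\Big)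 \] satisfy, for all $0\le\alpha,\beta\le N$, uniformly in $(\xi,x)$, as $|j|\to\infty$, \[ \partial_\xi^\alpha\partial_x^\beta R_M(j,\xi,x)=\mathcal{O}(|j|^{-(M+1+\alpha-\beta)}),\qquad \partial_\xi^\alpha\partial_x^\beta\tilde R_M(j,\xi,x)=\mathcal{O}(|j|^{-(M+1+\alpha-\beta)}). \] -/

import Mathlib

open scoped ContDiff

noncomputable section

namespace GKdV

open Set MeasureTheory Function

/-- `U` is a (classical) solution of `∂ₜ U + ∂ₓ (∂ₓ² U + f(U)) = 0` on the whole space-time. -/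
def IsSolution (f : ℝ → ℝ) (U : ℝ → ℝ → ℝ) : Prop :=
  ∀ t x : ℝ,
    deriv (fun s => U s x) t + deriv (fun y => iteratedDeriv 2 (U t) y + f (U t y)) x = 0

/-- `u` is the profile of a periodic traveling wave of speed `c` and wave number `k`
(that is, of period `1 / k`). -/
structure IsPeriodicWave (f : ℝ → ℝ) (u : ℝ → ℝ) (c k : ℝ) : Prop where
  k_pos : 0 < k
  regular : ContDiff ℝ 3 u
  periodic : Periodic u (1 / k)
  solution : IsSolution f (fun t x => u (x - c * t))

/-- The scaled profile, of period one. -/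
def scaledProfile (u : ℝ → ℝ) (k : ℝ) : ℝ → ℝ := fun x => u (x / k)

/-- The twisted derivative `∂ₓ + i ξ`. -/
def twistedDeriv (ξ : ℝ) (g : ℝ → ℂ) : ℝ → ℂ :=
  fun x => deriv g x + Complex.I * ξ * g x

/-- The Bloch symbol `L_ξ = -k (∂ₓ + i ξ) ((k² (∂ₓ + i ξ)² + f'(v) - c) ·)`, as a differential
expression, where `v` is the scaled profile. -/
def blochSymbol (f u : ℝ → ℝ) (c k ξ : ℝ) (g : ℝ → ℂ) : ℝ → ℂ :=
  fun x => -(k : ℂ) *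
    twistedDeriv ξ
      (fun y => (k : ℂ) ^ 2 * twistedDeriv ξ (twistedDeriv ξ g) y
        + ((deriv f (scaledProfile u k y) - c : ℝ) : ℂ) * g y) x

/-- Representatives of elements of `L²(ℝ/ℤ)`. -/
def MemL2per (g : ℝ → ℂ) : Prop :=
  Periodic g 1 ∧ MemLp g 2 (volume.restrict (Ioc (0 : ℝ) 1))

/-- Elements of `H³(ℝ/ℤ)`, identified with their continuous representative: the function has
period one, is of class `C²`, and its second derivative is a primitive of an element
of `L²(ℝ/ℤ)`. -/
def MemH3per (g : ℝ → ℂ) : Prop :=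
  Periodic g 1 ∧ ContDiff ℝ 2 g ∧
    ∃ w : ℝ → ℂ, MemL2per w ∧
      ∀ x, iteratedDeriv 2 g x = iteratedDeriv 2 g 0 + ∫ y in (0 : ℝ)..x, w y

/-- The scalar product of `L²(ℝ/ℤ)`, skew-linear in its first argument. -/
def innerPer (g h : ℝ → ℂ) : ℂ := ∫ x in (0 : ℝ)..1, (starRingEnd ℂ) (g x) * h x

/-- The norm of `L²(ℝ/ℤ)`. -/
def normPer (g : ℝ → ℂ) : ℝ := Real.sqrt (∫ x in (0 : ℝ)..1, ‖g x‖ ^ 2)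

/-- The spectrum of `L_ξ`, as a (closed) operator on `L²(ℝ/ℤ)` with domain `H³(ℝ/ℤ)`: the complex
numbers `μ` such that `μ - L_ξ` is not a bijection from `H³(ℝ/ℤ)` to `L²(ℝ/ℤ)`. -/
def spectrumPer (f u : ℝ → ℝ) (c k ξ : ℝ) : Set ℂ :=
  {μ | ¬ ∀ g, MemL2per g →
    ∃! w : ℝ → ℂ, MemH3per w ∧
      (fun x => μ * w x - blochSymbol f u c k ξ w x) =ᵐ[volume] g}

/-- `μ` is an eigenvalue of `L_ξ` of algebraic multiplicity one: the kernel of `L_ξ - μ` is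
spanned by a nonzero function, which does not belong to the range of `L_ξ - μ`. -/
def IsSimpleEigenvalue (f u : ℝ → ℝ) (c k ξ : ℝ) (μ : ℂ) : Prop :=
  ∃ p : ℝ → ℂ, MemH3per p ∧ p ≠ 0 ∧
    (blochSymbol f u c k ξ p =ᵐ[volume] fun x => μ * p x) ∧
    (∀ w : ℝ → ℂ, MemH3per w → (blochSymbol f u c k ξ w =ᵐ[volume] fun x => μ * w x) →
      ∃ z : ℂ, ∀ x, w x = z * p x) ∧
    ¬ ∃ w : ℝ → ℂ, MemH3per w ∧
      (fun x => blochSymbol f u c k ξ w x - μ * w x) =ᵐ[volume] p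

/-- `p` belongs to the domain of the adjoint of `L_ξ` and satisfies `L_ξ^* p = conj(μ) p`; by
definition of the adjoint this means `⟨p, L_ξ w⟩ = ⟨conj(μ) p, w⟩` for all `w` in the domain
`H³(ℝ/ℤ)` of `L_ξ`. -/
def IsAdjointEigenfunction (f u : ℝ → ℝ) (c k ξ : ℝ) (μ : ℂ) (p : ℝ → ℂ) : Prop :=
  ∀ w : ℝ → ℂ, MemH3per w →
    innerPer p (blochSymbol f u c k ξ w)
      = innerPer (fun x => (starRingEnd ℂ) μ * p x) w

/-- The interval `[-π, π]` of Floquet exponents. -/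
def floquet : Set ℝ := Icc (-Real.pi) Real.pi

/-- `(lam j ξ)`, `|j| ≥ j₀`, `ξ ∈ [-π, π]`, is the smooth parametrization of the large eigenvalues
of the Bloch symbols: they are purely imaginary and simple, behave as `i k³ (2πj + ξ)³ + O(|j|)`,
and exhaust the spectrum outside some ball. -/
structure IsLargeEigenvalues (f u : ℝ → ℝ) (c k : ℝ) (j₀ : ℕ) (lam : ℤ → ℝ → ℂ) : Prop where
  smooth : ∀ j : ℤ, (j₀ : ℤ) ≤ |j| → ContDiffOn ℝ ∞ (lam j) floquet
  imaginary : ∀ j : ℤ, (j₀ : ℤ) ≤ |j| → ∀ ξ ∈ floquet, (lam j ξ).re = 0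
  simple : ∀ j : ℤ, (j₀ : ℤ) ≤ |j| → ∀ ξ ∈ floquet, IsSimpleEigenvalue f u c k ξ (lam j ξ)
  distinct : ∀ j l : ℤ, (j₀ : ℤ) ≤ |j| → (j₀ : ℤ) ≤ |l| → ∀ ξ ∈ floquet,
    lam j ξ = lam l ξ → j = l
  exhaust : ∃ R : ℝ, ∀ ξ ∈ floquet, ∀ μ ∈ spectrumPer f u c k ξ, R < ‖μ‖ →
    ∃ j : ℤ, (j₀ : ℤ) ≤ |j| ∧ μ = lam j ξ
  asymptotics : ∃ C : ℝ, ∀ j : ℤ, (j₀ : ℤ) ≤ |j| → ∀ ξ ∈ floquet,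
    ‖lam j ξ - Complex.I * k ^ 3 * (2 * Real.pi * j + ξ) ^ 3‖ ≤ C * |(j : ℝ)|
  symm : ∀ j : ℤ, (j₀ : ℤ) ≤ |j| → ∀ ξ ∈ floquet, lam j ξ = -lam (-j) (-ξ)
  matching : ∀ j : ℤ, (j₀ : ℤ) ≤ |j| → (j₀ : ℤ) ≤ |j + 1| → ∀ m : ℕ,
    iteratedDerivWithin m (lam j) floquet Real.pi
      = iteratedDerivWithin m (lam (j + 1)) floquet (-Real.pi)

/-- A family `(p j ξ x)`, `|j| ≥ j₀`, `ξ ∈ [-π, π]`, `x ∈ ℝ`, which is smooth in `(ξ, x)`, has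
period one in `x`, is compatible with complex conjugation, and with the passage from the
exponent `π` to the exponent `-π`. As `e^{iξx} p j ξ x` is the object with an intrinsic meaning,
the latter passage involves a factor `e^{2iπx}`. -/
structure IsBlochFamily (j₀ : ℕ) (p : ℤ → ℝ → ℝ → ℂ) : Prop where
  smooth : ∀ j : ℤ, (j₀ : ℤ) ≤ |j| →
    ContDiffOn ℝ ∞ (fun q : ℝ × ℝ => p j q.1 q.2) (floquet ×ˢ univ)
  periodic : ∀ j : ℤ, (j₀ : ℤ) ≤ |j| → ∀ ξ ∈ floquet, Periodic (p j ξ) 1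
  conj : ∀ j : ℤ, (j₀ : ℤ) ≤ |j| → ∀ ξ ∈ floquet, ∀ x,
    (starRingEnd ℂ) (p j ξ x) = p (-j) (-ξ) x
  matching : ∀ j : ℤ, (j₀ : ℤ) ≤ |j| → (j₀ : ℤ) ≤ |j + 1| → ∀ (m : ℕ) (x : ℝ),
    Complex.exp (2 * Real.pi * Complex.I * x)
        * iteratedDerivWithin m (fun ξ => p j ξ x) floquet Real.pi
      = iteratedDerivWithin m (fun ξ => p (j + 1) ξ x) floquet (-Real.pi)

/-- `φ` and `ψ` are normalized families of direct and dual eigenfunctions associated with the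
eigenvalues `lam`. -/
structure IsEigenfunctionPair (f u : ℝ → ℝ) (c k : ℝ) (j₀ : ℕ) (lam : ℤ → ℝ → ℂ)
    (φ ψ : ℤ → ℝ → ℝ → ℂ) : Prop where
  direct_family : IsBlochFamily j₀ φ
  dual_family : IsBlochFamily j₀ ψ
  direct : ∀ j : ℤ, (j₀ : ℤ) ≤ |j| → ∀ ξ ∈ floquet, ∀ x,
    blochSymbol f u c k ξ (φ j ξ) x = lam j ξ * φ j ξ x
  dual : ∀ j : ℤ, (j₀ : ℤ) ≤ |j| → ∀ ξ ∈ floquet,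
    IsAdjointEigenfunction f u c k ξ (lam j ξ) (ψ j ξ)
  norm_eq : ∀ j : ℤ, (j₀ : ℤ) ≤ |j| → ∀ ξ ∈ floquet, normPer (φ j ξ) = normPer (ψ j ξ)
  pairing : ∀ j : ℤ, (j₀ : ℤ) ≤ |j| → ∀ ξ ∈ floquet, innerPer (ψ j ξ) (φ j ξ) = 1

/-- The remainder `p_j(ξ,x) - e^{2iπjx} (1 + ∑_{1 ≤ l ≤ M} b_l(j,ξ) r_l(x))`. -/
def remainder (p : ℤ → ℝ → ℝ → ℂ) (b : ℕ → ℤ → ℝ → ℂ) (r : ℕ → ℝ → ℂ) (M : ℕ)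
    (j : ℤ) (ξ x : ℝ) : ℂ :=
  p j ξ x - Complex.exp (2 * Real.pi * Complex.I * j * x)
    * (1 + ∑ l ∈ Finset.Icc 1 M, b l j ξ * r l x)

/-- The coefficients `b_l(j,ξ)`, `l ≥ 1`, are smooth in `ξ` and, uniformly in `ξ`,
`∂_ξ^α b_l(j,ξ) = O(|j|^{-(l+α)})`. -/
def CoefficientBounds (j₀ : ℕ) (b : ℕ → ℤ → ℝ → ℂ) : Prop :=
  ∀ l : ℕ, 1 ≤ l →
    (∀ j : ℤ, (j₀ : ℤ) ≤ |j| → ContDiffOn ℝ ∞ (b l j) floquet) ∧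
    ∀ α : ℕ, ∃ C : ℝ, ∀ j : ℤ, (j₀ : ℤ) ≤ |j| → ∀ ξ ∈ floquet,
      ‖iteratedDerivWithin α (b l j) floquet ξ‖ ≤ C * |(j : ℝ)| ^ (-((l : ℤ) + α))

/-- For `α, β ≤ N`, uniformly in `(ξ,x)`, `∂_ξ^α ∂_x^β R_M(j,ξ,x) = O(|j|^{-(M+1+α-β)})`. -/
def RemainderBounds (j₀ : ℕ) (p : ℤ → ℝ → ℝ → ℂ) (b : ℕ → ℤ → ℝ → ℂ) (r : ℕ → ℝ → ℂ)
    (M N : ℕ) : Prop :=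
  ∀ α β : ℕ, α ≤ N → β ≤ N → ∃ C : ℝ, ∀ j : ℤ, (j₀ : ℤ) ≤ |j| → ∀ ξ ∈ floquet, ∀ x : ℝ,
    ‖iteratedDerivWithin α (fun ζ => iteratedDeriv β (remainder p b r M j ζ) x) floquet ξ‖
      ≤ C * |(j : ℝ)| ^ (-((M : ℤ) + 1 + α - β))

end GKdV

end

/-! Conjugation by `e^{2iπjx}` turns the Bloch operator of exponent `ξ` into the one of exponent `κ
= 2πj + ξ`, so `(j, ξ)` enters the eigenvalue problem only through `κ`. The claim becomes the
following: with `h = 1/κ`, the eigenfunction close to the constant 1 is a smooth function `Φ(h, x)`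
up to and including `h = 0`, where it equals 1. Then `φ_j(ξ, x) = e^{2iπjx} Φ(1/(2πj + ξ), x)`, the
`r_ℓ` are the Taylor coefficients of `Φ` at `h = 0`, `b_ℓ = (2πj + ξ)^{-ℓ}`, and each derivative in
`ξ` gains a factor `1/κ`. The matching conditions at `±π` hold because `2πj + π = 2π(j+1) - π`.

To build `Φ`, the eigenvalue is written `i k³ κ³ + κ n` and the eigenfunction `1 + w` with `w` of
zero mean. For a frequency `M = 2πm ≠ 0` the symbol factors as `(κ + M)³ - κ³ = M κ² q(hM)`, where
`q(s) = 3 + 3s + s² ≥ 3/4`. Division by it gives a fixed point equation `w = D n(w) w + E (a + a *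
w)` on Fourier coefficients, where `a` is the sequence of coefficients of the potential `f'(v) - c`,
and `D`, `E` carry a factor `h` and decay like `1/|m|` (`coeffD`, `coeffE`). For small `h` this is a
contraction (`exists_correction`). Derivatives of `D` and `E` in `h` may lose powers of `|m|`, but
`w` decays faster than any power, so the loss is harmless and `w` is smooth in `h`
(`rap_correction`, `exists_smooth_correction`); summing the Fourier series gives the profile
(`exists_isProfile`).

That nothing else lies in the spectrum far from 0 follows from two overlapping regions: if `μ` is at
distance at least a large constant times `1 + |2πm + ξ|` from every `i k³ (2πm + ξ)³`, the potential
is a small perturbation (`uniquelySolvable_far`); otherwise `μ = i k³ κ³ + κ ν` with bounded `ν`,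
and the same contraction shows that only `ν = n(h)` is spectral (`uniquelySolvable_near`).
Simplicity is obtained from the same linear equation (`bounded_kernel`, `eigen_not_range`).

The dual functions come from the structure `L = -k T H`, with `T = ∂ₓ + iκ` skew-adjoint and `H = k²
T² + A` self-adjoint: `⟨HΦ, Φ⟩ ≠ 0` forces the eigenvalue to be imaginary, and then `HΦ` is an
eigenfunction of the adjoint. The rescaled `-(h²/k²) HΦ` is smooth at `h = 0` and agrees with `Φ` to
first order (`deriv_dualProfile`). The normalizing factors are even in `h`, hence do not touch the
first order either (`IsProfile.exists_isNormalizedPair`). This is why `r_1 = r̃_1`. -/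

open scoped ContDiff

noncomputable section

namespace GKdV

open Set MeasureTheory Function

/-! ### Weights on `ℤ`, rapidly decreasing sequences and convolution. -/

/-- The weight `1 + |m|` on `ℤ`. -/
def wt (m : ℤ) : ℝ := 1 + |(m : ℝ)|

lemma one_le_wt (m : ℤ) : 1 ≤ wt m := by simp [wt]

lemma wt_pos (m : ℤ) : 0 < wt m := lt_of_lt_of_le one_pos (one_le_wt m)

lemma wt_zpow_pos (m : ℤ) (s : ℤ) : 0 < wt m ^ s := zpow_pos (wt_pos m) s

lemma wt_neg (m : ℤ) : wt (-m) = wt m := by simp [wt]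

lemma wt_zero : wt 0 = 1 := by simp [wt]

lemma wt_add_le (m l : ℤ) : wt (m + l) ≤ wt m * wt l := by
  unfold wt
  have := abs_add_le (m : ℝ) l
  push_cast
  nlinarith [abs_nonneg (m : ℝ), abs_nonneg (l : ℝ), mul_nonneg (abs_nonneg (m : ℝ)) (abs_nonneg (l : ℝ))]

lemma wt_zpow_mono (m : ℤ) {s s' : ℤ} (h : s ≤ s') : wt m ^ s ≤ wt m ^ s' :=
  zpow_le_zpow_right₀ (one_le_wt m) h

/-- Peetre's inequality. -/
lemma wt_zpow_sub_le (s : ℤ) (m l : ℤ) : wt (m - l) ^ s ≤ wt m ^ s * wt l ^ s.natAbs := by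
  obtain ⟨n, rfl | rfl⟩ := s.eq_nat_or_neg
  · simp only [zpow_natCast, Int.natAbs_natCast, ← mul_pow]
    have := wt_add_le m (-l)
    rw [wt_neg, ← sub_eq_add_neg] at this
    exact pow_le_pow_left₀ (wt_pos _).le this n
  · simp only [zpow_neg, zpow_natCast, Int.natAbs_neg, Int.natAbs_natCast]
    have h := wt_add_le (m - l) l
    rw [sub_add_cancel] at h
    have h2 := pow_le_pow_left₀ (wt_pos _).le h n
    rw [mul_pow] at h2
    have p1 := pow_pos (wt_pos m) n
    have p2 := pow_pos (wt_pos (m - l)) n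
    rw [inv_eq_one_div, inv_mul_eq_div, div_le_div_iff₀ p2 p1]
    linarith

/-- Rapidly decreasing sequences. -/
def RapidSeq (a : ℤ → ℂ) : Prop := ∀ s : ℤ, ∃ C, ∀ m, ‖a m‖ ≤ C * wt m ^ s

lemma summable_wt : Summable fun m : ℤ => wt m ^ (-2 : ℤ) := by
  have h : Summable fun m : ℤ => 1 / |(m : ℝ)| ^ (2 : ℝ) :=
    Real.summable_one_div_int_pow.mpr (by norm_num : 1 < 2) |>.congr fun m => by
      rw [Real.rpow_two, sq_abs]
  refine Summable.of_norm_bounded_eventually h ?_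
  filter_upwards [Set.Finite.compl_mem_cofinite (Set.finite_singleton (0 : ℤ))] with m hm
  have hm' : 0 < |(m : ℝ)| := abs_pos.mpr (by exact_mod_cast hm)
  rw [Real.norm_of_nonneg (wt_zpow_pos _ _).le, zpow_neg, Real.rpow_two, one_div]
  apply inv_anti₀ (by positivity)
  rw [show (2 : ℤ) = ((2 : ℕ) : ℤ) from rfl, zpow_natCast]
  exact pow_le_pow_left₀ hm'.le (by simp [wt]) 2

lemma RapidSeq.summable {a : ℤ → ℂ} (ha : RapidSeq a) (n : ℕ) :
    Summable fun m => ‖a m‖ * wt m ^ n := by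
  obtain ⟨C, hC⟩ := ha (-2 - n)
  refine Summable.of_nonneg_of_le (fun m => mul_nonneg (norm_nonneg _) (pow_nonneg (wt_pos m).le _))
    (fun m => ?_) (summable_wt.mul_left C)
  calc ‖a m‖ * wt m ^ n ≤ C * wt m ^ (-2 - n : ℤ) * wt m ^ n :=
        mul_le_mul_of_nonneg_right (hC m) (pow_nonneg (wt_pos m).le _)
    _ = C * wt m ^ (-2 : ℤ) := by
        rw [← zpow_natCast, mul_assoc, ← zpow_add₀ (wt_pos m).ne']; congr 2; ring

lemma RapidSeq.summable_norm {a : ℤ → ℂ} (ha : RapidSeq a) : Summable fun m => ‖a m‖ := by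
  simpa using ha.summable 0

/-- Convolution of sequences. -/
def conv (a y : ℤ → ℂ) (m : ℤ) : ℂ := ∑' l, a l * y (m - l)

lemma conv_term_le {a y : ℤ → ℂ} {C : ℝ} {s : ℤ} (hC : 0 ≤ C) (hy : ∀ m, ‖y m‖ ≤ C * wt m ^ s)
    (m l : ℤ) : ‖a l * y (m - l)‖ ≤ (‖a l‖ * wt l ^ s.natAbs) * (C * wt m ^ s) := by
  rw [norm_mul]
  calc ‖a l‖ * ‖y (m - l)‖ ≤ ‖a l‖ * (C * (wt m ^ s * wt l ^ s.natAbs)) := by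
        refine mul_le_mul_of_nonneg_left ((hy _).trans ?_) (norm_nonneg _)
        exact mul_le_mul_of_nonneg_left (wt_zpow_sub_le s m l) hC
    _ = _ := by ring

lemma conv_summable {a y : ℤ → ℂ} (ha : RapidSeq a) {C : ℝ} {s : ℤ}
    (hy : ∀ m, ‖y m‖ ≤ C * wt m ^ s) (m : ℤ) : Summable fun l => a l * y (m - l) := by
  have hC : 0 ≤ C := by
    have := (norm_nonneg _).trans (hy 0)
    simpa [wt_zero] using this
  exact Summable.of_norm_bounded ((ha.summable s.natAbs).mul_right _) (conv_term_le hC hy m)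

/-- Peetre's inequality moves the weight from `m - l` to `m` at the price of a power of `wt l`,
which the decay of `a` absorbs. Thus convolution with `a` preserves growth and decay of every order.
-/
lemma conv_le {a y : ℤ → ℂ} (ha : RapidSeq a) {C : ℝ} {s : ℤ}
    (hy : ∀ m, ‖y m‖ ≤ C * wt m ^ s) (m : ℤ) :
    ‖conv a y m‖ ≤ (∑' l, ‖a l‖ * wt l ^ s.natAbs) * C * wt m ^ s := by
  have hC : 0 ≤ C := by
    have := (norm_nonneg _).trans (hy 0)
    simpa [wt_zero] using this
  have h := tsum_of_norm_bounded ((ha.summable s.natAbs).mul_right (C * wt m ^ s)).hasSum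
    (conv_term_le hC hy m)
  rw [tsum_mul_right, ← mul_assoc] at h
  exact h

lemma conv_le_sup {a y : ℤ → ℂ} (ha : RapidSeq a) {C : ℝ} (hy : ∀ m, ‖y m‖ ≤ C) (m : ℤ) :
    ‖conv a y m‖ ≤ (∑' l, ‖a l‖) * C := by
  have := conv_le ha (s := 0) (C := C) (by simpa using hy) m
  simpa using this

lemma conv_summable_sup {a y : ℤ → ℂ} (ha : RapidSeq a) {C : ℝ} (hy : ∀ m, ‖y m‖ ≤ C) (m : ℤ) :
    Summable fun l => a l * y (m - l) :=
  conv_summable ha (s := 0) (C := C) (by simpa using hy) m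

lemma conv_add {a y z : ℤ → ℂ} (ha : RapidSeq a) {C C' : ℝ} (hy : ∀ m, ‖y m‖ ≤ C)
    (hz : ∀ m, ‖z m‖ ≤ C') (m : ℤ) :
    conv a (fun l => y l + z l) m = conv a y m + conv a z m := by
  unfold conv
  rw [← (conv_summable_sup ha hy m).tsum_add (conv_summable_sup ha hz m)]
  simp only [mul_add]

lemma conv_sub {a y z : ℤ → ℂ} (ha : RapidSeq a) {C C' : ℝ} (hy : ∀ m, ‖y m‖ ≤ C)
    (hz : ∀ m, ‖z m‖ ≤ C') (m : ℤ) :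
    conv a (fun l => y l - z l) m = conv a y m - conv a z m := by
  unfold conv
  rw [← (conv_summable_sup ha hy m).tsum_sub (conv_summable_sup ha hz m)]
  simp only [mul_sub]

lemma conv_const_mul (a y : ℤ → ℂ) (c : ℂ) (m : ℤ) :
    conv a (fun l => c * y l) m = c * conv a y m := by
  unfold conv
  rw [← tsum_mul_left]
  congr 1; ext l; ring

lemma conv_shift (a y : ℤ → ℂ) (j m : ℤ) :
    conv a (fun l => y (l + j)) m = conv a y (m + j) := by
  unfold conv
  exact tsum_congr fun l => by
    show a l * y (m - l + j) = _
    rw [sub_add_eq_add_sub]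

lemma conv_single (a : ℤ → ℂ) (m : ℤ) : conv a (fun l => if l = 0 then 1 else 0) m = a m := by
  unfold conv
  rw [tsum_eq_single m]
  · simp
  · intro l hl
    simp only
    rw [if_neg (fun h => hl (by omega)), mul_zero]

/-! ### Fixed points and a priori bounds for the linear equation `y = lop y + g`. -/

/-- A half-contraction of a ball of bounded sequences has exactly one fixed point. -/
lemma exists_fixedPoint (Φ : (ℤ → ℂ) → ℤ → ℂ) (ρ : ℝ) (hρ : 0 ≤ ρ)
    (hmaps : ∀ y, (∀ m, ‖y m‖ ≤ ρ) → ∀ m, ‖Φ y m‖ ≤ ρ)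
    (hlip : ∀ y z, (∀ m, ‖y m‖ ≤ ρ) → (∀ m, ‖z m‖ ≤ ρ) → ∀ C, (∀ m, ‖y m - z m‖ ≤ C) →
      ∀ m, ‖Φ y m - Φ z m‖ ≤ C / 2) :
    ∃ y, (∀ m, ‖y m‖ ≤ ρ) ∧ (∀ m, Φ y m = y m) ∧
      ∀ z, (∀ m, ‖z m‖ ≤ ρ) → (∀ m, Φ z m = z m) → z = y := by
  -- Picard iteration, with the supremum norm present only through uniform bounds: the iterates
  -- converge for each `m`, with a rate independent of `m`, so the limit stays in the ball and is
  -- fixed.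
  let u : ℕ → ℤ → ℂ := fun n => Φ^[n] 0
  have usucc : ∀ n, u (n + 1) = Φ (u n) := fun n => Function.iterate_succ_apply' Φ n 0
  have ub : ∀ n m, ‖u n m‖ ≤ ρ := by
    intro n
    induction n with
    | zero => intro m; simpa [u] using hρ
    | succ n ih => rw [usucc]; exact hmaps _ ih
  have ud : ∀ n m, ‖u n m - u (n + 1) m‖ ≤ 2 * ρ / 2 / 2 ^ n * 2 := by
    intro n
    induction n with
    | zero =>
      intro m
      have := norm_sub_le (u 0 m) (u 1 m)
      have h1 := ub 0 m
      have h2 := ub 1 m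
      simp only [zero_add, pow_zero]
      linarith
    | succ n ih =>
      intro m
      have := hlip _ _ (ub n) (ub (n + 1)) _ ih m
      rw [← usucc, ← usucc] at this
      refine this.trans (le_of_eq ?_)
      rw [pow_succ]; field_simp
  have uc : ∀ m, CauchySeq fun n => u n m := fun m =>
    cauchySeq_of_le_geometric_two (C := 4 * ρ) fun n => by
      rw [dist_eq_norm]; refine (ud n m).trans (le_of_eq ?_); ring
  choose y hy using fun m => cauchySeq_tendsto_of_complete (uc m)
  have hyd : ∀ n m, ‖u n m - y m‖ ≤ 4 * ρ / 2 ^ n := fun n m => by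
    rw [← dist_eq_norm]
    exact dist_le_of_le_geometric_two_of_tendsto (C := 4 * ρ) (fun n => by
      rw [dist_eq_norm]; refine (ud n m).trans (le_of_eq ?_); ring) (hy m) n
  have hyb : ∀ m, ‖y m‖ ≤ ρ := fun m =>
    le_of_tendsto (hy m).norm (Filter.Eventually.of_forall fun n => ub n m)
  have hfix : ∀ m, Φ y m = y m := by
    intro m
    have h0 : Filter.Tendsto (fun n : ℕ => 4 * ρ / 2 ^ n / 2) Filter.atTop (nhds 0) := by
      have := (tendsto_pow_atTop_nhds_zero_of_lt_one (r := (1 / 2 : ℝ)) (by norm_num)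
        (by norm_num)).const_mul (4 * ρ / 2)
      rw [mul_zero] at this
      refine this.congr fun n => ?_
      rw [one_div, inv_pow]; ring
    have h1 : Filter.Tendsto (fun n => u (n + 1) m) Filter.atTop (nhds (Φ y m)) := by
      rw [tendsto_iff_norm_sub_tendsto_zero]
      refine squeeze_zero (fun _ => norm_nonneg _) (fun n => ?_) h0
      rw [usucc]
      exact hlip _ _ (ub n) hyb _ (hyd n) m
    exact tendsto_nhds_unique h1 ((Filter.tendsto_add_atTop_iff_nat 1).mpr (hy m))
  refine ⟨y, hyb, hfix, fun z hzb hz => ?_⟩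
  have hd : ∀ n : ℕ, ∀ m, ‖z m - y m‖ ≤ 2 * ρ / 2 ^ n := by
    intro n
    induction n with
    | zero =>
      intro m
      have := norm_sub_le (z m) (y m)
      have h1 := hzb m
      have h2 := hyb m
      simp only [pow_zero]
      linarith
    | succ n ih =>
      intro m
      have := hlip _ _ hzb hyb _ ih m
      rw [hz, hfix] at this
      refine this.trans (le_of_eq ?_)
      rw [pow_succ]; field_simp
  ext m
  have h0 : Filter.Tendsto (fun n : ℕ => 2 * ρ / 2 ^ n) Filter.atTop (nhds 0) := by
    have := (tendsto_pow_atTop_nhds_zero_of_lt_one (r := (1 / 2 : ℝ)) (by norm_num)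
      (by norm_num)).const_mul (2 * ρ)
    rw [mul_zero] at this
    refine this.congr fun n => ?_
    rw [one_div, inv_pow]; ring
  have := ge_of_tendsto' h0 (fun n => hd n m)
  exact sub_eq_zero.mp (norm_le_zero_iff.mp this)

/-- The operator `y ↦ α y + e (a * y) + β (a * y)₀` on sequences. -/
def lop (a α e β y : ℤ → ℂ) (m : ℤ) : ℂ := α m * y m + e m * conv a y m + β m * conv a y 0

/-- The shape of `lop` is that of the increments of the nonlinear map `corrMap`, the rank-one `β`
term being due to the variation of the scalar in it. The sum in `hs` bounds the operator norm on
bounded sequences. -/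
lemma lop_le {a α e β : ℤ → ℂ} (ha : RapidSeq a) {c : ℝ} 
    (hs : ∀ m, ‖α m‖ + ‖e m‖ * (∑' l, ‖a l‖) + ‖β m‖ * (∑' l, ‖a l‖) ≤ c)
    {y : ℤ → ℂ} {C : ℝ} (hy : ∀ m, ‖y m‖ ≤ C) (m : ℤ) : ‖lop a α e β y m‖ ≤ c * C := by
  have hC : 0 ≤ C := (norm_nonneg _).trans (hy 0)
  have h1 := conv_le_sup ha hy
  have : ‖lop a α e β y m‖ ≤ ‖α m‖ * C + ‖e m‖ * ((∑' l, ‖a l‖) * C)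
      + ‖β m‖ * ((∑' l, ‖a l‖) * C) := by
    unfold lop
    refine (norm_add₃_le).trans ?_
    rw [norm_mul, norm_mul, norm_mul]
    gcongr
    · exact hy m
    · exact h1 m
    · exact h1 0
  refine this.trans ?_
  calc _ = (‖α m‖ + ‖e m‖ * (∑' l, ‖a l‖) + ‖β m‖ * (∑' l, ‖a l‖)) * C := by ring
    _ ≤ c * C := by gcongr; exact hs m

lemma lop_sub {a α e β y z : ℤ → ℂ} (ha : RapidSeq a) {C C' : ℝ} (hy : ∀ m, ‖y m‖ ≤ C)
    (hz : ∀ m, ‖z m‖ ≤ C') (m : ℤ) :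
    lop a α e β (fun l => y l - z l) m = lop a α e β y m - lop a α e β z m := by
  unfold lop; rw [conv_sub ha hy hz, conv_sub ha hy hz]; ring

lemma lop_const_mul (a α e β y : ℤ → ℂ) (c : ℂ) (m : ℤ) :
    lop a α e β (fun l => c * y l) m = c * lop a α e β y m := by
  unfold lop; rw [conv_const_mul, conv_const_mul]; ring

/-- `y = lop y + g` has exactly one bounded solution when the operator is a half-contraction. -/
lemma exists_lop_solution {a α e β : ℤ → ℂ} (ha : RapidSeq a)
    (hs : ∀ m, ‖α m‖ + ‖e m‖ * (∑' l, ‖a l‖) + ‖β m‖ * (∑' l, ‖a l‖) ≤ 1 / 2)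
    {g : ℤ → ℂ} {G : ℝ} (hg : ∀ m, ‖g m‖ ≤ G) :
    ∃ y, (∀ m, ‖y m‖ ≤ 2 * G) ∧ ∀ m, y m = lop a α e β y m + g m := by
  have hG : 0 ≤ G := (norm_nonneg _).trans (hg 0)
  obtain ⟨y, h1, h2, -⟩ := exists_fixedPoint (fun y m => lop a α e β y m + g m) (2 * G)
    (by linarith) (fun y hy m => by
      have := lop_le ha hs hy m
      refine (norm_add_le _ _).trans ?_
      have := hg m
      linarith)
    (fun y z hy hz C hC m => by
      have := lop_le ha hs hC m
      rw [lop_sub ha hy hz] at this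
      rw [add_sub_add_right_eq_sub]
      linarith)
  exact ⟨y, h1, fun m => (h2 m).symm⟩

/-- The supremum `s` of `‖y m‖` satisfies `s ≤ s / 2 + G`; the qualitative bound `B` serves only to
make it finite, and does not enter the conclusion. -/
lemma lop_solution_le {a α e β : ℤ → ℂ} (ha : RapidSeq a)
    (hs : ∀ m, ‖α m‖ + ‖e m‖ * (∑' l, ‖a l‖) + ‖β m‖ * (∑' l, ‖a l‖) ≤ 1 / 2)
    {g y : ℤ → ℂ} {G B : ℝ} (hg : ∀ m, ‖g m‖ ≤ G) (hB : ∀ m, ‖y m‖ ≤ B)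
    (hy : ∀ m, y m = lop a α e β y m + g m) (m : ℤ) : ‖y m‖ ≤ 2 * G := by
  have hbd : BddAbove (range fun m => ‖y m‖) := ⟨B, by rintro _ ⟨m, rfl⟩; exact hB m⟩
  have h1 : ∀ m, ‖y m‖ ≤ ⨆ m, ‖y m‖ := fun m => le_ciSup hbd m
  have h2 : (⨆ m, ‖y m‖) ≤ 1 / 2 * (⨆ m, ‖y m‖) + G := ciSup_le fun m => by
    rw [hy m]
    refine (norm_add_le _ _).trans (add_le_add ?_ (hg m))
    exact lop_le ha hs h1 m
  have := h1 m
  linarith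

lemma lop_solution_unique {a α e β : ℤ → ℂ} (ha : RapidSeq a)
    (hs : ∀ m, ‖α m‖ + ‖e m‖ * (∑' l, ‖a l‖) + ‖β m‖ * (∑' l, ‖a l‖) ≤ 1 / 2)
    {g y z : ℤ → ℂ} {B B' : ℝ} (hB : ∀ m, ‖y m‖ ≤ B) (hB' : ∀ m, ‖z m‖ ≤ B')
    (hy : ∀ m, y m = lop a α e β y m + g m) (hz : ∀ m, z m = lop a α e β z m + g m) : y = z := by
  ext m
  have := lop_solution_le ha hs (g := 0) (y := fun m => y m - z m) (G := 0) (B := B + B')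
    (by simp) (fun m => (norm_sub_le _ _).trans (add_le_add (hB m) (hB' m)))
    (fun m => by
      rw [lop_sub ha hB hB']
      conv_lhs => rw [hy m, hz m]
      simp) m
  simp only [mul_zero] at this
  exact sub_eq_zero.mp (norm_le_zero_iff.mp this)

/-- Uniform weighted bounds for the bounded solutions of `η = lop η + f`, when the coefficients of
the operator gain one power of the weight. -/
lemma lop_apriori {ι : Type*} {a : ℤ → ℂ} (ha : RapidSeq a) {α e β : ι → ℤ → ℂ}
    (hs : ∀ i m, ‖α i m‖ + ‖e i m‖ * (∑' l, ‖a l‖) + ‖β i m‖ * (∑' l, ‖a l‖) ≤ 1 / 2)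
    {c : ℝ} (hα : ∀ i m, ‖α i m‖ ≤ c * wt m ^ (-1 : ℤ)) (he : ∀ i m, ‖e i m‖ ≤ c * wt m ^ (-1 : ℤ))
    (hβ : ∀ s : ℤ, ∃ C, ∀ i m, ‖β i m‖ ≤ C * wt m ^ s)
    {δ : ι → ℝ} (hδ : ∀ i, 0 ≤ δ i) {f η : ι → ℤ → ℂ}
    (hf : ∀ s : ℤ, ∃ C, ∀ i m, ‖f i m‖ ≤ C * wt m ^ s * δ i)
    (hb : ∀ i, ∃ B, ∀ m, ‖η i m‖ ≤ B) (hη : ∀ i m, η i m = lop a (α i) (e i) (β i) (η i) m + f i m)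
    (s : ℤ) : ∃ C, ∀ i m, ‖η i m‖ ≤ C * wt m ^ s * δ i := by
  -- Bootstrap: convolution keeps the weight, `α` and `e` contribute one more negative power, while
  -- `β` and `f` decay at will. The factor `δ i` is carried along so that the same estimate later
  -- controls differences in the parameter.
  have key : ∀ n : ℕ, ∃ C, 0 ≤ C ∧ ∀ i m, ‖η i m‖ ≤ C * wt m ^ (-(n : ℤ)) * δ i := by
    intro n
    induction n with
    | zero =>
      obtain ⟨C, hC⟩ := hf 0
      refine ⟨2 * |C|, by positivity, fun i m => ?_⟩
      obtain ⟨B, hB⟩ := hb i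
      have := lop_solution_le ha (hs i) (g := f i) (G := |C| * δ i) (fun m => by
        refine (hC i m).trans ?_
        simp only [zpow_zero, mul_one]
        exact mul_le_mul_of_nonneg_right (le_abs_self C) (hδ i)) hB (hη i) m
      simp only [Int.natCast_zero, neg_zero, zpow_zero, mul_one]
      linarith
    | succ n ih =>
      obtain ⟨C, hC0, hC⟩ := ih
      obtain ⟨C1, hC1⟩ := hf (-((n + 1 : ℕ) : ℤ))
      obtain ⟨C2, hC2⟩ := hβ (-((n + 1 : ℕ) : ℤ))
      set S := ∑' l, ‖a l‖ * wt l ^ (-(n : ℤ)).natAbs with hS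
      have hS0 : 0 ≤ S := tsum_nonneg fun l => mul_nonneg (norm_nonneg _) (pow_nonneg (wt_pos l).le _)
      refine ⟨|c| * C + |c| * (S * C) + |C2| * (S * C) + |C1|, by positivity, fun i m => ?_⟩
      have hcv := conv_le ha (s := -(n : ℤ)) (C := C * δ i) (y := η i) (fun m => by
        have := hC i m; linarith)
      have hw : wt m ^ (-1 : ℤ) * wt m ^ (-(n : ℤ)) = wt m ^ (-((n + 1 : ℕ) : ℤ)) := by
        rw [← zpow_add₀ (wt_pos m).ne']; congr 1; push_cast; ring
      have p1 := (wt_zpow_pos m (-1)).le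
      have pn := (wt_zpow_pos m (-(n:ℤ))).le
      have pn1 := (wt_zpow_pos m (-((n + 1 : ℕ) : ℤ))).le
      have d0 := hδ i
      have h1 : ‖α i m * η i m‖ ≤ (|c| * wt m ^ (-1 : ℤ)) * (C * wt m ^ (-(n : ℤ)) * δ i) := by
        rw [norm_mul]
        exact mul_le_mul ((hα i m).trans (mul_le_mul_of_nonneg_right (le_abs_self c) p1)) (hC i m)
          (norm_nonneg _) (by positivity)
      have h2 : ‖e i m * conv a (η i) m‖ ≤
          (|c| * wt m ^ (-1 : ℤ)) * (S * (C * δ i) * wt m ^ (-(n : ℤ))) := by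
        rw [norm_mul]
        exact mul_le_mul ((he i m).trans (mul_le_mul_of_nonneg_right (le_abs_self c) p1)) (hcv m)
          (norm_nonneg _) (by positivity)
      have h3 : ‖β i m * conv a (η i) 0‖ ≤
          (|C2| * wt m ^ (-((n + 1 : ℕ) : ℤ))) * (S * (C * δ i)) := by
        rw [norm_mul]
        have := hcv 0
        rw [wt_zero, one_zpow, mul_one] at this
        exact mul_le_mul ((hC2 i m).trans (mul_le_mul_of_nonneg_right (le_abs_self C2) pn1)) this
          (norm_nonneg _) (by positivity)
      have h4 : ‖f i m‖ ≤ |C1| * wt m ^ (-((n + 1 : ℕ) : ℤ)) * δ i := by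
        refine (hC1 i m).trans ?_
        gcongr
        exact le_abs_self C1
      rw [hη i m]
      unfold lop
      calc _ ≤ ‖α i m * η i m‖ + ‖e i m * conv a (η i) m‖ + ‖β i m * conv a (η i) 0‖ + ‖f i m‖ :=
            (norm_add_le _ _).trans (add_le_add_left norm_add₃_le _)
        _ ≤ _ := add_le_add (add_le_add (add_le_add h1 h2) h3) h4
        _ = _ := by rw [← hw]; ring
  obtain ⟨C, hC0, hC⟩ := key s.natAbs
  refine ⟨C, fun i m => (hC i m).trans ?_⟩
  have := wt_zpow_mono m (s := -(s.natAbs : ℤ)) (s' := s) (by omega)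
  have := hδ i
  gcongr

/-! ### Sequences depending on a real parameter: tempered and rapidly decreasing families. -/

/-- Families `y m t` with bounds `C * (1 + |m|) ^ s`, uniformly in `t`, on the values and on the
Lipschitz constants in `t`. -/
structure ClsZero (s : ℤ) (y : ℤ → ℝ → ℂ) : Prop where
  out : ∃ C, 0 ≤ C ∧ (∀ m t, ‖y m t‖ ≤ C * wt m ^ s) ∧
      ∀ m t t', ‖y m t - y m t'‖ ≤ C * wt m ^ s * |t - t'|

/-- Families `y m t` which are `r` times differentiable in `t` with Lipschitz `r`-th derivative,
all bounds being of the form `C * (1 + |m|) ^ s`, uniformly in `t`. -/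
inductive Cls : ℕ → ℤ → (ℤ → ℝ → ℂ) → Prop
  | base {s : ℤ} {y : ℤ → ℝ → ℂ} (h : ClsZero s y) : Cls 0 s y
  | step {r : ℕ} {s : ℤ} {y : ℤ → ℝ → ℂ} (h : ClsZero s y) (hd : ∀ m, Differentiable ℝ (y m))
      (h' : Cls r s (fun m => deriv (y m))) : Cls (r + 1) s y

/-- Families with tempered bounds. -/
def Temp (r : ℕ) (y : ℤ → ℝ → ℂ) : Prop := ∃ s, Cls r s y

/-- Rapidly decreasing families. -/
def Rap (r : ℕ) (y : ℤ → ℝ → ℂ) : Prop := ∀ s, Cls r s y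

lemma Cls.zero {r : ℕ} {s : ℤ} {y : ℤ → ℝ → ℂ} (h : Cls r s y) : ClsZero s y := by
  cases h with
  | base h => exact h
  | step h _ _ => exact h

lemma Cls.differentiable {r : ℕ} {s : ℤ} {y : ℤ → ℝ → ℂ} (h : Cls (r + 1) s y) (m : ℤ) :
    Differentiable ℝ (y m) := by
  cases h with | step _ hd _ => exact hd m

lemma Cls.deriv {r : ℕ} {s : ℤ} {y : ℤ → ℝ → ℂ} (h : Cls (r + 1) s y) :
    Cls r s (fun m => deriv (y m)) := by
  cases h with | step _ _ h' => exact h'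

lemma Cls.pred {r : ℕ} {s : ℤ} {y : ℤ → ℝ → ℂ} (h : Cls (r + 1) s y) : Cls r s y := by
  induction r generalizing y with
  | zero => exact .base h.zero
  | succ r ih => exact .step h.zero h.differentiable (ih h.deriv)

lemma Cls.mono {r : ℕ} {s s' : ℤ} (hs : s ≤ s') {y : ℤ → ℝ → ℂ} (h : Cls r s y) : Cls r s' y := by
  have h0 : ∀ {y : ℤ → ℝ → ℂ}, ClsZero s y → ClsZero s' y := by
    rintro y ⟨⟨C, hC, h1, h2⟩⟩
    refine ⟨⟨C, hC, fun m t => (h1 m t).trans ?_, fun m t t' => (h2 m t t').trans ?_⟩⟩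
    · exact mul_le_mul_of_nonneg_left (wt_zpow_mono m hs) hC
    · have := wt_zpow_mono m hs
      gcongr
  induction r generalizing y with
  | zero => exact .base (h0 h.zero)
  | succ r ih => exact .step (h0 h.zero) h.differentiable (ih h.deriv)

lemma Rap.pred {r : ℕ} {y : ℤ → ℝ → ℂ} (h : Rap (r + 1) y) : Rap r y := fun s => (h s).pred

lemma Temp.pred {r : ℕ} {y : ℤ → ℝ → ℂ} (h : Temp (r + 1) y) : Temp r y :=
  let ⟨s, hs⟩ := h; ⟨s, hs.pred⟩

lemma Rap.zero {r : ℕ} {y : ℤ → ℝ → ℂ} (h : Rap r y) : Rap 0 y := fun s => .base (h s).zero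

lemma Temp.zero {r : ℕ} {y : ℤ → ℝ → ℂ} (h : Temp r y) : Temp 0 y :=
  let ⟨s, hs⟩ := h; ⟨s, .base hs.zero⟩

lemma Rap.deriv {r : ℕ} {y : ℤ → ℝ → ℂ} (h : Rap (r + 1) y) : Rap r (fun m => deriv (y m)) :=
  fun s => (h s).deriv

lemma Temp.deriv {r : ℕ} {y : ℤ → ℝ → ℂ} (h : Temp (r + 1) y) : Temp r (fun m => deriv (y m)) :=
  let ⟨s, hs⟩ := h; ⟨s, hs.deriv⟩

/-- The Lipschitz bound on `y` is the mean value inequality applied with the bound on the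
derivative, so only sizes have to be checked. -/
lemma cls_succ_of_deriv {r : ℕ} {s : ℤ} {y : ℤ → ℝ → ℂ} {C : ℝ}
    (hb : ∀ m t, ‖y m t‖ ≤ C * wt m ^ s)
    (hd : ∀ m, Differentiable ℝ (y m)) (h : Cls r s (fun m => _root_.deriv (y m))) :
    Cls (r + 1) s y := by
  refine .step ?_ hd h
  obtain ⟨C', hC', h1, -⟩ := h.zero.out
  refine ⟨⟨|C| + C', by positivity, fun m t => (hb m t).trans ?_, fun m t t' => ?_⟩⟩
  · have := (wt_zpow_pos m s).le
    have h3 := le_abs_self C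
    gcongr
    linarith
  · have h2 := Convex.norm_image_sub_le_of_norm_deriv_le (𝕜 := ℝ) (f := y m) (s := univ) (x := t')
      (y := t) (C := C' * wt m ^ s) (fun x _ => (hd m x)) (fun x _ => h1 m x) convex_univ
      (mem_univ _) (mem_univ _)
    rw [Real.norm_eq_abs] at h2
    refine h2.trans ?_
    have := (wt_zpow_pos m s).le
    gcongr
    linarith [abs_nonneg C]

lemma Cls.add {r : ℕ} {s : ℤ} {y z : ℤ → ℝ → ℂ} (hy : Cls r s y) (hz : Cls r s z) :
    Cls r s (fun m t => y m t + z m t) := by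
  have h0 : ∀ {y z : ℤ → ℝ → ℂ}, ClsZero s y → ClsZero s z → ClsZero s (fun m t => y m t + z m t) := by
    rintro y z ⟨⟨C, hC, h1, h2⟩⟩ ⟨⟨C', hC', h1', h2'⟩⟩
    refine ⟨⟨C + C', by positivity, fun m t => ?_, fun m t t' => ?_⟩⟩
    · refine (norm_add_le _ _).trans ?_
      linarith [h1 m t, h1' m t]
    · rw [add_sub_add_comm]
      refine (norm_add_le _ _).trans ?_
      linarith [h2 m t t', h2' m t t']
  induction r generalizing y z with
  | zero => exact .base (h0 hy.zero hz.zero)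
  | succ r ih =>
    refine .step (h0 hy.zero hz.zero) (fun m => (hy.differentiable m).add (hz.differentiable m)) ?_
    convert ih hy.deriv hz.deriv using 3 with m t
    exact deriv_fun_add (hy.differentiable m _) (hz.differentiable m _)

lemma Cls.mul {r : ℕ} {s s' : ℤ} {y z : ℤ → ℝ → ℂ} (hy : Cls r s y) (hz : Cls r s' z) :
    Cls r (s + s') (fun m t => y m t * z m t) := by
  have h0 : ∀ {y z : ℤ → ℝ → ℂ}, ClsZero s y → ClsZero s' z →
      ClsZero (s + s') (fun m t => y m t * z m t) := by
    rintro y z ⟨⟨C, hC, h1, h2⟩⟩ ⟨⟨C', hC', h1', h2'⟩⟩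
    have hw : ∀ m, wt m ^ (s + s') = wt m ^ s * wt m ^ s' := fun m => zpow_add₀ (wt_pos m).ne' _ _
    refine ⟨⟨2 * (C * C'), by positivity, fun m t => ?_, fun m t t' => ?_⟩⟩
    · have p := (wt_zpow_pos m s).le
      have p' := (wt_zpow_pos m s').le
      rw [norm_mul, hw]
      have := mul_le_mul (h1 m t) (h1' m t) (norm_nonneg _) (by positivity)
      have h3 : 0 ≤ C * wt m ^ s * (C' * wt m ^ s') := by positivity
      nlinarith
    · have p := (wt_zpow_pos m s).le
      have p' := (wt_zpow_pos m s').le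
      have e : y m t * z m t - y m t' * z m t' = (y m t - y m t') * z m t
          + y m t' * (z m t - z m t') := by ring
      rw [e, hw]
      refine (norm_add_le _ _).trans ?_
      rw [norm_mul, norm_mul]
      have a1 := mul_le_mul (h2 m t t') (h1' m t) (norm_nonneg _) (by positivity)
      have a2 := mul_le_mul (h1 m t') (h2' m t t') (norm_nonneg _) (by positivity)
      linarith
  induction r generalizing y z with
  | zero => exact .base (h0 hy.zero hz.zero)
  | succ r ih =>
    refine .step (h0 hy.zero hz.zero) (fun m => (hy.differentiable m).mul (hz.differentiable m)) ?_
    convert (ih hy.deriv hz.pred).add (ih hy.pred hz.deriv) using 3 with m t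
    exact deriv_fun_mul (hy.differentiable m _) (hz.differentiable m _)

lemma cls_const (r : ℕ) {s : ℤ} {c : ℤ → ℂ} {C : ℝ} (hc : ∀ m, ‖c m‖ ≤ C * wt m ^ s) :
    Cls r s (fun m _ => c m) := by
  have hC : 0 ≤ C := by
    have := (norm_nonneg _).trans (hc 0)
    simpa [wt_zero] using this
  have h0 : ClsZero s (fun m (_ : ℝ) => c m) := by
    refine ⟨⟨C, hC, fun m _ => hc m, fun m t t' => ?_⟩⟩
    have := (wt_zpow_pos m s).le
    simp only [sub_self, norm_zero]
    positivity
  have hz : ∀ r, Cls r s (fun (_ : ℤ) (_ : ℝ) => (0 : ℂ)) := by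
    intro r
    have hz0 : ClsZero s (fun (_ : ℤ) (_ : ℝ) => (0 : ℂ)) := by
      exact ⟨⟨0, le_rfl, fun m _ => by simp, fun m t t' => by simp⟩⟩
    induction r with
    | zero => exact .base hz0
    | succ r ih => exact .step hz0 (fun m => differentiable_const _) (by simpa using ih)
  cases r with
  | zero => exact .base h0
  | succ r => exact .step h0 (fun m => differentiable_const _) (by simpa using hz r)

lemma temp_const (r : ℕ) (c : ℂ) : Temp r (fun _ _ => c) :=
  ⟨0, cls_const r (C := ‖c‖) (by simp)⟩

lemma rap_const (r : ℕ) {a : ℤ → ℂ} (ha : RapidSeq a) : Rap r (fun m _ => a m) :=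
  fun s => let ⟨_, hC⟩ := ha s; cls_const r hC

lemma Temp.add {r : ℕ} {y z : ℤ → ℝ → ℂ} (hy : Temp r y) (hz : Temp r z) :
    Temp r (fun m t => y m t + z m t) :=
  let ⟨s, hs⟩ := hy; let ⟨s', hs'⟩ := hz
  ⟨max s s', (hs.mono (le_max_left _ _)).add (hs'.mono (le_max_right _ _))⟩

lemma Temp.mul {r : ℕ} {y z : ℤ → ℝ → ℂ} (hy : Temp r y) (hz : Temp r z) :
    Temp r (fun m t => y m t * z m t) :=
  let ⟨s, hs⟩ := hy; let ⟨s', hs'⟩ := hz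
  ⟨s + s', hs.mul hs'⟩

lemma Rap.add {r : ℕ} {y z : ℤ → ℝ → ℂ} (hy : Rap r y) (hz : Rap r z) :
    Rap r (fun m t => y m t + z m t) := fun s => (hy s).add (hz s)

/-- This is what the two classes are for: a loss of any fixed power of the weight in the
coefficients is absorbed by the decay of the sequence that they multiply. -/
lemma Temp.mul_rap {r : ℕ} {y z : ℤ → ℝ → ℂ} (hy : Temp r y) (hz : Rap r z) :
    Rap r (fun m t => y m t * z m t) := fun s => by
  obtain ⟨s', hs'⟩ := hy
  have := hs'.mul (hz (s - s'))
  rwa [add_sub_cancel] at this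

lemma Rap.mul_temp {r : ℕ} {y z : ℤ → ℝ → ℂ} (hy : Rap r y) (hz : Temp r z) :
    Rap r (fun m t => y m t * z m t) := by
  simpa only [mul_comm] using hz.mul_rap hy

/-- The inverse of a tempered family which is bounded from below is tempered. -/
lemma Temp.inv {r : ℕ} {y : ℤ → ℝ → ℂ} (hy : Temp r y) {c : ℝ} (hc : 0 < c)
    (h : ∀ m t, c ≤ ‖y m t‖) : Temp r (fun m t => (y m t)⁻¹) := by
  have hne : ∀ m t, y m t ≠ 0 := fun m t => norm_pos_iff.mp (hc.trans_le (h m t))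
  have hb : ∀ m t, ‖(y m t)⁻¹‖ ≤ c⁻¹ := fun m t => by
    rw [norm_inv]; exact inv_anti₀ hc (h m t)
  induction r with
  | zero =>
    obtain ⟨s, hy⟩ := hy
    obtain ⟨C, hC, h1, h2⟩ := hy.zero.out
    -- The bound `c⁻¹` on the inverse has no decay, so the exponent must be nonnegative; it is also
    -- at least `s`, for the Lipschitz bound inherited from `y`.
    refine ⟨max s 0, .base ⟨⟨c⁻¹ + C * (c⁻¹ * c⁻¹), by positivity, fun m t => ?_, fun m t t' => ?_⟩⟩⟩
    · have hw : 1 ≤ wt m ^ (max s 0) := by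
        simpa using wt_zpow_mono m (le_max_right s 0)
      refine (hb m t).trans ?_
      have : 0 ≤ C * (c⁻¹ * c⁻¹) := by positivity
      have : 0 < c⁻¹ := by positivity
      nlinarith
    · have hw := wt_zpow_mono m (le_max_left s 0)
      have hp := (wt_zpow_pos m s).le
      have hp' := (wt_zpow_pos m (max s 0)).le
      have e : (y m t)⁻¹ - (y m t')⁻¹ = (y m t' - y m t) * ((y m t)⁻¹ * (y m t')⁻¹) := by
        have := hne m t; have := hne m t'
        field_simp
      rw [e, norm_mul, norm_mul, norm_sub_rev]
      have a1 := mul_le_mul (hb m t) (hb m t') (norm_nonneg _) (by positivity)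
      have a2 := mul_le_mul (h2 m t t') a1 (by positivity) (by positivity)
      refine a2.trans ?_
      have a3 : C * wt m ^ s ≤ C * wt m ^ (max s 0) := mul_le_mul_of_nonneg_left hw hC
      calc C * wt m ^ s * |t - t'| * (c⁻¹ * c⁻¹) ≤ C * wt m ^ (max s 0) * |t - t'| * (c⁻¹ * c⁻¹) := by
            gcongr
        _ = (C * (c⁻¹ * c⁻¹)) * wt m ^ (max s 0) * |t - t'| := by ring
        _ ≤ _ := by
          gcongr
          have : 0 < c⁻¹ := by positivity
          linarith
  | succ r ih =>
    have hi := ih hy.pred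
    have hd : Temp r (fun m => _root_.deriv fun t => (y m t)⁻¹) := by
      convert ((temp_const r (-1)).mul hy.deriv).mul (hi.mul hi) using 3 with m t
      obtain ⟨s, hs⟩ := hy
      rw [((hs.differentiable m t).hasDerivAt.fun_inv (hne m t)).deriv]
      have := hne m t
      field_simp
    obtain ⟨s, hs⟩ := hd
    refine ⟨max s 0, cls_succ_of_deriv (C := c⁻¹) (fun m t => (hb m t).trans ?_) (fun m t => ?_)
      (hs.mono (le_max_left _ _))⟩
    · have hw : 1 ≤ wt m ^ (max s 0) := by
        simpa using wt_zpow_mono m (le_max_right s 0)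
      have : 0 < c⁻¹ := by positivity
      nlinarith
    · obtain ⟨s, hs⟩ := hy
      exact (hs.differentiable m t).fun_inv (hne m t)

/-- The series may be differentiated term by term, since the differentiated terms have a summable
majorant independent of the parameter. -/
lemma Cls.conv {r : ℕ} {s : ℤ} {a : ℤ → ℂ} (ha : RapidSeq a) {y : ℤ → ℝ → ℂ} (hy : Cls r s y) :
    Cls r s (fun m t => conv a (fun l => y l t) m) := by
  have h0 : ∀ {y : ℤ → ℝ → ℂ}, ClsZero s y → ClsZero s (fun m t => GKdV.conv a (fun l => y l t) m) := by
    rintro y ⟨⟨C, hC, h1, h2⟩⟩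
    set S := ∑' l, ‖a l‖ * wt l ^ s.natAbs
    have hS0 : 0 ≤ S := tsum_nonneg fun l => mul_nonneg (norm_nonneg _) (pow_nonneg (wt_pos l).le _)
    refine ⟨⟨S * C, by positivity, fun m t => conv_le ha (fun m => h1 m t) m, fun m t t' => ?_⟩⟩
    have e : GKdV.conv a (fun l => y l t) m - GKdV.conv a (fun l => y l t') m
        = GKdV.conv a (fun l => y l t - y l t') m := by
      unfold GKdV.conv
      rw [← (conv_summable ha (fun m => h1 m t) m).tsum_sub
        (conv_summable ha (fun m => h1 m t') m)]
      simp only [mul_sub]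
    rw [e]
    have := conv_le ha (s := s) (C := C * |t - t'|) (y := fun l => y l t - y l t')
      (fun m => by have := h2 m t t'; linarith) m
    refine this.trans (le_of_eq ?_)
    ring
  induction r generalizing y with
  | zero => exact .base (h0 hy.zero)
  | succ r ih =>
    have hd : ∀ m t, HasDerivAt (fun t => GKdV.conv a (fun l => y l t) m)
        (GKdV.conv a (fun l => _root_.deriv (y l) t) m) t := by
      intro m t
      obtain ⟨C, hC, h1, -⟩ := hy.zero.out
      obtain ⟨C', hC', h1', -⟩ := hy.deriv.zero.out
      refine hasDerivAt_tsum (u := fun l => (‖a l‖ * wt l ^ s.natAbs) * (C' * wt m ^ s))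
        (g := fun l t => a l * y (m - l) t) (g' := fun l t => a l * _root_.deriv (y (m - l)) t)
        (y₀ := 0) ((ha.summable _).mul_right _) (fun l t => ?_) (fun l t => ?_) ?_ t
      · exact ((hy.differentiable (m - l) t).hasDerivAt).const_mul (a l)
      · exact conv_term_le (y := fun l => _root_.deriv (y l) t) hC' (fun m => h1' m t) m l
      · exact conv_summable ha (fun m => h1 m 0) m
    refine .step (h0 hy.zero) (fun m t => (hd m t).differentiableAt) ?_
    convert ih hy.deriv using 3 with m t
    exact (hd m t).deriv

lemma Rap.conv {r : ℕ} {a : ℤ → ℂ} (ha : RapidSeq a) {y : ℤ → ℝ → ℂ} (hy : Rap r y) :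
    Rap r (fun m t => conv a (fun l => y l t) m) := fun s => (hy s).conv ha

lemma Cls.eval {r : ℕ} {s : ℤ} {y : ℤ → ℝ → ℂ} (hy : Cls r s y) (m₀ : ℤ) :
    Cls r 0 (fun _ t => y m₀ t) := by
  have h0 : ∀ {y : ℤ → ℝ → ℂ}, ClsZero s y → ClsZero 0 (fun _ t => y m₀ t) := by
    rintro y ⟨⟨C, hC, h1, h2⟩⟩
    have := (wt_zpow_pos m₀ s).le
    exact ⟨⟨C * wt m₀ ^ s, by positivity, fun m t => by simpa using h1 m₀ t,
      fun m t t' => by simpa using h2 m₀ t t'⟩⟩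
  induction r generalizing y with
  | zero => exact .base (h0 hy.zero)
  | succ r ih => exact .step (h0 hy.zero) (fun _ => hy.differentiable m₀) (ih hy.deriv)

lemma Rap.eval {r : ℕ} {y : ℤ → ℝ → ℂ} (hy : Rap r y) (m₀ : ℤ) : Temp r (fun _ t => y m₀ t) :=
  ⟨0, (hy 0).eval m₀⟩

/-- First order Taylor formula. -/
lemma Cls.taylor {s : ℤ} {y : ℤ → ℝ → ℂ} (hy : Cls 1 s y) :
    ∃ C, 0 ≤ C ∧ ∀ m t t', ‖y m t - y m t' - ((t - t' : ℝ) : ℂ) * _root_.deriv (y m) t'‖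
      ≤ C * wt m ^ s * |t - t'| ^ 2 := by
  obtain ⟨C, hC, -, h2⟩ := hy.deriv.zero.out
  refine ⟨C, hC, fun m t t' => ?_⟩
  have hw := (wt_zpow_pos m s).le
  have hd : ∀ x, HasDerivAt (fun x : ℝ => y m x - ((x - t' : ℝ) : ℂ) * _root_.deriv (y m) t')
      (_root_.deriv (y m) x - _root_.deriv (y m) t') x := by
    intro x
    have h3 : HasDerivAt (fun x : ℝ => ((x - t' : ℝ) : ℂ)) 1 x := by
      simpa using ((hasDerivAt_id x).sub_const t').ofReal_comp
    simpa using (hy.differentiable m x).hasDerivAt.fun_sub (h3.mul_const (_root_.deriv (y m) t'))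
  have h4 := Convex.norm_image_sub_le_of_norm_hasDerivWithin_le (s := uIcc t' t) (x := t') (y := t)
    (C := C * wt m ^ s * |t - t'|)
    (fun x _ => (hd x).hasDerivWithinAt) (fun x hx => ?_) (convex_uIcc _ _)
    left_mem_uIcc right_mem_uIcc
  · rw [Real.norm_eq_abs] at h4
    calc _ = ‖(y m t - ((t - t' : ℝ) : ℂ) * _root_.deriv (y m) t') -
        (y m t' - ((t' - t' : ℝ) : ℂ) * _root_.deriv (y m) t')‖ := by
          congr 1; simp; ring
      _ ≤ _ := h4
      _ = _ := by ring
  · refine (h2 m x t').trans ?_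
    have := abs_sub_left_of_mem_uIcc hx
    gcongr

/-! ### Smooth dependence of solutions of the linear equation on the parameter. -/

lemma lop_coeff_sub (a α e β α' e' β' y : ℤ → ℂ) (m : ℤ) :
    lop a (fun l => α l - α' l) (fun l => e l - e' l) (fun l => β l - β' l) y m
      = lop a α e β y m - lop a α' e' β' y m := by
  unfold lop; ring

lemma lop_coeff_mul (a α e β y : ℤ → ℂ) (c : ℂ) (m : ℤ) :
    lop a (fun l => c * α l) (fun l => c * e l) (fun l => c * β l) y m = c * lop a α e β y m := by
  unfold lop; ring

lemma Rap.lop {r : ℕ} {a : ℤ → ℂ} (ha : RapidSeq a) {α e β y : ℤ → ℝ → ℂ} (hα : Temp r α)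
    (he : Temp r e) (hβ : Rap r β) (hy : Rap r y) :
    Rap r (fun m t => lop a (fun l => α l t) (fun l => e l t) (fun l => β l t) (fun l => y l t) m) :=
  ((hα.mul_rap hy).add (he.mul_rap (hy.conv ha))).add (hβ.mul_temp ((hy.conv ha).eval 0))

/-- Used with coefficients that are increments or first order Taylor remainders of the original
ones, `d` being `|t - t'|` or its square. They may grow in `m`, which the decay of `Y` compensates.
-/
lemma lop_bound {ι : Type*} {a : ℤ → ℂ} (ha : RapidSeq a) {α e β Y : ι → ℤ → ℂ} {d : ι → ℝ}
    {p p' : ℤ} {c c' : ℝ} (hα : ∀ i m, ‖α i m‖ ≤ c * wt m ^ p * d i)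
    (he : ∀ i m, ‖e i m‖ ≤ c' * wt m ^ p' * d i)
    (hβ : ∀ s : ℤ, ∃ C, ∀ i m, ‖β i m‖ ≤ C * wt m ^ s * d i)
    (hY : ∀ s : ℤ, ∃ C, ∀ i m, ‖Y i m‖ ≤ C * wt m ^ s) (s : ℤ) :
    ∃ C, ∀ i m, ‖lop a (α i) (e i) (β i) (Y i) m‖ ≤ C * wt m ^ s * d i := by
  obtain ⟨C1, h1⟩ := hY (s - p)
  obtain ⟨C2, h2⟩ := hY (s - p')
  obtain ⟨C3, h3⟩ := hβ s
  have k2 : ∀ i m, _ := fun i m => conv_le ha (h2 i) m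
  set S := ∑' l, ‖a l‖ * wt l ^ (s - p').natAbs
  refine ⟨c * C1 + c' * (S * C2) + C3 * (S * C2), fun i m => ?_⟩
  have b1 : ‖α i m * Y i m‖ ≤ (c * wt m ^ p * d i) * (C1 * wt m ^ (s - p)) := by
    rw [norm_mul]
    exact mul_le_mul (hα i m) (h1 i m) (norm_nonneg _) ((norm_nonneg _).trans (hα i m))
  have b2 : ‖e i m * conv a (Y i) m‖ ≤ (c' * wt m ^ p' * d i) * (S * C2 * wt m ^ (s - p')) := by
    rw [norm_mul]
    exact mul_le_mul (he i m) (k2 i m) (norm_nonneg _) ((norm_nonneg _).trans (he i m))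
  have b3 : ‖β i m * conv a (Y i) 0‖ ≤ (C3 * wt m ^ s * d i) * (S * C2) := by
    have := k2 i 0
    rw [wt_zero, one_zpow, mul_one] at this
    rw [norm_mul]
    exact mul_le_mul (h3 i m) this (norm_nonneg _) ((norm_nonneg _).trans (h3 i m))
  have w1 : wt m ^ p * wt m ^ (s - p) = wt m ^ s := by
    rw [← zpow_add₀ (wt_pos m).ne']; congr 1; ring
  have w2 : wt m ^ p' * wt m ^ (s - p') = wt m ^ s := by
    rw [← zpow_add₀ (wt_pos m).ne']; congr 1; ring
  unfold lop
  calc _ ≤ _ := norm_add₃_le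
    _ ≤ _ := add_le_add (add_le_add b1 b2) b3
    _ = c * C1 * (wt m ^ p * wt m ^ (s - p)) * d i
        + c' * (S * C2) * (wt m ^ p' * wt m ^ (s - p')) * d i + C3 * (S * C2) * wt m ^ s * d i := by
      ring
    _ = _ := by rw [w1, w2]; ring

lemma Temp.lip {y : ℤ → ℝ → ℂ} (hy : Temp 0 y) : ∃ (p : ℤ) (C : ℝ),
    ∀ (i : ℝ × ℝ) m, ‖y m i.1 - y m i.2‖ ≤ C * wt m ^ p * |i.1 - i.2| := by
  obtain ⟨s, hs⟩ := hy
  obtain ⟨C, -, -, h⟩ := hs.zero.out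
  exact ⟨s, C, fun i m => h m i.1 i.2⟩

lemma Rap.lip {y : ℤ → ℝ → ℂ} (hy : Rap 0 y) (s : ℤ) : ∃ C : ℝ,
    ∀ (i : ℝ × ℝ) m, ‖y m i.1 - y m i.2‖ ≤ C * wt m ^ s * |i.1 - i.2| := by
  obtain ⟨C, -, -, h⟩ := (hy s).zero.out
  exact ⟨C, fun i m => h m i.1 i.2⟩

lemma Rap.bound {r : ℕ} {y : ℤ → ℝ → ℂ} (hy : Rap r y) (s : ℤ) : ∃ C : ℝ,
    ∀ t m, ‖y m t‖ ≤ C * wt m ^ s := by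
  obtain ⟨C, -, h, -⟩ := (hy s).zero.out
  exact ⟨C, fun i m => h m i⟩

lemma Rap.bound_sup {r : ℕ} {y : ℤ → ℝ → ℂ} (hy : Rap r y) : ∃ C : ℝ, ∀ t m, ‖y m t‖ ≤ C := by
  obtain ⟨C, h⟩ := hy.bound 0
  exact ⟨C, fun i m => by simpa using h i m⟩

lemma Temp.taylor {y : ℤ → ℝ → ℂ} (hy : Temp 1 y) : ∃ (p : ℤ) (C : ℝ), ∀ (i : ℝ × ℝ) m,
    ‖y m i.1 - y m i.2 - ((i.1 - i.2 : ℝ) : ℂ) * _root_.deriv (y m) i.2‖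
      ≤ C * wt m ^ p * |i.1 - i.2| ^ 2 := by
  obtain ⟨s, hs⟩ := hy
  obtain ⟨C, -, h⟩ := hs.taylor
  exact ⟨s, C, fun i m => h m i.1 i.2⟩

lemma Rap.taylor {y : ℤ → ℝ → ℂ} (hy : Rap 1 y) (s : ℤ) : ∃ C : ℝ, ∀ (i : ℝ × ℝ) m,
    ‖y m i.1 - y m i.2 - ((i.1 - i.2 : ℝ) : ℂ) * _root_.deriv (y m) i.2‖
      ≤ C * wt m ^ s * |i.1 - i.2| ^ 2 := by
  obtain ⟨C, -, h⟩ := (hy s).taylor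
  exact ⟨C, fun i m => h m i.1 i.2⟩

lemma Temp.pred_le {r r' : ℕ} (h : r' ≤ r) {y : ℤ → ℝ → ℂ} (hy : Temp r y) : Temp r' y := by
  induction h with
  | refl => exact hy
  | step _ ih => exact ih hy.pred

lemma Rap.pred_le {r r' : ℕ} (h : r' ≤ r) {y : ℤ → ℝ → ℂ} (hy : Rap r y) : Rap r' y := by
  induction h with
  | refl => exact hy
  | step _ ih => exact ih hy.pred

lemma rap_zero_of {y : ℤ → ℝ → ℂ} (h1 : ∀ s : ℤ, ∃ C : ℝ, ∀ t m, ‖y m t‖ ≤ C * wt m ^ s)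
    (h2 : ∀ s : ℤ, ∃ C : ℝ, ∀ (i : ℝ × ℝ) m, ‖y m i.1 - y m i.2‖ ≤ C * wt m ^ s * |i.1 - i.2|) :
    Rap 0 y := fun s => by
  obtain ⟨C1, h1⟩ := h1 s
  obtain ⟨C2, h2⟩ := h2 s
  refine .base ⟨⟨|C1| + |C2|, by positivity, fun m t => (h1 t m).trans ?_,
    fun m t t' => (h2 (t, t') m).trans ?_⟩⟩
  · have := (wt_zpow_pos m s).le
    gcongr
    linarith [le_abs_self C1, abs_nonneg C2]
  · have := (wt_zpow_pos m s).le
    simp only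
    gcongr
    linarith [le_abs_self C2, abs_nonneg C1]

lemma rap_succ_of {r : ℕ} {y z : ℤ → ℝ → ℂ} (hy : Rap 0 y) (hz : Rap r z)
    (h : ∀ m t, HasDerivAt (y m) (z m t) t) : Rap (r + 1) y := fun s => by
  obtain ⟨C, hC⟩ := hy.bound s
  refine cls_succ_of_deriv (fun m t => hC t m) (fun m t => (h m t).differentiableAt) ?_
  have : (fun m => _root_.deriv (y m)) = z := by
    ext m t; exact (h m t).deriv
  rw [this]
  exact hz s

/-- The remainder `y(t') - y(t) - (t' - t) z(t)` solves a half-contractive equation with a source of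
size `|t' - t|²`, hence has that size itself. Differentiability of `y` is thus obtained without
being assumed. -/
lemma hasDerivAt_of_lop {a : ℤ → ℂ} (ha : RapidSeq a) {y z : ℤ → ℝ → ℂ} {α e β : ℝ × ℝ → ℤ → ℂ}
    (hs : ∀ i m, ‖α i m‖ + ‖e i m‖ * (∑' l, ‖a l‖) + ‖β i m‖ * (∑' l, ‖a l‖) ≤ 1 / 2)
    {B B' : ℝ} (hy : ∀ t m, ‖y m t‖ ≤ B) (hz : ∀ t m, ‖z m t‖ ≤ B') {C : ℝ}
    (h : ∀ (i : ℝ × ℝ) m, ‖(y m i.1 - y m i.2 - ((i.1 - i.2 : ℝ) : ℂ) * z m i.2)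
      - lop a (α i) (e i) (β i) (fun l => y l i.1 - y l i.2 - ((i.1 - i.2 : ℝ) : ℂ) * z l i.2) m‖
        ≤ C * |i.1 - i.2| ^ 2) (m : ℤ) (t : ℝ) : HasDerivAt (y m) (z m t) t := by
  have key : ∀ t', ‖y m t' - y m t - ((t' - t : ℝ) : ℂ) * z m t‖ ≤ 2 * (C * |t' - t| ^ 2) := by
    intro t'
    refine lop_solution_le ha (hs (t', t)) (y := fun l => y l t' - y l t - ((t' - t : ℝ) : ℂ) * z l t)
      (B := B + B + |t' - t| * B') (h (t', t)) (fun l => ?_) (fun l => by simp) m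
    refine (norm_sub_le _ _).trans (add_le_add ((norm_sub_le _ _).trans (add_le_add (hy _ _) (hy _ _))) ?_)
    rw [norm_mul, Complex.norm_real, Real.norm_eq_abs]
    gcongr
    exact hz _ _
  rw [hasDerivAt_iff_isLittleO]
  have h1 : (fun x' => y m x' - y m t - (x' - t) • z m t) =O[nhds t] fun x' => ‖x' - t‖ ^ 2 := by
    refine Asymptotics.IsBigO.of_bound (2 * C) (Filter.Eventually.of_forall fun x => ?_)
    have := key x
    rw [Complex.real_smul]
    refine this.trans (le_of_eq ?_)
    rw [norm_pow, norm_norm, Real.norm_eq_abs]; ring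
  refine h1.trans_isLittleO ?_
  exact Asymptotics.isLittleO_pow_sub_sub t one_lt_two

/-- Solutions of `y = lop y + g` inherit the regularity of the data. -/
lemma Rap.lop_solution {a : ℤ → ℂ} (ha : RapidSeq a) {r : ℕ} {α e β g y : ℤ → ℝ → ℂ} {c : ℝ}
    (hs : ∀ t m, ‖α m t‖ + ‖e m t‖ * (∑' l, ‖a l‖) + ‖β m t‖ * (∑' l, ‖a l‖) ≤ 1 / 2)
    (hα : ∀ t m, ‖α m t‖ ≤ c * wt m ^ (-1 : ℤ)) (he : ∀ t m, ‖e m t‖ ≤ c * wt m ^ (-1 : ℤ))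
    (tα : Temp r α) (te : Temp r e) (rβ : Rap r β) (rg : Rap r g)
    (hb : ∀ t, ∃ B, ∀ m, ‖y m t‖ ≤ B)
    (hy : ∀ t m, y m t = GKdV.lop a (fun l => α l t) (fun l => e l t) (fun l => β l t)
      (fun l => y l t) m + g m t) : Rap r y := by
  induction r generalizing g y with
  | zero =>
    have bd : ∀ s : ℤ, ∃ C : ℝ, ∀ t m, ‖y m t‖ ≤ C * wt m ^ s := by
      intro s
      have := lop_apriori ha (ι := ℝ) (α := fun t l => α l t) (e := fun t l => e l t)
        (β := fun t l => β l t) (η := fun t l => y l t) (f := fun t l => g l t) (δ := fun _ => 1)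
        hs hα he rβ.bound (by simp) (by simpa using rg.bound) hb hy s
      simpa using this
    -- Subtracting the equations at two parameter values, the difference of the solutions satisfies
    -- the equation at the first value, with a source made of increments of the data.
    refine rap_zero_of bd fun s => ?_
    obtain ⟨p, C, hαl⟩ := tα.lip
    obtain ⟨p', C', hel⟩ := te.lip
    have hl := lop_bound ha (ι := ℝ × ℝ) (α := fun i l => α l i.1 - α l i.2)
      (e := fun i l => e l i.1 - e l i.2) (β := fun i l => β l i.1 - β l i.2)
      (Y := fun i l => y l i.2) (d := fun i => |i.1 - i.2|) hαl hel rβ.lip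
      (fun s => let ⟨C, hC⟩ := bd s; ⟨C, fun i m => hC i.2 m⟩)
    refine lop_apriori ha (ι := ℝ × ℝ) (α := fun i l => α l i.1) (e := fun i l => e l i.1)
        (β := fun i l => β l i.1) (η := fun i l => y l i.1 - y l i.2)
        (f := fun i m => GKdV.lop a (fun l => α l i.1 - α l i.2)
      (fun l => e l i.1 - e l i.2) (fun l => β l i.1 - β l i.2) (fun l => y l i.2) m
        + (g m i.1 - g m i.2)) (δ := fun i => |i.1 - i.2|)
        (fun i => hs i.1) (fun i => hα i.1) (fun i => he i.1)
        (fun s => let ⟨C, hC⟩ := rβ.bound s; ⟨C, fun i m => hC i.1 m⟩)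
        (fun i => abs_nonneg _) (fun s => ?_) (fun i => ?_) (fun i m => ?_) s
    · obtain ⟨C1, h1⟩ := hl s
      obtain ⟨C2, h2⟩ := rg.lip s
      exact ⟨C1 + C2, fun i m => (norm_add_le _ _).trans (by linarith [h1 i m, h2 i m])⟩
    · obtain ⟨B, hB⟩ := hb i.1
      obtain ⟨B', hB'⟩ := hb i.2
      exact ⟨B + B', fun m => (norm_sub_le _ _).trans (add_le_add (hB m) (hB' m))⟩
    · obtain ⟨B, hB⟩ := hb i.1
      obtain ⟨B', hB'⟩ := hb i.2
      rw [lop_sub ha hB hB', lop_coeff_sub]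
      rw [hy i.1 m, hy i.2 m]
      ring
  | succ r ih =>
    have ry : Rap r y := ih tα.pred te.pred rβ.pred rg.pred hb hy
    -- The source of the formally differentiated equation. Its solution `z` is the candidate
    -- derivative, and the induction hypothesis applies to it because `G` has the `r` derivatives
    -- required.
    set G : ℤ → ℝ → ℂ := fun m t => GKdV.lop a (fun l => _root_.deriv (α l) t)
      (fun l => _root_.deriv (e l) t) (fun l => _root_.deriv (β l) t) (fun l => y l t) m
        + _root_.deriv (g m) t with hG
    have rG : Rap r G := (Rap.lop ha tα.deriv te.deriv rβ.deriv ry).add rg.deriv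
    obtain ⟨BG, hBG⟩ := rG.bound_sup
    choose z hzb hz using fun t => exists_lop_solution ha (hs t) (hBG t)
    have rz : Rap r (fun m t => z t m) :=
      ih tα.pred te.pred rβ.pred rG (fun t => ⟨_, hzb t⟩) hz
    obtain ⟨By, hBy⟩ := ry.bound_sup
    obtain ⟨p, C, hαt⟩ := (tα.pred_le (r' := 1) (by omega)).taylor
    obtain ⟨p', C', het⟩ := (te.pred_le (r' := 1) (by omega)).taylor
    obtain ⟨q, c1, hαl⟩ := tα.zero.lip
    obtain ⟨q', c2, hel⟩ := te.zero.lip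
    obtain ⟨C1, h1⟩ := lop_bound ha (ι := ℝ × ℝ)
      (α := fun i l => α l i.1 - α l i.2 - ((i.1 - i.2 : ℝ) : ℂ) * _root_.deriv (α l) i.2)
      (e := fun i l => e l i.1 - e l i.2 - ((i.1 - i.2 : ℝ) : ℂ) * _root_.deriv (e l) i.2)
      (β := fun i l => β l i.1 - β l i.2 - ((i.1 - i.2 : ℝ) : ℂ) * _root_.deriv (β l) i.2)
      (Y := fun i l => y l i.2) (d := fun i => |i.1 - i.2| ^ 2) hαt het
      (rβ.pred_le (r' := 1) (by omega)).taylor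
      (fun s => let ⟨C, hC⟩ := ry.bound s; ⟨C, fun i m => hC i.2 m⟩) 0
    obtain ⟨C2, h2⟩ := lop_bound ha (ι := ℝ × ℝ) (α := fun i l => α l i.1 - α l i.2)
      (e := fun i l => e l i.1 - e l i.2) (β := fun i l => β l i.1 - β l i.2)
      (Y := fun i l => z i.2 l) (d := fun i => |i.1 - i.2|) hαl hel rβ.zero.lip
      (fun s => let ⟨C, hC⟩ := rz.bound s; ⟨C, fun i m => hC i.2 m⟩) 0
    obtain ⟨C3, h3⟩ := (rg.pred_le (r' := 1) (by omega)).taylor 0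
    refine rap_succ_of ry.zero rz (hasDerivAt_of_lop ha (α := fun i l => α l i.1)
      (e := fun i l => e l i.1) (β := fun i l => β l i.1) (fun i => hs i.1) hBy hzb
      (C := C1 + C2 + C3) (fun i m => ?_))
    have h1 := h1 i m
    have h2 := h2 i m
    have h3 := h3 i m
    rw [zpow_zero, mul_one] at h1 h2 h3
    rw [lop_coeff_sub, lop_coeff_sub, lop_coeff_mul] at h1
    rw [lop_coeff_sub] at h2
    have hyd : ∀ l, ‖y l i.1 - y l i.2‖ ≤ By + By := fun l =>
      (norm_sub_le _ _).trans (add_le_add (hBy _ _) (hBy _ _))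
    have hzd : ∀ l, ‖((i.1 - i.2 : ℝ) : ℂ) * z i.2 l‖ ≤ |i.1 - i.2| * (2 * BG) := fun l => by
      rw [norm_mul, Complex.norm_real, Real.norm_eq_abs]
      gcongr; exact hzb _ _
    rw [lop_sub ha hyd hzd, lop_sub ha (hBy i.1) (hBy i.2), lop_const_mul]
    have hz2 := hz i.2 m
    have hy1 := hy i.1 m
    have hy2 := hy i.2 m
    rw [hG] at hz2
    simp only at hz2
    set δ : ℂ := ((i.1 - i.2 : ℝ) : ℂ) with hδ
    have nδ : ‖δ‖ = |i.1 - i.2| := by rw [hδ, Complex.norm_real, Real.norm_eq_abs]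
    calc _ = ‖(GKdV.lop a (fun l => α l i.1) (fun l => e l i.1) (fun l => β l i.1) (fun l => y l i.2) m
            - GKdV.lop a (fun l => α l i.2) (fun l => e l i.2) (fun l => β l i.2) (fun l => y l i.2) m
            - δ * GKdV.lop a (fun l => _root_.deriv (α l) i.2) (fun l => _root_.deriv (e l) i.2)
              (fun l => _root_.deriv (β l) i.2) (fun l => y l i.2) m)
          + δ * (GKdV.lop a (fun l => α l i.1) (fun l => e l i.1) (fun l => β l i.1) (z i.2) m
            - GKdV.lop a (fun l => α l i.2) (fun l => e l i.2) (fun l => β l i.2) (z i.2) m)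
          + (g m i.1 - g m i.2 - δ * _root_.deriv (g m) i.2)‖ := by
            congr 1
            linear_combination hy1 - hy2 - δ * hz2
      _ ≤ C1 * |i.1 - i.2| ^ 2 + |i.1 - i.2| * (C2 * |i.1 - i.2|) + C3 * |i.1 - i.2| ^ 2 := by
        refine norm_add₃_le.trans (add_le_add (add_le_add h1 ?_) h3)
        rw [norm_mul, nδ]
        gcongr
      _ = _ := by ring

/-! ### The nonlinear equation for the correction. -/

/-- The scalar `K (a₀ + (a * w)₀)`. -/
def scal (a : ℤ → ℂ) (K : ℂ) (w : ℤ → ℂ) : ℂ := K * (a 0 + conv a w 0)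

/-- The map whose fixed point is the correction of the eigenfunction. -/
def corrMap (a : ℤ → ℂ) (K : ℂ) (D E w : ℤ → ℂ) (m : ℤ) : ℂ :=
  D m * scal a K w * w m + E m * (a m + conv a w m)

lemma RapidSeq.le_tsum {a : ℤ → ℂ} (ha : RapidSeq a) (m : ℤ) : ‖a m‖ ≤ ∑' l, ‖a l‖ :=
  ha.summable_norm.le_tsum m (fun _ _ => norm_nonneg _)

lemma norm_add_conv_le {a w : ℤ → ℂ} (ha : RapidSeq a) (hw : ∀ m, ‖w m‖ ≤ 1) (m : ℤ) :
    ‖a m + conv a w m‖ ≤ 2 * ∑' l, ‖a l‖ := by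
  have h1 := ha.le_tsum m
  have h2 := conv_le_sup ha hw m
  have := norm_add_le (a m) (conv a w m)
  linarith

lemma scal_le {a w : ℤ → ℂ} (ha : RapidSeq a) (K : ℂ) (hw : ∀ m, ‖w m‖ ≤ 1) :
    ‖scal a K w‖ ≤ ‖K‖ * (2 * ∑' l, ‖a l‖) := by
  unfold scal
  rw [norm_mul]
  exact mul_le_mul_of_nonneg_left (norm_add_conv_le ha hw 0) (norm_nonneg _)

lemma scal_sub {a w w' : ℤ → ℂ} (ha : RapidSeq a) (K : ℂ) {B B' : ℝ} (hw : ∀ m, ‖w m‖ ≤ B)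
    (hw' : ∀ m, ‖w' m‖ ≤ B') :
    scal a K w - scal a K w' = K * conv a (fun l => w l - w' l) 0 := by
  unfold scal; rw [conv_sub ha hw hw']; ring

/-- The quadratic term is split as `n(w) w - n(w') w' = n(w) (w - w') + (n(w) - n(w')) w'`; as `n`
is affine, the second part is the rank-one term. -/
lemma corrMap_sub {a w w' D E : ℤ → ℂ} (ha : RapidSeq a) (K : ℂ) (hw : ∀ m, ‖w m‖ ≤ 1)
    (hw' : ∀ m, ‖w' m‖ ≤ 1) (m : ℤ) :
    corrMap a K D E w m - corrMap a K D E w' m =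
      lop a (fun l => D l * scal a K w) E (fun l => K * D l * w' l) (fun l => w l - w' l) m := by
  have := scal_sub ha K hw hw'
  unfold corrMap lop
  rw [conv_sub ha hw hw' m]
  linear_combination D m * w' m * this

section correction

variable {a : ℤ → ℂ} {K : ℂ} {ε : ℝ}

/-- The three terms contribute `2‖K‖`, `1` and `‖K‖` times `ε ∑ ‖a l‖`, which `4‖K‖ + 4` dominates.
The sequences `w` and `w'` are kept distinct because increments of `corrMap` involve both. -/
lemma corr_small (ha : RapidSeq a) (hε : ε * ((4 * ‖K‖ + 4) * ∑' l, ‖a l‖) ≤ 1 / 2)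
    {D E w w' : ℤ → ℂ} (hD : ∀ m, ‖D m‖ ≤ ε * wt m ^ (-1 : ℤ))
    (hE : ∀ m, ‖E m‖ ≤ ε * wt m ^ (-1 : ℤ)) (hw : ∀ m, ‖w m‖ ≤ 1) (hw' : ∀ m, ‖w' m‖ ≤ 1) (m : ℤ) :
    ‖D m * scal a K w‖ + ‖E m‖ * (∑' l, ‖a l‖) + ‖K * D m * w' m‖ * (∑' l, ‖a l‖) ≤ 1 / 2 := by
  have hε0 : 0 ≤ ε := by
    have := (norm_nonneg _).trans (hD 0)
    simpa [wt_zero] using this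
  set A := ∑' l, ‖a l‖
  have hA : 0 ≤ A := tsum_nonneg fun _ => norm_nonneg _
  have hw1 : wt m ^ (-1 : ℤ) ≤ 1 := by simpa using wt_zpow_mono m (s := -1) (s' := 0) (by norm_num)
  have d : ‖D m‖ ≤ ε := (hD m).trans (by nlinarith)
  have e : ‖E m‖ ≤ ε := (hE m).trans (by nlinarith)
  have s := scal_le ha K hw
  rw [norm_mul, norm_mul, norm_mul]
  have k0 := norm_nonneg K
  have h1 : ‖D m‖ * ‖scal a K w‖ ≤ ε * (‖K‖ * (2 * A)) := mul_le_mul d s (norm_nonneg _) hε0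
  have h2 : ‖E m‖ * A ≤ ε * A := mul_le_mul_of_nonneg_right e hA
  have h3 : ‖K‖ * ‖D m‖ * ‖w' m‖ * A ≤ ‖K‖ * ε * 1 * A := by gcongr; exact hw' m
  have : 0 ≤ ε * (‖K‖ * A) := by positivity
  have : 0 ≤ ε * A := by positivity
  nlinarith

lemma corrMap_le (ha : RapidSeq a)
    {D E w : ℤ → ℂ} (hD : ∀ m, ‖D m‖ ≤ ε * wt m ^ (-1 : ℤ))
    (hE : ∀ m, ‖E m‖ ≤ ε * wt m ^ (-1 : ℤ)) (hw : ∀ m, ‖w m‖ ≤ 1) (m : ℤ) :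
    ‖corrMap a K D E w m‖ ≤ ε * (2 * (‖K‖ + 1) * ∑' l, ‖a l‖) := by
  have hε0 : 0 ≤ ε := by
    have := (norm_nonneg _).trans (hD 0)
    simpa [wt_zero] using this
  set A := ∑' l, ‖a l‖
  have hA : 0 ≤ A := tsum_nonneg fun _ => norm_nonneg _
  have hw1 : wt m ^ (-1 : ℤ) ≤ 1 := by simpa using wt_zpow_mono m (s := -1) (s' := 0) (by norm_num)
  have d : ‖D m‖ ≤ ε := (hD m).trans (by nlinarith)
  have e : ‖E m‖ ≤ ε := (hE m).trans (by nlinarith)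
  have s := scal_le ha K hw
  have k0 := norm_nonneg K
  unfold corrMap
  refine (norm_add_le _ _).trans ?_
  rw [norm_mul, norm_mul, norm_mul]
  have h1 : ‖D m‖ * ‖scal a K w‖ * ‖w m‖ ≤ ε * (‖K‖ * (2 * A)) * 1 :=
    mul_le_mul (mul_le_mul d s (norm_nonneg _) hε0) (hw m) (norm_nonneg _) (by positivity)
  have h2 : ‖E m‖ * ‖a m + conv a w m‖ ≤ ε * (2 * A) :=
    mul_le_mul e (norm_add_conv_le ha hw m) (norm_nonneg _) hε0
  nlinarith

lemma exists_correction (ha : RapidSeq a) (hε : ε * ((4 * ‖K‖ + 4) * ∑' l, ‖a l‖) ≤ 1 / 2)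
    {D E : ℤ → ℂ} (hD : ∀ m, ‖D m‖ ≤ ε * wt m ^ (-1 : ℤ))
    (hE : ∀ m, ‖E m‖ ≤ ε * wt m ^ (-1 : ℤ)) :
    ∃ w, (∀ m, ‖w m‖ ≤ 1) ∧ (∀ m, corrMap a K D E w m = w m) ∧
      ∀ z, (∀ m, ‖z m‖ ≤ 1) → (∀ m, corrMap a K D E z m = z m) → z = w := by
  have hA : 0 ≤ ∑' l, ‖a l‖ := tsum_nonneg fun _ => norm_nonneg _
  refine exists_fixedPoint _ 1 zero_le_one (fun y hy m => ?_) (fun y z hy hz C hC m => ?_)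
  · refine (corrMap_le ha hD hE hy m).trans ?_
    nlinarith
  · rw [corrMap_sub ha K hy hz]
    have := lop_le ha (corr_small ha hε hD hE hy hz) hC m
    linarith

set_option maxHeartbeats 400000 in
/-- The correction depends smoothly on the parameter. -/
lemma rap_correction (ha : RapidSeq a) (hε : ε * ((4 * ‖K‖ + 4) * ∑' l, ‖a l‖) ≤ 1 / 2)
    {D E : ℤ → ℝ → ℂ} (hD : ∀ t m, ‖D m t‖ ≤ ε * wt m ^ (-1 : ℤ))
    (hE : ∀ t m, ‖E m t‖ ≤ ε * wt m ^ (-1 : ℤ)) (tD : ∀ r, Temp r D) (tE : ∀ r, Temp r E)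
    {w : ℤ → ℝ → ℂ} (hw : ∀ t m, ‖w m t‖ ≤ 1)
    (hfix : ∀ t m, corrMap a K (fun l => D l t) (fun l => E l t) (fun l => w l t) m = w m t)
    (r : ℕ) : Rap r w := by
  set A := ∑' l, ‖a l‖ with hAdef
  have hA : 0 ≤ A := tsum_nonneg fun _ => norm_nonneg _
  have hε0 : 0 ≤ ε := by
    have := (norm_nonneg _).trans (hD 0 0)
    simpa [wt_zero] using this
  set n : ℝ → ℂ := fun t => scal a K (fun l => w l t) with hn
  have nb : ∀ t, ‖n t‖ ≤ ‖K‖ * (2 * A) := fun t => scal_le ha K (hw t)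
  have hwfix : ∀ t m, w m t = D m t * n t * w m t + E m t * (a m + conv a (fun l => w l t) m) :=
    fun t m => (hfix t m).symm
  set c := ε * (‖K‖ * (2 * A)) + ε with hc
  have hα : ∀ t t' m, ‖D m t * n t'‖ ≤ c * wt m ^ (-1 : ℤ) := fun t t' m => by
    rw [norm_mul]
    have p := (wt_zpow_pos m (-1)).le
    have := mul_le_mul (hD t m) (nb t') (norm_nonneg _) (by positivity)
    rw [hc]
    nlinarith [mul_nonneg hε0 p]
  have hE' : ∀ t m, ‖E m t‖ ≤ c * wt m ^ (-1 : ℤ) := fun t m => by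
    have p := (wt_zpow_pos m (-1)).le
    refine (hE t m).trans ?_
    gcongr
    rw [hc]
    have : 0 ≤ ε * (‖K‖ * (2 * A)) := by positivity
    linarith
  have small : ∀ t t' t'' m, ‖D m t * n t'‖ + ‖E m t‖ * A + ‖K * D m t * w m t''‖ * A ≤ 1 / 2 :=
    fun t t' t'' m => corr_small ha hε (hD t) (hE t) (hw t') (hw t'') m
  have small0 : ∀ t m, ‖D m t * n t‖ + ‖E m t‖ * A + ‖(0 : ℂ)‖ * A ≤ 1 / 2 := fun t m => by
    have := small t t t m
    have h0 : 0 ≤ ‖K * D m t * w m t‖ * A := by positivity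
    rw [norm_zero]
    linarith
  -- For decay alone, `n t` can be regarded as a given bounded scalar: the equation is then linear,
  -- with `β = 0` and the rapidly decreasing source `E a`.
  have bd : ∀ s : ℤ, ∃ C : ℝ, ∀ t m, ‖w m t‖ ≤ C * wt m ^ s := by
    intro s
    have := lop_apriori ha (ι := ℝ) (α := fun t l => D l t * n t) (e := fun t l => E l t)
      (β := fun t l => 0) (η := fun t l => w l t) (f := fun t l => E l t * a l) (δ := fun _ => 1)
      small0 (fun t m => hα t t m) hE' (fun s => ⟨0, by simp⟩) (by simp) (fun s => ?_)
      (fun t => ⟨1, hw t⟩) (fun t m => ?_) s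
    · simpa using this
    · obtain ⟨C, hC⟩ := ha (s + 1)
      refine ⟨ε * C, fun t m => ?_⟩
      rw [norm_mul, mul_one]
      have p := (wt_zpow_pos m (-1)).le
      calc _ ≤ (ε * wt m ^ (-1 : ℤ)) * (C * wt m ^ (s + 1)) :=
            mul_le_mul (hE t m) (hC m) (norm_nonneg _) (by positivity)
        _ = ε * C * (wt m ^ (-1 : ℤ) * wt m ^ (s + 1)) := by ring
        _ = _ := by
          rw [← zpow_add₀ (wt_pos m).ne']
          congr 2; ring
    · have := hwfix t m
      unfold lop
      linear_combination this
  -- The map is compared at the same parameter `i.1` for the two sequences, giving the `lop` term;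
  -- the change of parameter with the sequence `w` at `i.2` frozen gives the source.
  have diff_eq : ∀ (i : ℝ × ℝ) m, w m i.1 - w m i.2 =
      lop a (fun l => D l i.1 * n i.1) (fun l => E l i.1) (fun l => K * D l i.1 * w l i.2)
        (fun l => w l i.1 - w l i.2) m
      + ((D m i.1 - D m i.2) * (n i.2 * w m i.2)
        + (E m i.1 - E m i.2) * (a m + conv a (fun l => w l i.2) m)) := by
    intro i m
    have h := corrMap_sub (D := fun l => D l i.1) (E := fun l => E l i.1) ha K (hw i.1) (hw i.2) m
    rw [← h, hfix i.1 m]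
    have := hwfix i.2 m
    unfold corrMap
    rw [show scal a K (fun l => w l i.2) = n i.2 from rfl]
    linear_combination -this
  have bd2 : ∀ s : ℤ, ∃ C : ℝ, ∀ t m, ‖n t * w m t‖ ≤ C * wt m ^ s := fun s => by
    obtain ⟨C, hC⟩ := bd s
    refine ⟨‖K‖ * (2 * A) * C, fun t m => ?_⟩
    rw [norm_mul, mul_assoc]
    exact mul_le_mul (nb t) (hC t m) (norm_nonneg _) (by positivity)
  have bd3 : ∀ s : ℤ, ∃ C : ℝ, ∀ t m, ‖a m + conv a (fun l => w l t) m‖ ≤ C * wt m ^ s := fun s => by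
    obtain ⟨C, hC⟩ := bd s
    obtain ⟨C', hC'⟩ := ha s
    refine ⟨C' + (∑' l, ‖a l‖ * wt l ^ s.natAbs) * C, fun t m => ?_⟩
    refine (norm_add_le _ _).trans ?_
    rw [add_mul]
    exact add_le_add (hC' m) (conv_le ha (hC t) m)
  have rβ : ∀ {ι : Type} (f g : ι → ℝ) (s : ℤ), ∃ C : ℝ, ∀ i m,
      ‖K * D m (f i) * w m (g i)‖ ≤ C * wt m ^ s := fun f g s => by
    obtain ⟨C, hC⟩ := bd s
    refine ⟨‖K‖ * ε * C, fun i m => ?_⟩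
    have hw1 : wt m ^ (-1 : ℤ) ≤ 1 := by
      simpa using wt_zpow_mono m (s := -1) (s' := 0) (by norm_num)
    have d : ‖D m (f i)‖ ≤ ε := (hD _ m).trans (by nlinarith)
    rw [norm_mul, norm_mul, mul_assoc (‖K‖ * ε)]
    exact mul_le_mul (mul_le_mul_of_nonneg_left d (norm_nonneg _)) (hC _ m) (norm_nonneg _)
      (by positivity)
  have prodb : ∀ {ι : Type} {d : ι → ℝ} {y : ι → ℤ → ℂ} {z : ι → ℤ → ℂ} {p : ℤ} {C : ℝ}
      (_ : ∀ i m, ‖y i m‖ ≤ C * wt m ^ p * d i)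
      (_ : ∀ s : ℤ, ∃ C : ℝ, ∀ i m, ‖z i m‖ ≤ C * wt m ^ s) (s : ℤ),
      ∃ C : ℝ, ∀ i m, ‖y i m * z i m‖ ≤ C * wt m ^ s * d i := by
    intro ι d y z p C hy hz s
    obtain ⟨C', hz⟩ := hz (s - p)
    refine ⟨C * C', fun i m => ?_⟩
    rw [norm_mul]
    calc _ ≤ (C * wt m ^ p * d i) * (C' * wt m ^ (s - p)) :=
          mul_le_mul (hy i m) (hz i m) (norm_nonneg _) ((norm_nonneg _).trans (hy i m))
      _ = C * C' * (wt m ^ p * wt m ^ (s - p)) * d i := by ring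
      _ = _ := by rw [← zpow_add₀ (wt_pos m).ne', add_sub_cancel]
  obtain ⟨p, C, hDl⟩ := (tD 0).lip
  obtain ⟨p', C', hEl⟩ := (tE 0).lip
  have r0 : Rap 0 w := by
    refine rap_zero_of bd fun s => ?_
    refine lop_apriori ha (ι := ℝ × ℝ) (α := fun i l => D l i.1 * n i.1) (e := fun i l => E l i.1)
        (β := fun i l => K * D l i.1 * w l i.2) (η := fun i l => w l i.1 - w l i.2)
        (f := fun i m => (D m i.1 - D m i.2) * (n i.2 * w m i.2)
        + (E m i.1 - E m i.2) * (a m + conv a (fun l => w l i.2) m)) (δ := fun i => |i.1 - i.2|)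
        (fun i => small i.1 i.1 i.2) (fun i => hα i.1 i.1) (fun i => hE' i.1)
        (rβ (fun i : ℝ × ℝ => i.1) (fun i => i.2))
        (fun i => abs_nonneg _) (fun s => ?_) (fun i => ?_) diff_eq s
    · obtain ⟨C1, h1⟩ := prodb (d := fun i : ℝ × ℝ => |i.1 - i.2|) (y := fun i m => D m i.1 - D m i.2) hDl (z := fun i m => n i.2 * w m i.2)
        (fun s => let ⟨C, hC⟩ := bd2 s; ⟨C, fun i m => hC i.2 m⟩) s
      obtain ⟨C2, h2⟩ := prodb (d := fun i : ℝ × ℝ => |i.1 - i.2|) (y := fun i m => E m i.1 - E m i.2) hEl (z := fun i m => a m + conv a (fun l => w l i.2) m)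
        (fun s => let ⟨C, hC⟩ := bd3 s; ⟨C, fun i m => hC i.2 m⟩) s
      exact ⟨C1 + C2, fun i m => (norm_add_le _ _).trans (by linarith [h1 i m, h2 i m])⟩
    · exact ⟨1 + 1, fun m => (norm_sub_le _ _).trans (add_le_add (hw _ m) (hw _ m))⟩
  -- The scalar inherits the regularity of `w`, so in the induction it may be used as a coefficient
  -- with `r` derivatives.
  have tn : ∀ r, Rap r w → Temp r (fun _ t => n t) := fun r hr =>
    (temp_const r K).mul ((temp_const r (a 0)).add ((hr.conv ha).eval 0))
  induction r with
  | zero => exact r0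
  | succ r ih =>
    -- The derivative of the map in the parameter with `w` frozen. The candidate derivative of `w`
    -- solves the equation linearized at `w` with this source.
    set g : ℤ → ℝ → ℂ := fun m t => deriv (D m) t * (n t * w m t)
      + deriv (E m) t * (a m + conv a (fun l => w l t) m) with hg
    have rg : Rap r g := ((tD (r + 1)).deriv.mul_rap ((tn r ih).mul_rap ih)).add
      ((tE (r + 1)).deriv.mul_rap ((rap_const r ha).add (ih.conv ha)))
    obtain ⟨BG, hBG⟩ := rg.bound_sup
    choose z hzb hz using fun t => exists_lop_solution ha (small t t t) (hBG t)
    have rz : Rap r (fun m t => z t m) :=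
      Rap.lop_solution ha (α := fun m t => D m t * n t) (e := E) (β := fun m t => K * D m t * w m t)
        (fun t => small t t t) (fun t => hα t t) hE' ((tD r).mul (tn r ih)) (tE r)
        (((temp_const r K).mul (tD r)).mul_rap ih) rg (fun t => ⟨_, hzb t⟩) hz
    obtain ⟨q, c1, hαl⟩ := ((tD 0).mul (tn 0 r0)).lip
    obtain ⟨q1, c2, hDt⟩ := (tD 1).taylor
    obtain ⟨q2, c3, hEt⟩ := (tE 1).taylor
    obtain ⟨C1, h1⟩ := prodb (d := fun i : ℝ × ℝ => |i.1 - i.2| ^ 2)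
      (y := fun i m => D m i.1 - D m i.2 - ((i.1 - i.2 : ℝ) : ℂ) * deriv (D m) i.2) hDt (z := fun i m => n i.2 * w m i.2)
      (fun s => let ⟨C, hC⟩ := bd2 s; ⟨C, fun i m => hC i.2 m⟩) 0
    obtain ⟨C2, h2⟩ := prodb (d := fun i : ℝ × ℝ => |i.1 - i.2| ^ 2)
      (y := fun i m => E m i.1 - E m i.2 - ((i.1 - i.2 : ℝ) : ℂ) * deriv (E m) i.2) hEt (z := fun i m => a m + conv a (fun l => w l i.2) m)
      (fun s => let ⟨C, hC⟩ := bd3 s; ⟨C, fun i m => hC i.2 m⟩) 0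
    obtain ⟨C3, h3⟩ := lop_bound ha (ι := ℝ × ℝ)
      (α := fun i l => D l i.1 * n i.1 - D l i.2 * n i.2)
      (e := fun i l => E l i.1 - E l i.2)
      (β := fun i l => K * D l i.1 * w l i.2 - K * D l i.2 * w l i.2)
      (Y := fun i l => z i.2 l) (d := fun i => |i.1 - i.2|) hαl hEl (fun s => by
        obtain ⟨C, hC⟩ := prodb (d := fun i : ℝ × ℝ => |i.1 - i.2|) (y := fun i m => D m i.1 - D m i.2) hDl (z := fun i m => K * w m i.2) (fun s => by
          obtain ⟨C, hC⟩ := bd s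
          refine ⟨‖K‖ * C, fun i m => ?_⟩
          rw [norm_mul, mul_assoc]
          exact mul_le_mul_of_nonneg_left (hC _ m) (norm_nonneg _)) s
        refine ⟨C, fun i m => ?_⟩
        convert hC i m using 2
        ring)
      (fun s => let ⟨C, hC⟩ := rz.bound s; ⟨C, fun i m => hC i.2 m⟩) 0
    refine rap_succ_of r0 rz (hasDerivAt_of_lop ha (α := fun i l => D l i.1 * n i.1)
      (e := fun i l => E l i.1) (β := fun i l => K * D l i.1 * w l i.2)
      (fun i => small i.1 i.1 i.2) hw hzb
      (C := C1 + C2 + C3) (fun i m => ?_))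
    have h1 := h1 i m
    have h2 := h2 i m
    have h3 := h3 i m
    rw [zpow_zero, mul_one] at h1 h2 h3
    rw [lop_coeff_sub] at h3
    have hyd : ∀ l, ‖w l i.1 - w l i.2‖ ≤ 1 + 1 := fun l =>
      (norm_sub_le _ _).trans (add_le_add (hw _ _) (hw _ _))
    have hzd : ∀ l, ‖((i.1 - i.2 : ℝ) : ℂ) * z i.2 l‖ ≤ |i.1 - i.2| * (2 * BG) := fun l => by
      rw [norm_mul, Complex.norm_real, Real.norm_eq_abs]
      gcongr; exact hzb _ _
    rw [lop_sub ha hyd hzd, lop_const_mul]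
    have hz2 := hz i.2 m
    have hy1 := diff_eq i m
    rw [hg] at hz2
    simp only at hz2
    set δ : ℂ := ((i.1 - i.2 : ℝ) : ℂ) with hδ
    have nδ : ‖δ‖ = |i.1 - i.2| := by rw [hδ, Complex.norm_real, Real.norm_eq_abs]
    calc _ = ‖(D m i.1 - D m i.2 - δ * deriv (D m) i.2) * (n i.2 * w m i.2)
          + (E m i.1 - E m i.2 - δ * deriv (E m) i.2) * (a m + conv a (fun l => w l i.2) m)
          + δ * (lop a (fun l => D l i.1 * n i.1) (fun l => E l i.1)
              (fun l => K * D l i.1 * w l i.2) (z i.2) m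
            - lop a (fun l => D l i.2 * n i.2) (fun l => E l i.2)
              (fun l => K * D l i.2 * w l i.2) (z i.2) m)‖ := by
            congr 1
            linear_combination hy1 - δ * hz2
      _ ≤ C1 * |i.1 - i.2| ^ 2 + C2 * |i.1 - i.2| ^ 2 + |i.1 - i.2| * (C3 * |i.1 - i.2|) := by
        refine norm_add₃_le.trans (add_le_add (add_le_add h1 h2) ?_)
        rw [norm_mul, nδ]
        gcongr
      _ = _ := by ring

end correction

/-! ### The coefficients of the correction equation as functions of `h = 1/κ`. -/

/-- The quadratic polynomial in the symbol `(κ + M)³ - κ³ = M κ² (3 + 3 (M / κ) + (M / κ)²)`. -/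
def qpoly (s : ℝ) : ℝ := 3 + 3 * s + s ^ 2

/-- The minimum is at `s = -3/2`. Its positivity means that no mode resonates with the leading one,
whatever `κ`, and allows division uniformly in `m` and `h`. -/
lemma qpoly_ge (s : ℝ) : 3 / 4 ≤ qpoly s := by unfold qpoly; nlinarith [sq_nonneg (s + 3 / 2)]

lemma qpoly_pos (s : ℝ) : 0 < qpoly s := lt_of_lt_of_le (by norm_num) (qpoly_ge s)

/-- This cancels the factor `1 + h * freq m` in `coeffE`, which is not bounded uniformly in `m`. -/
lemma abs_one_add_le_qpoly (s : ℝ) : |1 + s| ≤ qpoly s := by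
  unfold qpoly
  rw [abs_le]
  constructor <;> nlinarith [sq_nonneg (s + 2), sq_nonneg (s + 1)]

/-- The frequency `2 π m`. -/
def freq (m : ℤ) : ℝ := 2 * Real.pi * m

lemma freq_zero : freq 0 = 0 := by simp [freq]

lemma freq_neg (m : ℤ) : freq (-m) = -freq m := by simp [freq]

lemma freq_ne_zero {m : ℤ} (hm : m ≠ 0) : freq m ≠ 0 := by
  unfold freq
  have : (m : ℝ) ≠ 0 := by exact_mod_cast hm
  have := Real.pi_pos
  positivity

lemma three_wt_le_abs_freq {m : ℤ} (hm : m ≠ 0) : 3 * wt m ≤ |freq m| := by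
  have h1 : (1 : ℝ) ≤ |(m : ℝ)| := by exact_mod_cast Int.one_le_abs hm
  unfold freq wt
  rw [abs_mul, abs_of_pos Real.two_pi_pos]
  nlinarith [Real.pi_gt_three]

lemma abs_freq_le_wt (m : ℤ) : |freq m| ≤ 7 * wt m := by
  unfold freq wt
  rw [abs_mul, abs_of_pos Real.two_pi_pos]
  have := Real.pi_lt_d2
  have := Real.pi_gt_three
  nlinarith [abs_nonneg (m : ℝ)]

/-- The coefficient of the nonlinear term of the equation for the correction; it vanishes
at `m = 0` as `freq 0 = 0`. -/
def coeffD (k h : ℝ) (m : ℤ) : ℂ :=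
  -Complex.I * ((h / (k ^ 3 * freq m * qpoly (h * freq m)) : ℝ) : ℂ)

/-- The coefficient of the linear term of the equation for the correction. -/
def coeffE (k h : ℝ) (m : ℤ) : ℂ :=
  ((h * (1 + h * freq m) / (k ^ 2 * freq m * qpoly (h * freq m)) : ℝ) : ℂ)

lemma coeffD_le {k h h₀ : ℝ} (hk : 0 < k) (hh : |h| ≤ h₀) (m : ℤ) :
    ‖coeffD k h m‖ ≤ h₀ * (1 / k ^ 3 + 1 / k ^ 2) * wt m ^ (-1 : ℤ) := by
  have h0 : 0 ≤ h₀ := (abs_nonneg _).trans hh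
  have hw := wt_pos m
  by_cases hm : m = 0
  · subst hm; simp only [coeffD, freq_zero, mul_zero, zero_mul, div_zero, Complex.ofReal_zero, norm_zero]
    positivity
  · have h3 := three_wt_le_abs_freq hm
    have hq := qpoly_ge (h * freq m)
    have : ‖coeffD k h m‖ = |h| / (k ^ 3 * |freq m| * qpoly (h * freq m)) := by
      unfold coeffD
      rw [norm_mul, norm_neg, Complex.norm_I, one_mul, Complex.norm_real, Real.norm_eq_abs, abs_div,
        abs_mul, abs_mul, abs_of_pos (pow_pos hk 3), abs_of_pos (qpoly_pos _)]
    rw [this, zpow_neg_one]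
    calc _ ≤ h₀ / (k ^ 3 * (3 * wt m) * (3 / 4)) := by
          apply div_le_div₀ h0 hh (by positivity)
          gcongr
      _ ≤ h₀ * (1 / k ^ 3) * (wt m)⁻¹ := by
        rw [div_le_iff₀ (by positivity)]
        have : h₀ * (1 / k ^ 3) * (wt m)⁻¹ * (k ^ 3 * (3 * wt m) * (3 / 4)) = h₀ * (9 / 4) := by
          field_simp; norm_num
        rw [this]; linarith
      _ ≤ _ := by
        gcongr
        have : 0 < 1 / k ^ 2 := by positivity
        linarith

lemma coeffE_le {k h h₀ : ℝ} (hk : 0 < k) (hh : |h| ≤ h₀) (m : ℤ) :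
    ‖coeffE k h m‖ ≤ h₀ * (1 / k ^ 3 + 1 / k ^ 2) * wt m ^ (-1 : ℤ) := by
  have h0 : 0 ≤ h₀ := (abs_nonneg _).trans hh
  have hw := wt_pos m
  by_cases hm : m = 0
  · subst hm; simp only [coeffE, freq_zero, mul_zero, zero_mul, div_zero, Complex.ofReal_zero, norm_zero]
    positivity
  · have h3 := three_wt_le_abs_freq hm
    have hq := qpoly_pos (h * freq m)
    have hq1 := abs_one_add_le_qpoly (h * freq m)
    have hf : 0 < |freq m| := abs_pos.mpr (freq_ne_zero hm)
    have : ‖coeffE k h m‖ = |h| * |1 + h * freq m| / (k ^ 2 * |freq m| * qpoly (h * freq m)) := by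
      unfold coeffE
      rw [Complex.norm_real, Real.norm_eq_abs, abs_div, abs_mul,
        abs_mul, abs_mul, abs_of_pos (pow_pos hk 2), abs_of_pos (qpoly_pos _)]
    rw [this, zpow_neg_one]
    calc _ ≤ h₀ * qpoly (h * freq m) / (k ^ 2 * |freq m| * qpoly (h * freq m)) := by gcongr
      _ = h₀ / (k ^ 2 * |freq m|) := by field_simp
      _ ≤ h₀ / (k ^ 2 * wt m) := by gcongr; linarith
      _ = h₀ * (1 / k ^ 2) * (wt m)⁻¹ := by field_simp
      _ ≤ _ := by
        gcongr
        have : 0 < 1 / k ^ 3 := by positivity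
        linarith

lemma temp_of_hasCompactSupport (r : ℕ) {g : ℝ → ℂ} (hg : ContDiff ℝ ∞ g) (hc : HasCompactSupport g) :
    Temp r (fun _ => g) := by
  have bd : ∀ {g : ℝ → ℂ}, ContDiff ℝ ∞ g → HasCompactSupport g → ∃ C, ∀ t, ‖g t‖ ≤ C := by
    intro g hg hc
    exact hc.exists_bound_of_continuous hg.continuous
  have key : Cls r 0 (fun _ : ℤ => g) := by
    induction r generalizing g with
    | zero =>
      obtain ⟨C, hC⟩ := bd hg hc
      obtain ⟨C', hC'⟩ := bd (contDiff_infty_iff_deriv.mp hg).2 hc.deriv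
      have h0 := (norm_nonneg _).trans (hC 0)
      have h0' := (norm_nonneg _).trans (hC' 0)
      refine .base ⟨⟨C + C', by positivity, fun m t => ?_, fun m t t' => ?_⟩⟩
      · simp only [zpow_zero, mul_one]; linarith [hC t]
      · have h2 := Convex.norm_image_sub_le_of_norm_deriv_le (𝕜 := ℝ) (f := g) (s := univ) (x := t')
          (y := t) (C := C') (fun x _ => (hg.differentiable (by simp)) x) (fun x _ => hC' x)
          convex_univ (mem_univ _) (mem_univ _)
        rw [Real.norm_eq_abs] at h2
        simp only [zpow_zero, mul_one]
        refine h2.trans ?_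
        gcongr; linarith
    | succ r ih =>
      obtain ⟨C, hC⟩ := bd hg hc
      refine cls_succ_of_deriv (C := C) (fun m t => by simpa using hC t)
        (fun m => hg.differentiable (by simp)) ?_
      exact ih (contDiff_infty_iff_deriv.mp hg).2 hc.deriv
  exact ⟨0, key⟩

/-- A smooth compactly supported truncation of the identity. -/
lemma exists_cutoff {h₀ : ℝ} (h : 0 < h₀) : ∃ χ : ℝ → ℝ, ContDiff ℝ ∞ χ ∧ HasCompactSupport χ ∧
    (∀ t, |χ t| ≤ h₀) ∧ ∀ t, |t| ≤ h₀ / 2 → χ t = t := by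
  let b : ContDiffBump (0 : ℝ) := ⟨h₀ / 2, h₀, by positivity, by linarith⟩
  refine ⟨fun t => t * b t, contDiff_id.mul b.contDiff, b.hasCompactSupport.mul_left, fun t => ?_,
    fun t ht => ?_⟩
  · change |t * b t| ≤ h₀
    by_cases ht : |t| < h₀
    · rw [abs_mul, abs_of_nonneg b.nonneg]
      have := b.le_one (x := t)
      have := b.nonneg (x := t)
      nlinarith [abs_nonneg t]
    · rw [b.zero_of_le_dist (by simpa using not_lt.mp ht)]
      simpa using h.le
  · change t * b t = t
    rw [b.one_of_mem_closedBall (by simpa using ht), mul_one]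

lemma temp_freq (r : ℕ) : Temp r (fun m _ => (freq m : ℂ)) :=
  ⟨1, cls_const r (C := 7) fun m => by
    rw [Complex.norm_real, Real.norm_eq_abs, zpow_one]; exact abs_freq_le_wt m⟩

lemma temp_inv_freq (r : ℕ) : Temp r (fun m _ => (freq m : ℂ)⁻¹) :=
  ⟨0, cls_const r (C := 1) fun m => by
    rw [norm_inv, Complex.norm_real, Real.norm_eq_abs, zpow_zero, mul_one]
    by_cases hm : m = 0
    · subst hm; simp [freq_zero]
    · have := three_wt_le_abs_freq hm
      have := one_le_wt m
      exact inv_le_one_of_one_le₀ (by linarith)⟩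

/-- The argument of `qpoly` contains the product of `h` and the frequency, so derivatives in `h` can
produce powers of `freq m`: temperedness suffices here, the decay being supplied by the correction.
-/
lemma temp_inv_qpoly (r : ℕ) {χ : ℝ → ℝ} (tχ : Temp r (fun _ t => (χ t : ℂ))) :
    Temp r (fun m t => ((qpoly (χ t * freq m) : ℝ) : ℂ)⁻¹) := by
  refine Temp.inv (c := 3 / 4) ?_ (by norm_num) (fun m t => ?_)
  · have h1 := tχ.mul (temp_freq r)
    have := ((temp_const r 3).add ((temp_const r 3).mul h1)).add (h1.mul h1)
    convert this using 3 with m t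
    unfold qpoly
    push_cast
    ring
  · rw [Complex.norm_real, Real.norm_eq_abs, abs_of_pos (qpoly_pos _)]
    exact qpoly_ge _

lemma temp_coeffD (r : ℕ) (k : ℝ) {χ : ℝ → ℝ} (tχ : Temp r (fun _ t => (χ t : ℂ))) :
    Temp r (fun m t => coeffD k (χ t) m) := by
  have := (((temp_const r (-Complex.I * ((k ^ 3 : ℝ) : ℂ)⁻¹)).mul tχ).mul (temp_inv_freq r)).mul
    (temp_inv_qpoly r tχ)
  convert this using 3 with m t
  unfold coeffD
  push_cast
  rw [div_eq_mul_inv, mul_inv, mul_inv]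
  ring

lemma temp_coeffE (r : ℕ) (k : ℝ) {χ : ℝ → ℝ} (tχ : Temp r (fun _ t => (χ t : ℂ))) :
    Temp r (fun m t => coeffE k (χ t) m) := by
  have := ((((temp_const r ((k ^ 2 : ℝ) : ℂ)⁻¹).mul tχ).mul
    ((temp_const r 1).add (tχ.mul (temp_freq r)))).mul (temp_inv_freq r)).mul (temp_inv_qpoly r tχ)
  convert this using 3 with m t
  unfold coeffE
  push_cast
  rw [div_eq_mul_inv, mul_inv, mul_inv]
  ring

/-- The smallness condition on the range of `h`. -/
def SmallRange (a : ℤ → ℂ) (k h₀ : ℝ) : Prop :=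
  h₀ * (1 / k ^ 3 + 1 / k ^ 2) * ((4 * ‖-Complex.I * (k : ℂ)‖ + 4) * ∑' l, ‖a l‖) ≤ 1 / 2

/-- The correction of the eigenfunction, as a smooth function of `h = 1 / κ`. -/
lemma exists_smooth_correction {a : ℤ → ℂ} (ha : RapidSeq a) {k h₀ : ℝ} (hk : 0 < k) (h0 : 0 < h₀)
    (hs : SmallRange a k h₀) : ∃ w : ℤ → ℝ → ℂ, (∀ r, Rap r w) ∧ (∀ t m, ‖w m t‖ ≤ 1) ∧
      ∀ h, |h| ≤ h₀ / 2 →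
        (∀ m, corrMap a (-Complex.I * k) (coeffD k h) (coeffE k h) (fun l => w l h) m = w m h) ∧
        ∀ z : ℤ → ℂ, (∀ m, ‖z m‖ ≤ 1) →
          (∀ m, corrMap a (-Complex.I * k) (coeffD k h) (coeffE k h) z m = z m) →
          z = fun l => w l h := by
  -- Replacing `h` by `χ h` makes the coefficients small for every real parameter without changing
  -- them for `|h| ≤ h₀ / 2`, so the estimates uniform over `ℝ` apply.
  obtain ⟨χ, χs, χc, χb, χid⟩ := exists_cutoff h0
  have tχ : ∀ r, Temp r (fun _ t => (χ t : ℂ)) := fun r =>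
    temp_of_hasCompactSupport r (Complex.ofRealCLM.contDiff.comp χs)
      (χc.comp_left (g := fun x : ℝ => (x : ℂ)) (by simp))
  choose w hw hfix huniq using fun t => exists_correction ha hs
    (fun m => coeffD_le hk (χb t) m) (fun m => coeffE_le hk (χb t) m)
  refine ⟨fun m t => w t m, fun r => ?_, hw, fun h hh => ?_⟩
  · exact rap_correction ha hs (D := fun m t => coeffD k (χ t) m) (E := fun m t => coeffE k (χ t) m)
      (fun t m => coeffD_le hk (χb t) m) (fun t m => coeffE_le hk (χb t) m)
      (fun r => temp_coeffD r k (tχ r)) (fun r => temp_coeffE r k (tχ r)) hw hfix r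
  · have := hfix h
    have hu := huniq h
    rw [χid h hh] at this hu
    exact ⟨this, hu⟩

/-! ### Smoothness of Fourier series whose coefficients depend on a parameter. -/

lemma Rap.contDiff {y : ℤ → ℝ → ℂ} (hy : ∀ r, Rap r y) (m : ℤ) : ContDiff ℝ ∞ (y m) := by
  have : ∀ (n : ℕ) {y : ℤ → ℝ → ℂ}, (∀ r, Rap r y) → ContDiff ℝ n (y m) := by
    intro n
    induction n with
    | zero =>
      intro y hy
      exact contDiff_zero.mpr ((hy 1 0).differentiable m).continuous
    | succ n ih =>
      intro y hy
      rw [Nat.cast_succ, contDiff_succ_iff_deriv]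
      exact ⟨(hy 1 0).differentiable m, fun h => by simp at h, ih fun r => (hy (r + 1)).deriv⟩
  exact contDiff_infty.mpr fun n => this n hy

lemma Rap.iteratedDeriv_bound (n : ℕ) {y : ℤ → ℝ → ℂ} (hy : ∀ r, Rap r y) (s : ℤ) :
    ∃ C, ∀ t m, ‖iteratedDeriv n (y m) t‖ ≤ C * wt m ^ s := by
  induction n generalizing y with
  | zero => simpa using (hy 0).bound s
  | succ n ih =>
    simp only [iteratedDeriv_succ']
    exact ih fun r => (hy (r + 1)).deriv

/-- The Fourier mode `e^{2iπmx}`. -/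
def mode (m : ℤ) (x : ℝ) : ℂ := Complex.exp (2 * Real.pi * Complex.I * m * x)

lemma mode_eq (m : ℤ) (x : ℝ) : mode m x = Complex.exp (Complex.I * freq m * x) := by
  unfold mode freq; congr 1; push_cast; ring

lemma norm_mode (m : ℤ) (x : ℝ) : ‖mode m x‖ = 1 := by
  rw [mode_eq, show Complex.I * freq m * x = ((freq m * x : ℝ) : ℂ) * Complex.I by push_cast; ring]
  exact Complex.norm_exp_ofReal_mul_I _

lemma hasDerivAt_mode (m : ℤ) (x : ℝ) : HasDerivAt (mode m) (Complex.I * freq m * mode m x) x := by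
  have h1 : HasDerivAt (fun x : ℝ => Complex.I * freq m * (x : ℂ)) (Complex.I * freq m) x := by
    simpa using (Complex.ofRealCLM.hasDerivAt (x := x)).const_mul (Complex.I * freq m)
  refine (h1.cexp.congr_of_eventuallyEq
    (Filter.Eventually.of_forall fun x => mode_eq m x)).congr_deriv ?_
  rw [mode_eq]; ring

lemma contDiff_mode (m : ℤ) : ContDiff ℝ ∞ (mode m) := by
  unfold mode
  exact (contDiff_const.mul Complex.ofRealCLM.contDiff).cexp

lemma iteratedDeriv_mode (n : ℕ) (m : ℤ) :
    iteratedDeriv n (mode m) = fun x => (Complex.I * freq m) ^ n * mode m x := by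
  induction n with
  | zero => ext x; simp
  | succ n ih =>
    rw [iteratedDeriv_succ, ih]
    ext x
    rw [((hasDerivAt_mode m x).const_mul _).deriv]
    ring

lemma mode_periodic (m : ℤ) : Periodic (mode m) 1 := fun x => by
  unfold mode
  rw [Complex.exp_eq_exp_iff_exists_int]
  exact ⟨m, by push_cast; ring⟩

/-- The function of `(h, x)` whose Fourier coefficients in `x` are `y m h` is smooth. -/
lemma contDiff_fourierSeries {y : ℤ → ℝ → ℂ} (hy : ∀ r, Rap r y) :
    ContDiff ℝ ∞ fun q : ℝ × ℝ => ∑' m, y m q.1 * mode m q.2 := by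
  have hle : ∀ j : ℕ, (j : WithTop ℕ∞) ≤ ∞ := fun j => by exact_mod_cast le_top
  have hb : ∀ n : ℕ, ∃ C, ∀ m (x : ℝ × ℝ),
      ‖iteratedFDeriv ℝ n (fun q : ℝ × ℝ => y m q.1 * mode m q.2) x‖ ≤ C * wt m ^ (-2 : ℤ) := by
    intro n
    -- Up to `n` derivatives falling on the mode cost `wt m ^ n`; the exponent `-2` that remains is
    -- summable.
    choose C hC using fun j : ℕ => Rap.iteratedDeriv_bound j hy (-2 - n)
    refine ⟨∑ i ∈ Finset.range (n + 1), (n.choose i : ℝ) * |C i| * 7 ^ n, fun m x => ?_⟩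
    have h1 : ContDiff ℝ ∞ fun q : ℝ × ℝ => y m q.1 := (Rap.contDiff hy m).comp contDiff_fst
    have h2 : ContDiff ℝ ∞ fun q : ℝ × ℝ => mode m q.2 := (contDiff_mode m).comp contDiff_snd
    refine (norm_iteratedFDeriv_mul_le h1 h2 x (by exact_mod_cast le_top)).trans ?_
    rw [Finset.sum_mul]
    refine Finset.sum_le_sum fun i hi => ?_
    have hin : i ≤ n := by simpa [Nat.lt_succ_iff] using hi
    have b1 : ‖iteratedFDeriv ℝ i (fun q : ℝ × ℝ => y m q.1) x‖ ≤ |C i| * wt m ^ (-2 - n : ℤ) := by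
      have e := ContinuousLinearMap.iteratedFDeriv_comp_right (ContinuousLinearMap.fst ℝ ℝ ℝ)
        (Rap.contDiff hy m) x (i := i) (hle i)
      have e' : (y m ∘ (ContinuousLinearMap.fst ℝ ℝ ℝ)) = fun q : ℝ × ℝ => y m q.1 := rfl
      rw [e'] at e
      rw [e]
      refine (ContinuousMultilinearMap.norm_compContinuousLinearMap_le _ _).trans ?_
      rw [norm_iteratedFDeriv_eq_norm_iteratedDeriv]
      have hf : ∏ _j : Fin i, ‖ContinuousLinearMap.fst ℝ ℝ ℝ‖ ≤ 1 :=
        Finset.prod_le_one (fun _ _ => norm_nonneg _) fun _ _ => ContinuousLinearMap.norm_fst_le ..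
      have h3 := hC i x.1 m
      have h4 : C i * wt m ^ (-2 - n : ℤ) ≤ |C i| * wt m ^ (-2 - n : ℤ) :=
        mul_le_mul_of_nonneg_right (le_abs_self _) (wt_zpow_pos _ _).le
      calc _ ≤ (|C i| * wt m ^ (-2 - n : ℤ)) * 1 :=
            mul_le_mul (h3.trans h4) hf (Finset.prod_nonneg fun _ _ => norm_nonneg _)
              (mul_nonneg (abs_nonneg _) (wt_zpow_pos _ _).le)
        _ = _ := mul_one _
    have b2 : ‖iteratedFDeriv ℝ (n - i) (fun q : ℝ × ℝ => mode m q.2) x‖ ≤ 7 ^ n * wt m ^ n := by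
      have e := ContinuousLinearMap.iteratedFDeriv_comp_right (ContinuousLinearMap.snd ℝ ℝ ℝ)
        (contDiff_mode m) x (i := n - i) (hle _)
      have e' : (mode m ∘ (ContinuousLinearMap.snd ℝ ℝ ℝ)) = fun q : ℝ × ℝ => mode m q.2 := rfl
      rw [e'] at e
      rw [e]
      refine (ContinuousMultilinearMap.norm_compContinuousLinearMap_le _ _).trans ?_
      rw [norm_iteratedFDeriv_eq_norm_iteratedDeriv, iteratedDeriv_mode]
      have hf : ∏ _j : Fin (n - i), ‖ContinuousLinearMap.snd ℝ ℝ ℝ‖ ≤ 1 :=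
        Finset.prod_le_one (fun _ _ => norm_nonneg _) fun _ _ => ContinuousLinearMap.norm_snd_le ..
      have h3 : ‖(Complex.I * freq m) ^ (n - i) * mode m x.2‖ ≤ 7 ^ n * wt m ^ n := by
        rw [norm_mul, norm_mode, mul_one, norm_pow, norm_mul, Complex.norm_I, one_mul,
          Complex.norm_real, Real.norm_eq_abs, ← mul_pow]
        have h7 := one_le_wt m
        calc |freq m| ^ (n - i) ≤ (7 * wt m) ^ (n - i) :=
              pow_le_pow_left₀ (abs_nonneg _) (abs_freq_le_wt m) _
          _ ≤ (7 * wt m) ^ n := pow_le_pow_right₀ (by linarith) (Nat.sub_le _ _)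
      calc _ ≤ (7 ^ n * wt m ^ n) * 1 :=
            mul_le_mul h3 hf (Finset.prod_nonneg fun _ _ => norm_nonneg _)
              (mul_nonneg (by positivity) (pow_nonneg (wt_pos m).le _))
        _ = _ := mul_one _
    calc _ ≤ (n.choose i : ℝ) * (|C i| * wt m ^ (-2 - n : ℤ)) * (7 ^ n * wt m ^ n) := by
          have := (wt_zpow_pos m (-2 - n : ℤ)).le
          gcongr
      _ = (n.choose i : ℝ) * |C i| * 7 ^ n * (wt m ^ (-2 - n : ℤ) * wt m ^ n) := by ring
      _ = _ := by
        rw [← zpow_natCast (wt m) n, ← zpow_add₀ (wt_pos m).ne']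
        congr 2; ring
  choose C hC using hb
  exact contDiff_tsum (v := fun n m => C n * wt m ^ (-2 : ℤ))
    (fun m => ((Rap.contDiff hy m).comp contDiff_fst).mul ((contDiff_mode m).comp contDiff_snd))
    (fun n _ => summable_wt.mul_left _) (fun n m x _ => hC n m x)

/-! ### Fourier coefficients of periodic functions. -/

/-- The Fourier coefficients of a function of period one. -/
def fc (g : ℝ → ℂ) (m : ℤ) : ℂ := ∫ x in (0 : ℝ)..1, mode (-m) x * g x

lemma continuous_mode (m : ℤ) : Continuous (mode m) := (contDiff_mode m).continuous

lemma mode_add (m l : ℤ) (x : ℝ) : mode (m + l) x = mode m x * mode l x := by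
  unfold mode
  rw [← Complex.exp_add]; congr 1; push_cast; ring

lemma mode_zero (x : ℝ) : mode 0 x = 1 := by simp [mode]

lemma conj_mode (m : ℤ) (x : ℝ) : (starRingEnd ℂ) (mode m x) = mode (-m) x := by
  rw [mode_eq, mode_eq, ← Complex.exp_conj]
  congr 1
  simp [freq_neg]

lemma fourierCoeffOn_eq_fc (g : ℝ → ℂ) (m : ℤ) : fourierCoeffOn zero_lt_one g m = fc g m := by
  rw [fourierCoeffOn_eq_integral]
  simp only [sub_zero, div_one, one_smul]
  unfold fc
  refine intervalIntegral.integral_congr fun x _ => ?_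
  simp only [smul_eq_mul, fourier_coe_apply, mode]
  congr 2
  simp only [sub_zero, Complex.ofReal_one, div_one]

lemma ae_of_ae_restrict_of_periodic {p : ℝ → Prop} (hp : ∀ x, p (x + 1) ↔ p x)
    (h : ∀ᵐ x ∂(volume.restrict (Ioc (0 : ℝ) 1)), p x) : ∀ᵐ x, p x := by
  have hz : ∀ (n : ℤ) x, p (x + n) ↔ p x := by
    intro n
    induction n using Int.induction_on with
    | zero => simp
    | succ i ih => intro x; rw [← ih x, ← hp (x + (i : ℤ))]; push_cast; rw [add_assoc]
    | pred i ih => intro x; rw [← ih x, ← hp]; push_cast; ring_nf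
  rw [ae_restrict_iff' measurableSet_Ioc, ae_iff] at h
  rw [ae_iff]
  refine measure_mono_null (t := ⋃ n : ℤ, (fun x : ℝ => x + n) ⁻¹' {a | ¬(a ∈ Ioc (0 : ℝ) 1 → p a)})
    (fun x hx => ?_) (measure_iUnion_null fun n => ?_)
  · obtain ⟨n, hn, -⟩ := existsUnique_add_zsmul_mem_Ioc (zero_lt_one' ℝ) x 0
    simp only [zsmul_eq_mul, mul_one, zero_add] at hn
    refine mem_iUnion.mpr ⟨n, ?_⟩
    simp only [mem_preimage]
    intro hc
    exact hx ((hz n x).mp (hc hn))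
  · rw [measure_preimage_add_right]; exact h

lemma MemL2per.intervalIntegrable {g : ℝ → ℂ} (hg : MemL2per g) (a b : ℝ) :
    IntervalIntegrable g volume a b := by
  refine hg.1.intervalIntegrable one_ne_zero (t := 0) ?_ a b
  rw [zero_add, intervalIntegrable_iff_integrableOn_Ioc_of_le zero_le_one]
  exact hg.2.integrable (by norm_num)

lemma MemL2per.add {g h : ℝ → ℂ} (hg : MemL2per g) (hh : MemL2per h) :
    MemL2per (fun x => g x + h x) := ⟨hg.1.add hh.1, hg.2.add hh.2⟩

lemma MemL2per.const_mul {g : ℝ → ℂ} (c : ℂ) (hg : MemL2per g) :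
    MemL2per (fun x => c * g x) := ⟨fun x => by simp only [hg.1 x], hg.2.const_mul c⟩

lemma MemL2per.sub {g h : ℝ → ℂ} (hg : MemL2per g) (hh : MemL2per h) :
    MemL2per (fun x => g x - h x) := ⟨hg.1.sub hh.1, hg.2.sub hh.2⟩

lemma memL2per_of_continuous {g : ℝ → ℂ} (hg : Continuous g) (hp : Periodic g 1) : MemL2per g := by
  refine ⟨hp, ?_⟩
  obtain ⟨C, hC⟩ := isCompact_Icc.exists_bound_of_continuousOn (s := Icc (0 : ℝ) 1) hg.continuousOn
  refine MemLp.of_bound hg.aestronglyMeasurable C ?_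
  rw [ae_restrict_iff' measurableSet_Ioc]
  exact Filter.Eventually.of_forall fun x hx => hC x (Ioc_subset_Icc_self hx)

lemma intervalIntegrable_mode_mul {g : ℝ → ℂ} {a b : ℝ} (hg : IntervalIntegrable g volume a b)
    (m : ℤ) : IntervalIntegrable (fun x => mode m x * g x) volume a b :=
  hg.continuousOn_mul (continuous_mode m).continuousOn

lemma fc_add {g h : ℝ → ℂ} (hg : IntervalIntegrable g volume 0 1)
    (hh : IntervalIntegrable h volume 0 1) (m : ℤ) :
    fc (fun x => g x + h x) m = fc g m + fc h m := by
  unfold fc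
  rw [← intervalIntegral.integral_add (intervalIntegrable_mode_mul hg _)
    (intervalIntegrable_mode_mul hh _)]
  simp only [mul_add]

lemma fc_sub {g h : ℝ → ℂ} (hg : IntervalIntegrable g volume 0 1)
    (hh : IntervalIntegrable h volume 0 1) (m : ℤ) :
    fc (fun x => g x - h x) m = fc g m - fc h m := by
  unfold fc
  rw [← intervalIntegral.integral_sub (intervalIntegrable_mode_mul hg _)
    (intervalIntegrable_mode_mul hh _)]
  simp only [mul_sub]

lemma fc_const_mul (c : ℂ) (g : ℝ → ℂ) (m : ℤ) : fc (fun x => c * g x) m = c * fc g m := by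
  unfold fc
  rw [← intervalIntegral.integral_const_mul]
  congr 1; ext x; ring

lemma fc_congr_ae {g h : ℝ → ℂ} (hgh : g =ᵐ[volume] h) (m : ℤ) : fc g m = fc h m := by
  unfold fc
  refine intervalIntegral.integral_congr_ae ?_
  filter_upwards [hgh] with x hx _
  rw [hx]

lemma norm_fc_le {g : ℝ → ℂ} {C : ℝ} (h : ∀ x, ‖g x‖ ≤ C) (m : ℤ) : ‖fc g m‖ ≤ C := by
  have := intervalIntegral.norm_integral_le_of_norm_le_const (a := 0) (b := 1) (C := C)
    (f := fun x => mode (-m) x * g x) (fun x _ => by rw [norm_mul, norm_mode, one_mul]; exact h x)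
  simpa [fc] using this

/-- Square integrable functions are determined by their Fourier coefficients. -/
lemma MemL2per.ae_eq_zero {g : ℝ → ℂ} (hg : MemL2per g) (h : ∀ m, fc g m = 0) :
    g =ᵐ[volume] 0 := by
  have h1 := hasSum_sq_fourierCoeffOn (zero_lt_one' ℝ) hg.2
  simp only [fourierCoeffOn_eq_fc, h, norm_zero, ne_eq, OfNat.ofNat_ne_zero, not_false_eq_true,
    zero_pow, sub_zero, inv_one, one_smul] at h1
  have h2 := h1.unique hasSum_zero
  rw [intervalIntegral.integral_of_le zero_le_one, integral_eq_zero_iff_of_nonneg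
    (fun x => by positivity) hg.2.norm.integrable_sq] at h2
  refine ae_of_ae_restrict_of_periodic (fun x => by rw [hg.1 x]; rfl) ?_
  filter_upwards [h2] with x hx
  simpa using hx

lemma MemL2per.ae_eq {g h : ℝ → ℂ} (hg : MemL2per g) (hh : MemL2per h) (e : ∀ m, fc g m = fc h m) :
    g =ᵐ[volume] h := by
  have := (hg.sub hh).ae_eq_zero fun m => by
    rw [fc_sub (hg.intervalIntegrable _ _) (hh.intervalIntegrable _ _), e, sub_self]
  filter_upwards [this] with x hx
  exact sub_eq_zero.mp hx

lemma eq_of_fc_eq {g h : ℝ → ℂ} (cg : Continuous g) (pg : Periodic g 1) (ch : Continuous h)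
    (ph : Periodic h 1) (e : ∀ m, fc g m = fc h m) : g = h :=
  (Continuous.ae_eq_iff_eq volume cg ch).mp
    ((memL2per_of_continuous cg pg).ae_eq (memL2per_of_continuous ch ph) e)

lemma integral_mode (m : ℤ) : ∫ x in (0 : ℝ)..1, mode m x = if m = 0 then 1 else 0 := by
  split_ifs with h
  · subst h; simp [mode_zero]
  · have hne : Complex.I * (freq m : ℂ) ≠ 0 :=
      mul_ne_zero Complex.I_ne_zero (by exact_mod_cast freq_ne_zero h)
    have := intervalIntegral.integral_eq_sub_of_hasDerivAt (a := 0) (b := 1)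
      (f := fun x => (Complex.I * (freq m : ℂ))⁻¹ * mode m x) (f' := mode m)
      (fun x _ => ((hasDerivAt_mode m x).const_mul _).congr_deriv (by rw [← mul_assoc, inv_mul_cancel₀ hne, one_mul]))
      ((continuous_mode m).intervalIntegrable _ _)
    rw [this]
    have := mode_periodic m 0
    rw [zero_add] at this
    rw [this, sub_self]

/-- Fourier coefficients of the product with an absolutely convergent Fourier series. -/
lemma fc_series_mul {a : ℤ → ℂ} (ha : Summable fun m => ‖a m‖) {g : ℝ → ℂ} (hg : Continuous g)
    (m : ℤ) : fc (fun x => (∑' l, a l * mode l x) * g x) m = ∑' l, a l * fc g (m - l) := by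
  obtain ⟨C, hC⟩ := isCompact_Icc.exists_bound_of_continuousOn (s := Icc (0 : ℝ) 1) hg.continuousOn
  have hC0 : 0 ≤ C := (norm_nonneg _).trans (hC 0 (by simp))
  unfold fc
  have h := intervalIntegral.hasSum_integral_of_dominated_convergence (μ := volume) (a := 0) (b := 1)
    (F := fun l x => a l * (mode (-(m - l)) x * g x))
    (f := fun x => mode (-m) x * ((∑' l, a l * mode l x) * g x)) (fun l _ => ‖a l‖ * C)
    (fun l => ((continuous_const.mul ((continuous_mode _).mul hg))).aestronglyMeasurable)
    (fun l => Filter.Eventually.of_forall fun x hx => ?_)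
    (Filter.Eventually.of_forall fun x hx => ha.mul_right C) (by simp)
    (Filter.Eventually.of_forall fun x hx => ?_)
  · rw [← h.tsum_eq]
    simp only [intervalIntegral.integral_const_mul]
  · rw [norm_mul, norm_mul, norm_mode, one_mul]
    rw [uIoc_of_le zero_le_one] at hx
    exact mul_le_mul_of_nonneg_left (hC x (Ioc_subset_Icc_self hx)) (norm_nonneg _)
  · have hs : Summable fun l => a l * mode l x :=
      Summable.of_norm_bounded ha fun l => by rw [norm_mul, norm_mode, mul_one]
    have := (hs.hasSum.mul_right (g x)).mul_left (mode (-m) x)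
    refine this.congr_fun fun l => ?_
    rw [neg_sub, sub_eq_add_neg, mode_add]; ring

lemma fc_series {a : ℤ → ℂ} (ha : Summable fun m => ‖a m‖) (m : ℤ) :
    fc (fun x => ∑' l, a l * mode l x) m = a m := by
  have h := fc_series_mul ha (g := fun _ => 1) continuous_const m
  simp only [mul_one] at h
  rw [h, tsum_eq_single m]
  · simp [fc, mode_zero]
  · intro l hl
    have : fc (fun _ => 1) (m - l) = 0 := by
      unfold fc
      simp only [mul_one]
      rw [integral_mode, if_neg (by omega)]
    rw [this, mul_zero]

lemma continuous_series {a : ℤ → ℂ} (ha : Summable fun m => ‖a m‖) :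
    Continuous fun x => ∑' l, a l * mode l x :=
  continuous_tsum (fun l => continuous_const.mul (continuous_mode l)) ha fun l x => by
    rw [norm_mul, norm_mode, mul_one]

lemma series_periodic (a : ℤ → ℂ) : Periodic (fun x => ∑' l, a l * mode l x) 1 := fun x => by
  simp only [mode_periodic _ x]

/-! ### Primitives of integrable functions and integration by parts. -/

/-- `G` is a primitive of the locally integrable function `g`. -/
structure IsPrimitive (G g : ℝ → ℂ) : Prop where
  integrable : ∀ a b, IntervalIntegrable g volume a b
  eq : ∀ x, G x = G 0 + ∫ y in (0 : ℝ)..x, g y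

lemma isPrimitive_deriv {G : ℝ → ℂ} (h : ContDiff ℝ 1 G) : IsPrimitive G (deriv G) where
  integrable a b := (h.continuous_deriv le_rfl).intervalIntegrable a b
  eq x := by
    rw [intervalIntegral.integral_eq_sub_of_hasDerivAt
      (fun x _ => (h.differentiable one_ne_zero x).hasDerivAt)
      ((h.continuous_deriv le_rfl).intervalIntegrable _ _)]
    ring

lemma IsPrimitive.continuous {G g : ℝ → ℂ} (h : IsPrimitive G g) : Continuous G := by
  have : G = fun x => G 0 + ∫ y in (0 : ℝ)..x, g y := funext h.eq
  rw [this]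
  exact continuous_const.add (intervalIntegral.continuous_primitive h.integrable 0)

lemma IsPrimitive.add {G g H h : ℝ → ℂ} (hG : IsPrimitive G g) (hH : IsPrimitive H h) :
    IsPrimitive (fun x => G x + H x) (fun x => g x + h x) where
  integrable a b := (hG.integrable a b).add (hH.integrable a b)
  eq x := by
    rw [intervalIntegral.integral_add (hG.integrable _ _) (hH.integrable _ _), hG.eq x, hH.eq x]
    ring

lemma IsPrimitive.const_mul {G g : ℝ → ℂ} (c : ℂ) (hG : IsPrimitive G g) :
    IsPrimitive (fun x => c * G x) (fun x => c * g x) where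
  integrable a b := (hG.integrable a b).const_mul c
  eq x := by
    rw [intervalIntegral.integral_const_mul, hG.eq x]
    ring

/-- Lebesgue differentiation. It is what gives meaning to the pointwise `deriv` in `blochSymbol` on
`H³`, where the third derivative exists only almost everywhere. -/
lemma IsPrimitive.ae_hasDerivAt {G g : ℝ → ℂ} (h : IsPrimitive G g) :
    ∀ᵐ x, HasDerivAt G (g x) x := by
  have hl : LocallyIntegrable g volume := by
    rw [locallyIntegrable_iff]
    intro K hK
    obtain ⟨R, hR⟩ := hK.isBounded.subset_closedBall 0
    rw [Real.closedBall_eq_Icc] at hR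
    by_cases hR0 : 0 ≤ R
    · have := h.integrable (0 - R) (0 + R)
      rw [intervalIntegrable_iff_integrableOn_Icc_of_le (by linarith)] at this
      exact this.mono_set hR
    · have : K = ∅ := by
        rw [Icc_eq_empty (by linarith)] at hR
        exact subset_empty_iff.mp hR
      rw [this]; exact integrableOn_empty
  filter_upwards [LocallyIntegrable.ae_hasDerivAt_integral hl] with x hx
  have := (hx 0).const_add (G 0)
  exact this.congr_of_eventuallyEq (Filter.Eventually.of_forall h.eq)

lemma absolutelyContinuous_integral {g : ℝ → ℂ} {x : ℝ} (h : IntervalIntegrable g volume 0 x) :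
    AbsolutelyContinuousOnInterval (fun y => ∫ t in (0 : ℝ)..y, g t) 0 x := by
  have hre : IntervalIntegrable (fun t => (g t).re) volume 0 x := ⟨h.1.re, h.2.re⟩
  have him : IntervalIntegrable (fun t => (g t).im) volume 0 x := ⟨h.1.im, h.2.im⟩
  have cst : ∀ z : ℂ, AbsolutelyContinuousOnInterval (fun _ : ℝ => z) 0 x := fun z =>
    contDiff_const.contDiffOn.absolutelyContinuousOnInterval
  have h1 := (hre.absolutelyContinuousOnInterval_intervalIntegral left_mem_uIcc).smul (cst 1)
  have h2 := (him.absolutelyContinuousOnInterval_intervalIntegral left_mem_uIcc).smul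
    (cst Complex.I)
  have h3 := h1.add h2
  rw [absolutelyContinuousOnInterval_iff] at h3 ⊢
  intro ε hε
  obtain ⟨δ, hδ, H⟩ := h3 ε hε
  refine ⟨δ, hδ, fun E hE hs => ?_⟩
  convert H E hE hs using 2 with i hi
  have key : ∀ y ∈ uIcc 0 x, (∫ t in (0 : ℝ)..y, g t) =
      (((fun y => ∫ t in (0 : ℝ)..y, (g t).re) • fun _ : ℝ => (1 : ℂ)) +
        ((fun y => ∫ t in (0 : ℝ)..y, (g t).im) • fun _ : ℝ => Complex.I)) y := by
    intro y hy
    have hy' : IntervalIntegrable g volume 0 y := h.mono_set (uIcc_subset_uIcc_left hy)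
    simp only [Pi.add_apply, Pi.smul_apply', Complex.real_smul, mul_one]
    apply Complex.ext
    · have e := Complex.reCLM.intervalIntegral_comp_comm hy'
      simp only [Complex.reCLM_apply] at e
      rw [← e]; simp
    · have e := Complex.imCLM.intervalIntegral_comp_comm hy'
      simp only [Complex.imCLM_apply] at e
      rw [← e]; simp
  have hm := hE.1 i hi
  rw [key _ hm.1, key _ hm.2]

/-- The product rule for primitives. -/
lemma IsPrimitive.mul {χ G g : ℝ → ℂ} (hχ : ContDiff ℝ 1 χ) (hG : IsPrimitive G g) :
    IsPrimitive (fun x => χ x * G x) (fun x => deriv χ x * G x + χ x * g x) := by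
  have cχ' := hχ.continuous_deriv le_rfl
  have hint : ∀ a b, IntervalIntegrable (fun x => deriv χ x * G x + χ x * g x) volume a b :=
    fun a b => ((cχ'.mul hG.continuous).intervalIntegrable a b).add
      ((hG.integrable a b).continuousOn_mul hχ.continuous.continuousOn)
  refine ⟨hint, fun x => ?_⟩
  have hP : IsPrimitive (fun y => ∫ t in (0 : ℝ)..y, (deriv χ t * G t + χ t * g t))
      (fun x => deriv χ x * G x + χ x * g x) := ⟨hint, fun x => by simp⟩
  have acG : AbsolutelyContinuousOnInterval G 0 x := by
    have h1 : AbsolutelyContinuousOnInterval (fun _ : ℝ => G 0) 0 x :=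
      contDiff_const.contDiffOn.absolutelyContinuousOnInterval
    have h2 := h1.add (absolutelyContinuous_integral (hG.integrable 0 x))
    rwa [show ((fun _ : ℝ => G 0) + fun y => ∫ t in (0 : ℝ)..y, g t) = G from
      (funext hG.eq).symm] at h2
  -- The integral of the expected derivative minus the product is absolutely continuous with
  -- derivative zero almost everywhere, hence constant.
  have ac := (absolutelyContinuous_integral (hint 0 x)).sub
    (hχ.contDiffOn.absolutelyContinuousOnInterval.smul acG)
  obtain ⟨C, hC⟩ := ac.const_of_ae_hasDerivAt_zero (by
    filter_upwards [hP.ae_hasDerivAt, hG.ae_hasDerivAt] with y h1 h2 _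
    have h3 := (hχ.differentiable one_ne_zero y).hasDerivAt.mul h2
    have := h1.sub h3
    rw [sub_self] at this
    exact this)
  have h1 := hC x right_mem_uIcc
  have h0 := hC 0 left_mem_uIcc
  simp only [Pi.sub_apply, smul_eq_mul, Pi.mul_apply, intervalIntegral.integral_same] at h1 h0
  linear_combination h0 - h1

/-- Integration by parts. -/
lemma IsPrimitive.integral_mul {χ G g : ℝ → ℂ} (hχ : ContDiff ℝ 1 χ) (hG : IsPrimitive G g)
    (pχ : Periodic χ 1) (pG : Periodic G 1) :
    ∫ x in (0 : ℝ)..1, χ x * g x = -∫ x in (0 : ℝ)..1, deriv χ x * G x := by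
  have h := (hG.mul hχ).eq 1
  have e : χ 1 * G 1 = χ 0 * G 0 := by
    have h1 := pχ 0; have h2 := pG 0
    rw [zero_add] at h1 h2
    rw [h1, h2]
  rw [e, intervalIntegral.integral_add (f := fun x => deriv χ x * G x) (g := fun x => χ x * g x)
    (((hχ.continuous_deriv le_rfl).mul hG.continuous).intervalIntegrable _ _)
    ((hG.integrable _ _).continuousOn_mul hχ.continuous.continuousOn)] at h
  linear_combination -h

lemma IsPrimitive.fc {G g : ℝ → ℂ} (hG : IsPrimitive G g) (pG : Periodic G 1) (m : ℤ) :
    fc g m = Complex.I * freq m * fc G m := by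
  unfold GKdV.fc
  rw [hG.integral_mul ((contDiff_mode (-m)).of_le (by exact_mod_cast le_top)) (mode_periodic _) pG,
    ← intervalIntegral.integral_const_mul, ← intervalIntegral.integral_neg]
  congr 1; ext x
  rw [(hasDerivAt_mode _ _).deriv, freq_neg]
  push_cast; ring

/-! ### The Bloch operator on the torus, its action on Fourier coefficients and its adjoint. -/

/-- The operator `k² (∂ₓ + iξ)² + A`. -/
def hillOp (k : ℝ) (A : ℝ → ℝ) (ξ : ℝ) (g : ℝ → ℂ) : ℝ → ℂ :=
  fun y => (k : ℂ) ^ 2 * twistedDeriv ξ (twistedDeriv ξ g) y + (A y : ℂ) * g y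

/-- The operator `-k (∂ₓ + iξ) (k² (∂ₓ + iξ)² + A)`. -/
def blochOp (k : ℝ) (A : ℝ → ℝ) (ξ : ℝ) (g : ℝ → ℂ) : ℝ → ℂ :=
  fun x => -(k : ℂ) * twistedDeriv ξ (hillOp k A ξ g) x

lemma blochSymbol_eq_blochOp (f u : ℝ → ℝ) (c k : ℝ) :
    blochSymbol f u c k = blochOp k (fun y => deriv f (scaledProfile u k y) - c) := rfl

/-- The action of `μ - L_ξ` on Fourier coefficients. -/
def resSeq (k : ℝ) (a : ℤ → ℂ) (ξ : ℝ) (μ : ℂ) (y : ℤ → ℂ) (m : ℤ) : ℂ :=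
  (μ - Complex.I * k ^ 3 * (freq m + ξ) ^ 3) * y m + Complex.I * k * (freq m + ξ) * conv a y m

lemma periodic_deriv {g : ℝ → ℂ} (hg : Periodic g 1) : Periodic (deriv g) 1 := fun x => by
  rw [← deriv_comp_add_const]
  congr 1
  exact funext hg

lemma twistedDeriv_periodic {g : ℝ → ℂ} (hg : Periodic g 1) (ξ : ℝ) :
    Periodic (twistedDeriv ξ g) 1 := fun x => by
  unfold twistedDeriv
  rw [hg x, periodic_deriv hg x]

lemma twistedDeriv_contDiff {g : ℝ → ℂ} {n : WithTop ℕ∞} (hg : ContDiff ℝ (n + 1) g) (ξ : ℝ) :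
    ContDiff ℝ n (twistedDeriv ξ g) :=
  (ContDiff.deriv' hg).add (contDiff_const.mul (hg.of_le le_self_add))

lemma twistedDeriv_smooth {g : ℝ → ℂ} (hg : ContDiff ℝ ∞ g) (ξ : ℝ) :
    ContDiff ℝ ∞ (twistedDeriv ξ g) := twistedDeriv_contDiff (by simpa using hg) ξ

lemma twistedDeriv_const_mul {g : ℝ → ℂ} (c : ℂ) (ξ : ℝ) :
    twistedDeriv ξ (fun x => c * g x) = fun x => c * twistedDeriv ξ g x := by
  ext x
  unfold twistedDeriv
  rw [deriv_const_mul_field]; ring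

lemma hillOp_const_mul {k : ℝ} {A : ℝ → ℝ} {g : ℝ → ℂ} (c : ℂ) (ξ : ℝ) :
    hillOp k A ξ (fun x => c * g x) = fun x => c * hillOp k A ξ g x := by
  ext x
  unfold hillOp
  rw [twistedDeriv_const_mul, twistedDeriv_const_mul]; ring

lemma blochOp_const_mul {k : ℝ} {A : ℝ → ℝ} {g : ℝ → ℂ} (c : ℂ) (ξ : ℝ) :
    blochOp k A ξ (fun x => c * g x) = fun x => c * blochOp k A ξ g x := by
  ext x
  unfold blochOp
  rw [hillOp_const_mul, twistedDeriv_const_mul]; ring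

/-- Conjugation by a mode shifts the exponent; through this identity everything depends on `j` and
`ξ` only via `freq j + ξ`. -/
lemma twistedDeriv_mode_mul {g : ℝ → ℂ} (hg : Differentiable ℝ g) (j : ℤ) (ξ : ℝ) :
    twistedDeriv ξ (fun x => mode j x * g x) = fun x => mode j x * twistedDeriv (freq j + ξ) g x := by
  ext x
  unfold twistedDeriv
  rw [((hasDerivAt_mode j x).fun_mul (hg x).hasDerivAt).deriv]
  push_cast; ring

section smooth

variable {k : ℝ} {A : ℝ → ℝ}

lemma hillOp_periodic (pA : Periodic A 1) {g : ℝ → ℂ} (hg : Periodic g 1) (ξ : ℝ) :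
    Periodic (hillOp k A ξ g) 1 := fun x => by
  unfold hillOp
  rw [twistedDeriv_periodic (twistedDeriv_periodic hg ξ) ξ x, pA x, hg x]

lemma ofReal_contDiff {n : WithTop ℕ∞} (hA : ContDiff ℝ n A) : ContDiff ℝ n fun x => (A x : ℂ) :=
  Complex.ofRealCLM.contDiff.comp hA

lemma hillOp_smooth (hA : ContDiff ℝ ∞ A) {g : ℝ → ℂ} (hg : ContDiff ℝ ∞ g) (ξ : ℝ) :
    ContDiff ℝ ∞ (hillOp k A ξ g) :=
  (contDiff_const.mul (twistedDeriv_smooth (twistedDeriv_smooth hg ξ) ξ)).add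
    ((ofReal_contDiff hA).mul hg)

lemma blochOp_smooth (hA : ContDiff ℝ ∞ A) {g : ℝ → ℂ} (hg : ContDiff ℝ ∞ g) (ξ : ℝ) :
    ContDiff ℝ ∞ (blochOp k A ξ g) :=
  contDiff_const.mul (twistedDeriv_smooth (hillOp_smooth hA hg ξ) ξ)

lemma hillOp_mode_mul {g : ℝ → ℂ} (hg : ContDiff ℝ ∞ g) (j : ℤ) (ξ : ℝ) :
    hillOp k A ξ (fun x => mode j x * g x) = fun x => mode j x * hillOp k A (freq j + ξ) g x := by
  have h1 : Differentiable ℝ g := hg.differentiable (by simp)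
  have h2 : Differentiable ℝ (twistedDeriv (freq j + ξ) g) :=
    (twistedDeriv_smooth hg _).differentiable (by simp)
  ext x
  unfold hillOp
  rw [twistedDeriv_mode_mul h1, twistedDeriv_mode_mul h2]
  ring

lemma blochOp_mode_mul (hA : ContDiff ℝ ∞ A) {g : ℝ → ℂ} (hg : ContDiff ℝ ∞ g) (j : ℤ) (ξ : ℝ) :
    blochOp k A ξ (fun x => mode j x * g x) = fun x => mode j x * blochOp k A (freq j + ξ) g x := by
  have h2 : Differentiable ℝ (hillOp k A (freq j + ξ) g) :=
    (hillOp_smooth hA hg _).differentiable (by simp)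
  ext x
  unfold blochOp
  rw [hillOp_mode_mul hg, twistedDeriv_mode_mul h2]
  ring

end smooth

lemma exists_norm_le_of_periodic {g : ℝ → ℂ} (hg : Continuous g) (pg : Periodic g 1) :
    ∃ C, ∀ x, ‖g x‖ ≤ C := by
  obtain ⟨C, hC⟩ := isBounded_iff_forall_norm_le.mp (pg.isBounded_of_continuous one_ne_zero hg)
  exact ⟨C, fun x => hC _ (mem_range_self x)⟩

lemma rapidSeq_fc {g : ℝ → ℂ} (hg : ContDiff ℝ ∞ g) (pg : Periodic g 1) : RapidSeq (fc g) := by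
  have key : ∀ (n : ℕ) {g : ℝ → ℂ}, ContDiff ℝ ∞ g → Periodic g 1 →
      ∃ C, ∀ m, |freq m| ^ n * ‖fc g m‖ ≤ C := by
    intro n
    induction n with
    | zero =>
      intro g hg pg
      obtain ⟨C, hC⟩ := exists_norm_le_of_periodic hg.continuous pg
      exact ⟨C, fun m => by simpa using norm_fc_le hC m⟩
    | succ n ih =>
      intro g hg pg
      obtain ⟨C, hC⟩ := ih (contDiff_infty_iff_deriv.mp hg).2 (periodic_deriv pg)
      refine ⟨C, fun m => (le_of_eq ?_).trans (hC m)⟩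
      rw [(isPrimitive_deriv (hg.of_le (by exact_mod_cast le_top))).fc pg m, norm_mul, norm_mul,
        Complex.norm_I, Complex.norm_real, Real.norm_eq_abs]
      ring
  intro s
  obtain ⟨C, hC⟩ := key s.natAbs hg pg
  refine ⟨max C ‖fc g 0‖, fun m => ?_⟩
  have hw := wt_zpow_mono m (s := -(s.natAbs : ℤ)) (s' := s) (by omega)
  have h0 : 0 ≤ max C ‖fc g 0‖ := (norm_nonneg _).trans (le_max_right _ _)
  refine le_trans ?_ (mul_le_mul_of_nonneg_left hw h0)
  rw [zpow_neg, zpow_natCast, ← div_eq_mul_inv, le_div_iff₀ (pow_pos (wt_pos m) _)]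
  by_cases hm : m = 0
  · subst hm; rw [wt_zero]; simp
  · have h3 := three_wt_le_abs_freq hm
    have := wt_pos m
    refine le_trans ?_ ((hC m).trans (le_max_left _ _))
    rw [mul_comm]
    gcongr
    linarith

lemma series_fc {g : ℝ → ℂ} (hg : ContDiff ℝ ∞ g) (pg : Periodic g 1) :
    (fun x => ∑' l, fc g l * mode l x) = g :=
  eq_of_fc_eq (continuous_series (rapidSeq_fc hg pg).summable_norm) (series_periodic _)
    hg.continuous pg fun m => fc_series (rapidSeq_fc hg pg).summable_norm m

lemma fc_mul {A : ℝ → ℝ} (hA : ContDiff ℝ ∞ A) (pA : Periodic A 1) {w : ℝ → ℂ} (hw : Continuous w)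
    (m : ℤ) : fc (fun x => (A x : ℂ) * w x) m = conv (fc fun x => (A x : ℂ)) (fc w) m := by
  have pA' : Periodic (fun x => (A x : ℂ)) 1 := fun x => by simp only [pA x]
  have h := fc_series_mul (rapidSeq_fc (ofReal_contDiff hA) pA').summable_norm hw m
  have e := series_fc (ofReal_contDiff hA) pA'
  have e' : ∀ x, (∑' l, fc (fun x => (A x : ℂ)) l * mode l x) = (A x : ℂ) := fun x => congrFun e x
  simp only [e'] at h
  exact h

lemma fc_deriv {g : ℝ → ℂ} (hg : ContDiff ℝ 1 g) (pg : Periodic g 1) (m : ℤ) :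
    fc (deriv g) m = Complex.I * freq m * fc g m := (isPrimitive_deriv hg).fc pg m

lemma fc_twistedDeriv {g : ℝ → ℂ} (hg : ContDiff ℝ 1 g) (pg : Periodic g 1) (ξ : ℝ) (m : ℤ) :
    fc (twistedDeriv ξ g) m = Complex.I * (freq m + ξ) * fc g m := by
  unfold twistedDeriv
  rw [fc_add (g := fun x => deriv g x) (h := fun x => Complex.I * ξ * g x)
    ((hg.continuous_deriv le_rfl).intervalIntegrable _ _)
    ((continuous_const.mul hg.continuous).intervalIntegrable _ _), fc_const_mul, fc_deriv hg pg]
  ring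

lemma MemH3per.bounded {w : ℝ → ℂ} (hw : MemH3per w) : ∃ C, ∀ m, ‖fc w m‖ ≤ C := by
  obtain ⟨C, hC⟩ := exists_norm_le_of_periodic hw.2.1.continuous hw.1
  exact ⟨C, norm_fc_le hC⟩

lemma memH3per_of_contDiff {g : ℝ → ℂ} (hg : ContDiff ℝ 3 g) (pg : Periodic g 1) : MemH3per g := by
  have h2 : ContDiff ℝ 2 g := hg.of_le (by norm_num)
  have e : iteratedDeriv 2 g = deriv (deriv g) := by
    rw [iteratedDeriv_succ, iteratedDeriv_one]
  have h3 : ContDiff ℝ 1 (iteratedDeriv 2 g) := by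
    rw [e]
    exact ContDiff.deriv' (n := 1) (ContDiff.deriv' (n := 2) (by norm_num; exact hg))
  have p3 : Periodic (deriv (iteratedDeriv 2 g)) 1 := by
    rw [e]; exact periodic_deriv (periodic_deriv (periodic_deriv pg))
  exact ⟨pg, h2, deriv (iteratedDeriv 2 g), memL2per_of_continuous (h3.continuous_deriv le_rfl) p3,
    (isPrimitive_deriv h3).eq⟩

section equation

variable {k : ℝ} {A : ℝ → ℝ}

/-- Expanding the twisted derivatives leaves `w''`, which is a primitive by definition of `H³`, and
terms of class `C¹`. -/
lemma MemH3per.exists_primitive (hA : ContDiff ℝ ∞ A) (pA : Periodic A 1) {w : ℝ → ℂ}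
    (hw : MemH3per w) (ξ : ℝ) :
    ∃ g, MemL2per g ∧ IsPrimitive (hillOp k A ξ w) g := by
  obtain ⟨pw, w2, W, hW, hWe⟩ := hw
  have e : iteratedDeriv 2 w = deriv (deriv w) := by
    rw [iteratedDeriv_succ, iteratedDeriv_one]
  have w1 : ContDiff ℝ 1 (deriv w) := ContDiff.deriv' (n := 1) (by norm_num; exact w2)
  have w1' : ContDiff ℝ 1 w := w2.of_le (by norm_num)
  have dw : Differentiable ℝ w := w1'.differentiable one_ne_zero
  have ddw : Differentiable ℝ (deriv w) := w1.differentiable one_ne_zero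
  have hprim : IsPrimitive (deriv (deriv w)) W := ⟨hW.intervalIntegrable, by rw [← e]; exact hWe⟩
  have hA1 : ContDiff ℝ 1 fun x => (A x : ℂ) := ofReal_contDiff (hA.of_le (by exact_mod_cast le_top))
  have pA' : Periodic (fun x => (A x : ℂ)) 1 := fun x => by simp only [pA x]
  have hsum := ((hprim.const_mul ((k : ℂ) ^ 2)).add
    ((isPrimitive_deriv w1).const_mul ((k : ℂ) ^ 2 * (2 * Complex.I * ξ)))).add
    (((isPrimitive_deriv w1').const_mul (-(k : ℂ) ^ 2 * ξ ^ 2)).add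
      ((isPrimitive_deriv w1').mul hA1))
  have hH : hillOp k A ξ w = fun x => (k : ℂ) ^ 2 * deriv (deriv w) x +
      (k : ℂ) ^ 2 * (2 * Complex.I * ξ) * deriv w x +
      (-(k : ℂ) ^ 2 * ξ ^ 2 * w x + (A x : ℂ) * w x) := by
    ext x
    have ht : twistedDeriv ξ w = fun x => deriv w x + Complex.I * ξ * w x := rfl
    unfold hillOp
    rw [ht]
    unfold twistedDeriv
    rw [deriv_fun_add (ddw x) ((dw x).const_mul _), deriv_const_mul_field]
    linear_combination (k : ℂ) ^ 2 * ξ ^ 2 * w x * Complex.I_sq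
  refine ⟨_, ?_, hH ▸ hsum⟩
  · have c1 := w1.continuous
    have c2 := w1.continuous_deriv le_rfl
    have cA := hA1.continuous_deriv le_rfl
    have p1 := periodic_deriv pw
    have p2 := periodic_deriv p1
    refine ((hW.const_mul _).add ((memL2per_of_continuous c2 p2).const_mul _)).add
      (((memL2per_of_continuous c1 p1).const_mul _).add (memL2per_of_continuous ?_ ?_))
    · exact (cA.mul w1'.continuous).add (hA1.continuous.mul c1)
    · intro x
      simp only [pA' x, p1 x, periodic_deriv pA' x, pw x]

lemma MemH3per.hillOp_periodic (pA : Periodic A 1) {w : ℝ → ℂ} (hw : MemH3per w) (ξ : ℝ) :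
    Periodic (hillOp k A ξ w) 1 := GKdV.hillOp_periodic pA hw.1 ξ

lemma MemH3per.fc_hillOp (hA : ContDiff ℝ ∞ A) (pA : Periodic A 1) {w : ℝ → ℂ}
    (hw : MemH3per w) (ξ : ℝ) (m : ℤ) : fc (hillOp k A ξ w) m =
      -(k : ℂ) ^ 2 * (freq m + ξ) ^ 2 * fc w m + conv (fc fun x => (A x : ℂ)) (fc w) m := by
  have w2 := hw.2.1
  have w1 : ContDiff ℝ 1 (twistedDeriv ξ w) := twistedDeriv_contDiff (by norm_num; exact w2) ξ
  have w0 : Continuous (twistedDeriv ξ (twistedDeriv ξ w)) :=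
    (twistedDeriv_contDiff (n := 0) (by simpa using w1) ξ).continuous
  unfold hillOp
  rw [fc_add (g := fun y => (k : ℂ) ^ 2 * twistedDeriv ξ (twistedDeriv ξ w) y)
    (h := fun y => (A y : ℂ) * w y) ((continuous_const.mul w0).intervalIntegrable _ _)
    (((ofReal_contDiff hA).continuous.mul w2.continuous).intervalIntegrable _ _), fc_const_mul,
    fc_twistedDeriv w1 (twistedDeriv_periodic hw.1 ξ), fc_twistedDeriv (w2.of_le (by norm_num)) hw.1,
    fc_mul hA pA w2.continuous]
  linear_combination (k : ℂ) ^ 2 * (freq m + ξ) ^ 2 * fc w m * Complex.I_sq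

/-- `blochOp w` agrees almost everywhere with a square integrable function. -/
lemma MemH3per.exists_blochOp (hA : ContDiff ℝ ∞ A) (pA : Periodic A 1) {w : ℝ → ℂ}
    (hw : MemH3per w) (ξ : ℝ) : ∃ g, MemL2per g ∧ blochOp k A ξ w =ᵐ[volume] g ∧
      ∀ m, fc g m = -Complex.I * k * (freq m + ξ) *
        (-(k : ℂ) ^ 2 * (freq m + ξ) ^ 2 * fc w m + conv (fc fun x => (A x : ℂ)) (fc w) m) := by
  obtain ⟨g, hg, hp⟩ := hw.exists_primitive (k := k) hA pA ξ
  have pH := hw.hillOp_periodic (k := k) pA ξ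
  have hH := memL2per_of_continuous hp.continuous pH
  refine ⟨fun x => -(k : ℂ) * (g x + Complex.I * ξ * hillOp k A ξ w x),
    (hg.add (hH.const_mul _)).const_mul _, ?_, fun m => ?_⟩
  · filter_upwards [hp.ae_hasDerivAt] with x hx
    unfold blochOp
    rw [show twistedDeriv ξ (hillOp k A ξ w) x
      = deriv (hillOp k A ξ w) x + Complex.I * ξ * hillOp k A ξ w x from rfl, hx.deriv]
  · rw [fc_const_mul, fc_add (hg.intervalIntegrable _ _) ((hH.const_mul _).intervalIntegrable _ _),
      fc_const_mul, hp.fc pH, hw.fc_hillOp hA pA]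
    ring

/-- The resolvent equation in terms of Fourier coefficients. -/
lemma MemH3per.equation_iff (hA : ContDiff ℝ ∞ A) (pA : Periodic A 1) {w g : ℝ → ℂ}
    (hw : MemH3per w) (hg : MemL2per g) (ξ : ℝ) (μ : ℂ) :
    (fun x => μ * w x - blochOp k A ξ w x) =ᵐ[volume] g ↔
      ∀ m, resSeq k (fc fun x => (A x : ℂ)) ξ μ (fc w) m = fc g m := by
  obtain ⟨b, hb, hbe, hbf⟩ := hw.exists_blochOp (k := k) hA pA ξ
  have hwL := memL2per_of_continuous hw.2.1.continuous hw.1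
  have hL : MemL2per fun x => μ * w x - b x := (hwL.const_mul μ).sub hb
  have h1 : (fun x => μ * w x - blochOp k A ξ w x) =ᵐ[volume] fun x => μ * w x - b x := by
    filter_upwards [hbe] with x hx
    rw [hx]
  have h2 : ∀ m, fc (fun x => μ * w x - b x) m = resSeq k (fc fun x => (A x : ℂ)) ξ μ (fc w) m := by
    intro m
    rw [fc_sub ((hwL.const_mul μ).intervalIntegrable _ _) (hb.intervalIntegrable _ _),
      fc_const_mul, hbf]
    unfold resSeq
    ring
  constructor
  · intro h m
    rw [← h2, fc_congr_ae (h1.symm.trans h)]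
  · intro h
    exact h1.trans (hL.ae_eq hg fun m => by rw [h2, h])

lemma periodic_conj {χ : ℝ → ℂ} (pχ : Periodic χ 1) :
    Periodic (fun x => (starRingEnd ℂ) (χ x)) 1 := fun x => by simp only [pχ x]

lemma conj_contDiff {χ : ℝ → ℂ} {n : WithTop ℕ∞} (hχ : ContDiff ℝ n χ) :
    ContDiff ℝ n fun x => (starRingEnd ℂ) (χ x) :=
  (Complex.conjCLE : ℂ →L[ℝ] ℂ).contDiff.comp hχ

lemma deriv_conj {χ : ℝ → ℂ} {x : ℝ} (hχ : DifferentiableAt ℝ χ x) :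
    deriv (fun x => (starRingEnd ℂ) (χ x)) x = (starRingEnd ℂ) (deriv χ x) :=
  ((Complex.conjCLE : ℂ →L[ℝ] ℂ).hasFDerivAt.comp_hasDerivAt x hχ.hasDerivAt).deriv

/-- Skew-adjointness of `∂ₓ + iξ`. The second function is only required to be a primitive, so that
`hillOp w` with `w` in `H³` is allowed, as the adjoint on the full domain demands. -/
lemma IsPrimitive.innerPer_twistedDeriv {χ G g : ℝ → ℂ} (hG : IsPrimitive G g)
    (hχ : ContDiff ℝ 1 χ) (pχ : Periodic χ 1) (pG : Periodic G 1) (ξ : ℝ) :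
    innerPer χ (twistedDeriv ξ G) = -innerPer (twistedDeriv ξ χ) G := by
  have cχ := conj_contDiff hχ
  have h1 : innerPer χ (twistedDeriv ξ G) = ∫ x in (0 : ℝ)..1, ((starRingEnd ℂ) (χ x) * g x +
      (starRingEnd ℂ) (χ x) * (Complex.I * ξ * G x)) := by
    refine intervalIntegral.integral_congr_ae ?_
    filter_upwards [hG.ae_hasDerivAt] with x hx _
    unfold twistedDeriv
    rw [hx.deriv]; ring
  have c1 : Continuous fun x => -(deriv (fun x => (starRingEnd ℂ) (χ x)) x * G x) :=
    ((cχ.continuous_deriv le_rfl).mul hG.continuous).neg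
  have c2 : Continuous fun x => (starRingEnd ℂ) (χ x) * (Complex.I * ξ * G x) :=
    cχ.continuous.mul (continuous_const.mul hG.continuous)
  rw [h1, intervalIntegral.integral_add (f := fun x => (starRingEnd ℂ) (χ x) * g x)
    (g := fun x => (starRingEnd ℂ) (χ x) * (Complex.I * ξ * G x))
    ((hG.integrable _ _).continuousOn_mul cχ.continuous.continuousOn)
    (c2.intervalIntegrable _ _), hG.integral_mul cχ (periodic_conj pχ) pG, ← intervalIntegral.integral_neg,
    ← intervalIntegral.integral_add (c1.intervalIntegrable _ _) (c2.intervalIntegrable _ _),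
    innerPer, ← intervalIntegral.integral_neg]
  congr 1; ext x
  unfold twistedDeriv
  rw [deriv_conj (hχ.differentiable one_ne_zero x)]
  simp only [map_add, map_mul, Complex.conj_I, Complex.conj_ofReal]
  ring

lemma innerPer_const_mul_left (c : ℂ) (g h : ℝ → ℂ) :
    innerPer (fun x => c * g x) h = (starRingEnd ℂ) c * innerPer g h := by
  unfold innerPer
  rw [← intervalIntegral.integral_const_mul]
  congr 1; ext x
  rw [map_mul]; ring

lemma innerPer_const_mul_right (c : ℂ) (g h : ℝ → ℂ) :
    innerPer g (fun x => c * h x) = c * innerPer g h := by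
  unfold innerPer
  rw [← intervalIntegral.integral_const_mul]
  congr 1; ext x
  ring

lemma innerPer_add_left {g g' h : ℝ → ℂ} (hg : Continuous g) (hg' : Continuous g')
    (hh : Continuous h) :
    innerPer (fun x => g x + g' x) h = innerPer g h + innerPer g' h := by
  unfold innerPer
  have h1 : Continuous fun x => (starRingEnd ℂ) (g x) * h x := (Complex.continuous_conj.comp hg).mul hh
  have h2 : Continuous fun x => (starRingEnd ℂ) (g' x) * h x :=
    (Complex.continuous_conj.comp hg').mul hh
  rw [← intervalIntegral.integral_add (h1.intervalIntegrable _ _) (h2.intervalIntegrable _ _)]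
  congr 1; ext x
  simp only [map_add]; ring

lemma innerPer_add_right {g h h' : ℝ → ℂ} (hg : Continuous g) (hh : Continuous h)
    (hh' : Continuous h') :
    innerPer g (fun x => h x + h' x) = innerPer g h + innerPer g h' := by
  unfold innerPer
  have h1 : Continuous fun x => (starRingEnd ℂ) (g x) * h x := (Complex.continuous_conj.comp hg).mul hh
  have h2 : Continuous fun x => (starRingEnd ℂ) (g x) * h' x :=
    (Complex.continuous_conj.comp hg).mul hh'
  rw [← intervalIntegral.integral_add (h1.intervalIntegrable _ _) (h2.intervalIntegrable _ _)]
  congr 1; ext x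
  ring

lemma innerPer_twistedDeriv {χ w : ℝ → ℂ} (hχ : ContDiff ℝ 1 χ) (pχ : Periodic χ 1)
    (hw : ContDiff ℝ 1 w) (pw : Periodic w 1) (ξ : ℝ) :
    innerPer χ (twistedDeriv ξ w) = -innerPer (twistedDeriv ξ χ) w :=
  (isPrimitive_deriv hw).innerPer_twistedDeriv hχ pχ pw ξ

/-- The operator `k² (∂ₓ + iξ)² + A` is symmetric. -/
lemma innerPer_hillOp (hA : Continuous A) {χ w : ℝ → ℂ} (hχ : ContDiff ℝ 2 χ) (pχ : Periodic χ 1)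
    (hw : ContDiff ℝ 2 w) (pw : Periodic w 1) (ξ : ℝ) :
    innerPer χ (hillOp k A ξ w) = innerPer (hillOp k A ξ χ) w := by
  have hχ1 : ContDiff ℝ 1 (twistedDeriv ξ χ) := twistedDeriv_contDiff (by norm_num; exact hχ) ξ
  have hw1 : ContDiff ℝ 1 (twistedDeriv ξ w) := twistedDeriv_contDiff (by norm_num; exact hw) ξ
  have hχ0 : Continuous (twistedDeriv ξ (twistedDeriv ξ χ)) :=
    (twistedDeriv_contDiff (n := 0) (by simpa using hχ1) ξ).continuous
  have hw0 : Continuous (twistedDeriv ξ (twistedDeriv ξ w)) :=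
    (twistedDeriv_contDiff (n := 0) (by simpa using hw1) ξ).continuous
  have cA : Continuous fun x => (A x : ℂ) := Complex.continuous_ofReal.comp hA
  have e : innerPer χ (fun y => (A y : ℂ) * w y) = innerPer (fun y => (A y : ℂ) * χ y) w := by
    unfold innerPer
    congr 1; ext x
    rw [map_mul, Complex.conj_ofReal]; ring
  unfold hillOp
  rw [innerPer_add_right (h := fun y => (k : ℂ) ^ 2 * twistedDeriv ξ (twistedDeriv ξ w) y)
      (h' := fun y => (A y : ℂ) * w y) hχ.continuous (continuous_const.mul hw0)
      (cA.mul hw.continuous),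
    innerPer_add_left (g := fun y => (k : ℂ) ^ 2 * twistedDeriv ξ (twistedDeriv ξ χ) y)
      (g' := fun y => (A y : ℂ) * χ y) (continuous_const.mul hχ0) (cA.mul hχ.continuous)
      hw.continuous, e,
    innerPer_const_mul_right, innerPer_const_mul_left,
    innerPer_twistedDeriv (hχ.of_le (by norm_num)) pχ hw1 (twistedDeriv_periodic pw ξ),
    innerPer_twistedDeriv hχ1 (twistedDeriv_periodic pχ ξ) (hw.of_le (by norm_num)) pw]
  simp

/-- The adjoint of `blochOp`. -/
lemma MemH3per.innerPer_blochOp (hA : ContDiff ℝ ∞ A) (pA : Periodic A 1) {ψ w : ℝ → ℂ}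
    (hψ : ContDiff ℝ ∞ ψ) (pψ : Periodic ψ 1) (hw : MemH3per w) (ξ : ℝ) :
    innerPer ψ (blochOp k A ξ w) =
      innerPer (fun x => (k : ℂ) * hillOp k A ξ (twistedDeriv ξ ψ) x) w := by
  obtain ⟨g, -, hp⟩ := hw.exists_primitive (k := k) hA pA ξ
  have hT := twistedDeriv_smooth hψ ξ
  have e := hp.innerPer_twistedDeriv (hψ.of_le (by exact_mod_cast le_top)) pψ
    (hw.hillOp_periodic pA ξ) ξ
  unfold blochOp
  rw [innerPer_const_mul_right, e, innerPer_hillOp hA.continuous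
    (contDiff_infty.mp hT 2) (twistedDeriv_periodic pψ ξ) hw.2.1 hw.1,
    innerPer_const_mul_left, Complex.conj_ofReal]
  ring

end equation

/-! ### From square summable sequences back to functions in `L²` and `H³`. -/

lemma MemL2per.summable_sq_fc {g : ℝ → ℂ} (hg : MemL2per g) : Summable fun m => ‖fc g m‖ ^ 2 := by
  have h1 := (hasSum_sq_fourierCoeffOn (zero_lt_one' ℝ) hg.2).summable
  simpa only [fourierCoeffOn_eq_fc] using h1

/-- The Riesz–Fischer theorem. -/
lemma exists_memL2per_fc {c : ℤ → ℂ} (hc : Summable fun m => ‖c m‖ ^ 2) :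
    ∃ g, MemL2per g ∧ ∀ m, fc g m = c m := by
  have : Fact ((0 : ℝ) < 1) := ⟨zero_lt_one⟩
  have hmem : Memℓp c 2 := by
    rw [memℓp_gen_iff (by norm_num)]
    simpa using hc
  let F : Lp ℂ 2 (@AddCircle.haarAddCircle 1 _) :=
    (fourierBasis (T := 1)).repr.symm ⟨c, hmem⟩
  have hF : ∀ m, fourierCoeff F m = c m := fun m => by
    rw [← fourierBasis_repr]
    simp [F]
  have hv : MemLp F 2 (volume : Measure (AddCircle (1 : ℝ))) := (Lp.memLp F).of_haarAddCircle
  refine ⟨fun x => F (x : AddCircle (1 : ℝ)), ⟨fun x => ?_, ?_⟩, fun m => ?_⟩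
  · simp only [AddCircle.coe_add, AddCircle.coe_period, add_zero]
  · have := hv.comp_measurePreserving (AddCircle.measurePreserving_mk 1 0)
    rw [zero_add] at this
    exact this
  · rw [← hF, fourierCoeff_eq_intervalIntegral _ _ 0, div_one, one_smul, zero_add, fc]
    refine intervalIntegral.integral_congr fun x _ => ?_
    simp only [smul_eq_mul, fourier_coe_apply, mode]
    congr 2
    simp

/-- At `m = 0` the hypothesis says that `g` has mean zero, which makes its primitive periodic; the
constant of integration is then fixed by `c 0`. -/
lemma exists_isPrimitive_fc {g : ℝ → ℂ} {c : ℤ → ℂ} (hg : ∀ a b, IntervalIntegrable g volume a b)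
    (pg : Periodic g 1) (hc : ∀ m, fc g m = Complex.I * freq m * c m) :
    ∃ G, Periodic G 1 ∧ IsPrimitive G g ∧ ∀ m, fc G m = c m := by
  have h0 : ∫ y in (0 : ℝ)..1, g y = 0 := by
    have := hc 0
    simpa [fc, freq_zero, mode_zero] using this
  let P : ℝ → ℂ := fun x => ∫ y in (0 : ℝ)..x, g y
  have hP : IsPrimitive P g := ⟨hg, fun x => by simp [P]⟩
  have pP : Periodic P 1 := fun x => by
    have h1 := intervalIntegral.integral_add_adjacent_intervals (hg 0 x) (hg x (x + 1))
    have h2 := pg.intervalIntegral_add_eq x 0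
    simp only [P]
    rw [← h1, h2, zero_add, h0, add_zero]
  let d : ℂ := c 0 - fc P 0
  have hG : IsPrimitive (fun x => d + P x) g := ⟨hg, fun x => by simp [P]⟩
  have pG : Periodic (fun x => d + P x) 1 := fun x => by simp only [pP x]
  refine ⟨_, pG, hG, fun m => ?_⟩
  by_cases hm : m = 0
  · subst hm
    rw [fc_add (g := fun _ => d) (continuous_const.intervalIntegrable _ _)
      (hP.continuous.intervalIntegrable _ _)]
    simp [fc, mode_zero, d]
  · have h1 := hG.fc pG m
    rw [hc] at h1
    have : Complex.I * freq m ≠ 0 :=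
      mul_ne_zero Complex.I_ne_zero (Complex.ofReal_ne_zero.mpr (freq_ne_zero hm))
    exact (mul_left_cancel₀ this h1).symm

lemma IsPrimitive.hasDerivAt {G g : ℝ → ℂ} (h : IsPrimitive G g) (cg : Continuous g) (x : ℝ) :
    HasDerivAt G (g x) x := by
  have h1 := (cg.integral_hasStrictDerivAt 0 x).hasDerivAt.const_add (G 0)
  exact h1.congr_of_eventuallyEq (Filter.Eventually.of_forall h.eq)

lemma contDiff_succ_of_hasDerivAt {G g : ℝ → ℂ} {n : ℕ} (h : ∀ x, HasDerivAt G (g x) x)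
    (hg : ContDiff ℝ n g) : ContDiff ℝ (n + 1 : ℕ) G := by
  push_cast
  rw [contDiff_succ_iff_deriv]
  refine ⟨fun x => (h x).differentiableAt, by simp, ?_⟩
  rwa [show deriv G = g from funext fun x => (h x).deriv]

/-- Sequences with enough decay are the Fourier coefficients of a function in `H³`. -/
lemma exists_memH3per_fc {c : ℤ → ℂ} (hc : Summable fun m => ‖(freq m : ℂ) ^ 3 * c m‖ ^ 2) :
    ∃ w, MemH3per w ∧ ∀ m, fc w m = c m := by
  obtain ⟨W, hW, hWc⟩ := exists_memL2per_fc (c := fun m => (Complex.I * freq m) ^ 3 * c m) (by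
    convert hc using 3 with m
    rw [mul_pow, norm_mul, norm_mul, norm_mul, norm_pow, Complex.norm_I, one_pow, one_mul])
  obtain ⟨G2, p2, h2, e2⟩ := exists_isPrimitive_fc (c := fun m => (Complex.I * freq m) ^ 2 * c m)
    hW.intervalIntegrable hW.1 fun m => by rw [hWc]; ring
  have c2 := h2.continuous
  obtain ⟨G1, p1, h1, e1⟩ := exists_isPrimitive_fc (c := fun m => Complex.I * freq m * c m)
    (fun a b => c2.intervalIntegrable a b) p2 fun m => by rw [e2]; ring
  have c1 := h1.continuous
  obtain ⟨G0, p0, h0, e0⟩ := exists_isPrimitive_fc (c := c)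
    (fun a b => c1.intervalIntegrable a b) p1 fun m => by rw [e1]
  have d1 := h1.hasDerivAt c2
  have d0 := h0.hasDerivAt c1
  have k1 := contDiff_succ_of_hasDerivAt (n := 0) d1 (by simpa using c2)
  have k0 := contDiff_succ_of_hasDerivAt (n := 1) d0 (by simpa using k1)
  have e : iteratedDeriv 2 G0 = G2 := by
    rw [iteratedDeriv_succ, iteratedDeriv_one, show deriv G0 = G1 from funext fun x => (d0 x).deriv]
    exact funext fun x => (d1 x).deriv
  refine ⟨G0, ⟨p0, by simpa using k0, W, hW, ?_⟩, e0⟩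
  rw [e]
  exact h2.eq

/-! ### Solvability of the resolvent equation on sequences, near and far from unperturbed
eigenvalues. -/

/-- The sequence of Fourier coefficients of the constant function one. -/
def delta (m : ℤ) : ℂ := if m = 0 then 1 else 0

lemma delta_zero : delta 0 = 1 := if_pos rfl

lemma delta_of_ne {m : ℤ} (hm : m ≠ 0) : delta m = 0 := if_neg hm

lemma norm_delta_le (m : ℤ) : ‖delta m‖ ≤ 1 := by
  unfold delta; split_ifs <;> simp

lemma conv_delta (a : ℤ → ℂ) (m : ℤ) : conv a delta m = a m := conv_single a m

lemma coeffD_zero (k h : ℝ) : coeffD k h 0 = 0 := by simp [coeffD, freq_zero]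

lemma coeffE_zero (k h : ℝ) : coeffE k h 0 = 0 := by simp [coeffE, freq_zero]

lemma resSeq_shift (k : ℝ) (a : ℤ → ℂ) (ξ : ℝ) (μ : ℂ) (y : ℤ → ℂ) (j m : ℤ) :
    resSeq k a (freq j + ξ) μ (fun l => y (l + j)) m = resSeq k a ξ μ y (m + j) := by
  unfold resSeq
  rw [conv_shift]
  simp only [freq]
  push_cast; ring

/-- The equation with the operator on sequences is uniquely solvable for bounded sequences. -/
def UniquelySolvable (k : ℝ) (a : ℤ → ℂ) (ξ : ℝ) (μ : ℂ) : Prop :=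
  ∀ g : ℤ → ℂ, (∃ C, ∀ m, ‖g m‖ ≤ C) →
    ∃! y : ℤ → ℂ, (∃ C, ∀ m, ‖y m‖ ≤ C) ∧ ∀ m, resSeq k a ξ μ y m = g m

lemma UniquelySolvable.of_shift {k : ℝ} {a : ℤ → ℂ} {ξ : ℝ} {μ : ℂ} {j : ℤ}
    (h : UniquelySolvable k a (freq j + ξ) μ) : UniquelySolvable k a ξ μ := by
  rintro g ⟨C, hC⟩
  obtain ⟨y, ⟨⟨B, hB⟩, hy⟩, hu⟩ := h (fun m => g (m + j)) ⟨C, fun m => hC _⟩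
  refine ⟨fun m => y (m - j), ⟨⟨B, fun m => hB _⟩, fun m => ?_⟩, ?_⟩
  · have h1 := resSeq_shift k a ξ μ (fun m => y (m - j)) j (m - j)
    simp only [add_sub_cancel_right, sub_add_cancel] at h1
    rw [← h1, hy, sub_add_cancel]
  · rintro z ⟨⟨B', hB'⟩, hz⟩
    have := hu (fun m => z (m + j)) ⟨⟨B', fun m => hB' _⟩, fun m => by
      rw [resSeq_shift, hz]⟩
    ext m
    have := congrFun this (m - j)
    simpa using this

section near

variable {k h h₀ κ : ℝ} {a : ℤ → ℂ} {n : ℂ}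

/-- The eigenvalue with given scaled correction. -/
def eigenvalue (k κ : ℝ) (n : ℂ) : ℂ := Complex.I * k ^ 3 * κ ^ 3 + κ * n

/-- Modes `m ≠ 0` are multiplied by the nonzero factor `h * coeffD k h m`, which normalizes the
coefficient of `y m`. At `m = 0` the cubic terms cancel, and the equation is kept as a separate
scalar condition. The first family is void at `m = 0`, so `y 0` is a free parameter there: this is a
Lyapunov–Schmidt reduction. -/
lemma resSeq_iff (hk : 0 < k) (hκ : κ * h = 1) (y g : ℤ → ℂ) :
    (∀ m, resSeq k a κ (eigenvalue k κ n) y m = g m) ↔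
      (∀ m, y m = lop a (fun l => n * coeffD k h l) (coeffE k h) 0 y m +
        (y 0 * delta m - h * coeffD k h m * g m)) ∧
      n * y 0 + Complex.I * k * conv a y 0 = h * g 0 := by
  have hh : h ≠ 0 := right_ne_zero_of_mul_eq_one hκ
  have hκ' : κ = h⁻¹ := eq_inv_of_mul_eq_one_left hκ
  have e0 : resSeq k a κ (eigenvalue k κ n) y 0 = κ * (n * y 0 + Complex.I * k * conv a y 0) := by
    unfold resSeq eigenvalue
    rw [freq_zero]; push_cast; ring
  have h0 : resSeq k a κ (eigenvalue k κ n) y 0 = g 0 ↔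
      n * y 0 + Complex.I * k * conv a y 0 = h * g 0 := by
    have hc : (κ : ℂ) * h = 1 := by exact_mod_cast hκ
    rw [e0]
    constructor
    · intro e; rw [← e]; linear_combination -(n * y 0 + Complex.I * k * conv a y 0) * hc
    · intro e; rw [e]; linear_combination g 0 * hc
  have hm : ∀ m, m ≠ 0 → (resSeq k a κ (eigenvalue k κ n) y m = g m ↔
      y m = lop a (fun l => n * coeffD k h l) (coeffE k h) 0 y m +
        (y 0 * delta m - h * coeffD k h m * g m)) := by
    intro m hm
    have hq : ((qpoly (h * freq m) : ℝ) : ℂ) ≠ 0 := by exact_mod_cast (qpoly_pos _).ne'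
    have hf : ((freq m : ℝ) : ℂ) ≠ 0 := by exact_mod_cast freq_ne_zero hm
    have hkc : (k : ℂ) ≠ 0 := by exact_mod_cast hk.ne'
    have hhc : (h : ℂ) ≠ 0 := by exact_mod_cast hh
    have e : (coeffD k h m * h * (resSeq k a κ (eigenvalue k κ n) y m - g m)) =
        (lop a (fun l => n * coeffD k h l) (coeffE k h) 0 y m +
        (y 0 * delta m - h * coeffD k h m * g m)) - y m := by
      have d1 : coeffD k h m * (k ^ 3 * freq m * (qpoly (h * freq m) : ℝ)) = -Complex.I * h := by
        unfold coeffD; push_cast; field_simp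
      have d2 : coeffE k h m = Complex.I * k * (1 + h * freq m) * coeffD k h m := by
        unfold coeffD coeffE; push_cast; field_simp
        rw [Complex.I_sq]; ring
      have d3 : (h : ℂ) ^ 2 * (κ ^ 3 - (freq m + κ) ^ 3) = -(freq m * (qpoly (h * freq m) : ℝ)) := by
        rw [hκ']; unfold qpoly; push_cast; field_simp; ring
      have d4 : (h : ℂ) * κ = 1 := by rw [mul_comm]; exact_mod_cast hκ
      have d5 : coeffD k h m * h * (Complex.I * k ^ 3 * (κ ^ 3 - (freq m + κ) ^ 3)) = -1 := by
        have : (h : ℂ) * (coeffD k h m * h * (Complex.I * k ^ 3 * (κ ^ 3 - (freq m + κ) ^ 3))) =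
            h * -1 := by
          linear_combination coeffD k h m * Complex.I * k ^ 3 * d3 - Complex.I * d1 +
            h * Complex.I_sq
        exact mul_left_cancel₀ hhc this
      unfold resSeq eigenvalue lop
      rw [delta_of_ne hm, d2, Pi.zero_apply]
      linear_combination y m * d5 + coeffD k h m * n * y m * d4 +
        Complex.I * k * coeffD k h m * conv a y m * d4
    have hD : coeffD k h m * h ≠ 0 := by
      have : coeffD k h m ≠ 0 := by
        unfold coeffD
        push_cast
        refine mul_ne_zero (neg_ne_zero.mpr Complex.I_ne_zero) (div_ne_zero hhc ?_)
        exact mul_ne_zero (mul_ne_zero (pow_ne_zero _ hkc) hf) hq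
      exact mul_ne_zero this hhc
    constructor
    · intro h1
      rw [h1, sub_self, mul_zero] at e
      exact (sub_eq_zero.mp e.symm).symm
    · intro h1
      rw [← h1, sub_self] at e
      exact sub_eq_zero.mp ((mul_eq_zero.mp e).resolve_left hD)
  have hz : y 0 = lop a (fun l => n * coeffD k h l) (coeffE k h) 0 y 0 +
      (y 0 * delta 0 - h * coeffD k h 0 * g 0) := by
    simp [lop, coeffD_zero, coeffE_zero, delta_zero]
  constructor
  · intro H
    refine ⟨fun m => ?_, h0.mp (H 0)⟩
    by_cases h1 : m = 0
    · rw [h1]; exact hz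
    · exact (hm m h1).mp (H m)
  · rintro ⟨H1, H2⟩ m
    by_cases h1 : m = 0
    · rw [h1]; exact h0.mpr H2
    · exact (hm m h1).mpr (H1 m)

lemma lop_coeff_small (hk : 0 < k) (hh : |h| ≤ h₀) {N : ℝ}
    (hN : h₀ * (1 / k ^ 3 + 1 / k ^ 2) * (N + ∑' l, ‖a l‖) ≤ 1 / 2) (hn : ‖n‖ ≤ N) (m : ℤ) :
    ‖n * coeffD k h m‖ + ‖coeffE k h m‖ * (∑' l, ‖a l‖) + ‖(0 : ℤ → ℂ) m‖ * (∑' l, ‖a l‖) ≤ 1 / 2 := by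
  have hA : 0 ≤ ∑' l, ‖a l‖ := tsum_nonneg fun _ => norm_nonneg _
  have h0 : 0 ≤ h₀ := (abs_nonneg _).trans hh
  have hw : wt m ^ (-1 : ℤ) ≤ 1 := by
    rw [zpow_neg_one]; exact inv_le_one_of_one_le₀ (one_le_wt m)
  have hε : 0 ≤ h₀ * (1 / k ^ 3 + 1 / k ^ 2) := by positivity
  have h1 := (coeffD_le hk hh m).trans (mul_le_of_le_one_right hε hw)
  have h2 := (coeffE_le hk hh m).trans (mul_le_of_le_one_right hε hw)
  rw [norm_mul, Pi.zero_apply, norm_zero, zero_mul, add_zero]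
  calc _ ≤ N * (h₀ * (1 / k ^ 3 + 1 / k ^ 2)) + (h₀ * (1 / k ^ 3 + 1 / k ^ 2)) * ∑' l, ‖a l‖ := by
        have : 0 ≤ N := (norm_nonneg _).trans hn
        gcongr
    _ ≤ 1 / 2 := by linarith

lemma norm_coeffD_le (hk : 0 < k) (hh : |h| ≤ h₀) (m : ℤ) :
    ‖coeffD k h m‖ ≤ h₀ * (1 / k ^ 3 + 1 / k ^ 2) := by
  have h0 : 0 ≤ h₀ := (abs_nonneg _).trans hh
  refine (coeffD_le hk hh m).trans (mul_le_of_le_one_right (by positivity) ?_)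
  rw [zpow_neg_one]; exact inv_le_one_of_one_le₀ (one_le_wt m)

lemma norm_coeffE_le (hk : 0 < k) (hh : |h| ≤ h₀) (m : ℤ) :
    ‖coeffE k h m‖ ≤ h₀ * (1 / k ^ 3 + 1 / k ^ 2) := by
  have h0 : 0 ≤ h₀ := (abs_nonneg _).trans hh
  refine (coeffE_le hk hh m).trans (mul_le_of_le_one_right (by positivity) ?_)
  rw [zpow_neg_one]; exact inv_le_one_of_one_le₀ (one_le_wt m)

/-- The correction solves the fixed point equation exactly when adding the leading mode gives
a solution of the eigenvalue equation away from the leading mode. -/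
lemma corrMap_fixed_iff (ha : RapidSeq a) {C : ℝ} {p : ℤ → ℂ} (hp : ∀ m, ‖p m‖ ≤ C)
    (hp0 : p 0 = 1) (hn : n * p 0 + Complex.I * k * conv a p 0 = 0) :
    (∀ m, p m = lop a (fun l => n * coeffD k h l) (coeffE k h) 0 p m + delta m) ↔
    ∀ m, corrMap a (-Complex.I * k) (coeffD k h) (coeffE k h) (fun l => p l - delta l) m =
      p m - delta m := by
  have hc : ∀ m, conv a (fun l => p l - delta l) m = conv a p m - a m := fun m => by
    rw [conv_sub ha hp norm_delta_le, conv_delta]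
  have hs : scal a (-Complex.I * k) (fun l => p l - delta l) = n := by
    unfold scal
    rw [hp0] at hn
    rw [hc]
    linear_combination -hn
  refine forall_congr' fun m => ?_
  unfold corrMap lop
  rw [hs, hc, Pi.zero_apply]
  have : coeffD k h m * delta m = 0 := by
    by_cases hm : m = 0
    · rw [hm, coeffD_zero, zero_mul]
    · rw [delta_of_ne hm, mul_zero]
  constructor
  · intro H; linear_combination -H - n * this
  · intro H; linear_combination -H - n * this

lemma lop_add {a α e β y z : ℤ → ℂ} (ha : RapidSeq a) {C C' : ℝ} (hy : ∀ m, ‖y m‖ ≤ C)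
    (hz : ∀ m, ‖z m‖ ≤ C') (m : ℤ) :
    lop a α e β (fun l => y l + z l) m = lop a α e β y m + lop a α e β z m := by
  unfold lop; rw [conv_add ha hy hz, conv_add ha hy hz]; ring

lemma resSeq_sub (ha : RapidSeq a) {y z : ℤ → ℂ} {C C' : ℝ} (hy : ∀ m, ‖y m‖ ≤ C)
    (hz : ∀ m, ‖z m‖ ≤ C') (ξ : ℝ) (μ : ℂ) (m : ℤ) :
    resSeq k a ξ μ (fun l => y l - z l) m = resSeq k a ξ μ y m - resSeq k a ξ μ z m := by
  unfold resSeq; rw [conv_sub ha hy hz]; ring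

lemma lop_coeff_zero (y : ℤ → ℂ) :
    lop a (fun l => n * coeffD k h l) (coeffE k h) 0 y 0 = 0 := by
  simp [lop, coeffD_zero, coeffE_zero]

lemma coeffD_mul_delta (m : ℤ) : coeffD k h m * delta m = 0 := by
  by_cases hm : m = 0
  · rw [hm, coeffD_zero, zero_mul]
  · rw [delta_of_ne hm, mul_zero]

/-- Both sides solve the same half-contractive equation with source `y 0 * delta`; only the modes `m
≠ 0` of the kernel equation are needed. -/
lemma bounded_kernel (ha : RapidSeq a) (hk : 0 < k) (hh : |h| ≤ h₀) {N : ℝ}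
    (hN : h₀ * (1 / k ^ 3 + 1 / k ^ 2) * (N + ∑' l, ‖a l‖) ≤ 1 / 2) (hn : ‖n‖ ≤ N)
    (hκ : κ * h = 1) {p y : ℤ → ℂ} {B B' : ℝ} (hpB : ∀ m, ‖p m‖ ≤ B)
    (hp : ∀ m, p m = lop a (fun l => n * coeffD k h l) (coeffE k h) 0 p m + delta m)
    (hyB : ∀ m, ‖y m‖ ≤ B') (hy : ∀ m, resSeq k a κ (eigenvalue k κ n) y m = 0) :
    y = fun m => y 0 * p m := by
  have h1 := ((resSeq_iff hk hκ y 0).mp hy).1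
  refine lop_solution_unique ha (lop_coeff_small hk hh hN hn) (g := fun m => y 0 * delta m) hyB
    (B' := ‖y 0‖ * B) (fun m => ?_) (fun m => ?_) (fun m => ?_)
  · rw [norm_mul]; exact mul_le_mul_of_nonneg_left (hpB m) (norm_nonneg _)
  · conv_lhs => rw [h1 m]
    simp
  · rw [lop_const_mul]
    conv_lhs => rw [hp m]
    ring

/-- Near the large eigenvalues of the unperturbed operator, there is no other element of the
spectrum than the perturbed eigenvalue. -/
lemma uniquelySolvable_near (ha : RapidSeq a) (hk : 0 < k) (hh : |h| ≤ h₀)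
    {N : ℝ} (hN : h₀ * (1 / k ^ 3 + 1 / k ^ 2) * (N + ∑' l, ‖a l‖) ≤ 1 / 2) (hn : ‖n‖ ≤ N)
    (hκ : κ * h = 1) {w : ℤ → ℂ}
    (huniq : ∀ z : ℤ → ℂ, (∀ m, ‖z m‖ ≤ 1) →
      (∀ m, corrMap a (-Complex.I * k) (coeffD k h) (coeffE k h) z m = z m) → z = w)
    (hne : n ≠ scal a (-Complex.I * k) w) : UniquelySolvable k a κ (eigenvalue k κ n) := by
  have hsm := lop_coeff_small hk hh hN hn
  -- The sequence with leading coefficient 1 that solves all the equations with `m ≠ 0`. What it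
  -- leaves at `m = 0` is the scalar `F` below, whose zeros in `n` are the eigenvalues.
  obtain ⟨p, hpB, hp⟩ := exists_lop_solution ha hsm norm_delta_le
  have hp0 : p 0 = 1 := by rw [hp 0, lop_coeff_zero, delta_zero, zero_add]
  have hF : n * p 0 + Complex.I * k * conv a p 0 ≠ 0 := by
    intro hF
    have hfix := (corrMap_fixed_iff ha hpB hp0 hF).mp hp
    -- Uniqueness of the correction is known only in the unit ball. Here `p - delta` solves the
    -- linear equation with source `coeffE * a`, which is small enough.
    have hz : ∀ m, ‖p m - delta m‖ ≤ 1 := by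
      intro m
      have h1 := lop_solution_le ha hsm (g := fun m => coeffE k h m * a m)
        (y := fun m => p m - delta m) (G := h₀ * (1 / k ^ 3 + 1 / k ^ 2) * ∑' l, ‖a l‖)
        (B := 2 * 1 + 1)
        (fun m => by
          rw [norm_mul]
          exact mul_le_mul (norm_coeffE_le hk hh m) (ha.le_tsum m) (norm_nonneg _)
            ((norm_nonneg _).trans (norm_coeffE_le hk hh m)))
        (fun m => (norm_sub_le _ _).trans (add_le_add (hpB m) (norm_delta_le m)))
        (fun m => by
          rw [lop_sub ha hpB norm_delta_le]
          conv_lhs => rw [hp m]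
          have : lop a (fun l => n * coeffD k h l) (coeffE k h) 0 delta m = coeffE k h m * a m := by
            unfold lop
            rw [conv_delta, mul_assoc, coeffD_mul_delta]; simp
          rw [this]; ring) m
      refine h1.trans ?_
      have h2 : h₀ * (1 / k ^ 3 + 1 / k ^ 2) * ∑' l, ‖a l‖ ≤
          h₀ * (1 / k ^ 3 + 1 / k ^ 2) * (N + ∑' l, ‖a l‖) := by
        have h0 : 0 ≤ h₀ := (abs_nonneg _).trans hh
        have : 0 ≤ N := (norm_nonneg _).trans hn
        gcongr
        linarith
      linarith
    have hw := huniq _ hz hfix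
    apply hne
    rw [← hw]
    unfold scal
    rw [conv_sub ha hpB norm_delta_le, conv_delta]
    rw [hp0] at hF
    linear_combination hF
  rintro g ⟨C, hC⟩
  have hC0 : 0 ≤ C := (norm_nonneg _).trans (hC 0)
  set ε := h₀ * (1 / k ^ 3 + 1 / k ^ 2)
  -- A particular solution for the modes `m ≠ 0` with zero leading coefficient. The multiple `c` of
  -- `p` added to it is the one that satisfies the scalar condition, which is possible as `F ≠ 0`.
  obtain ⟨q, hqB, hq⟩ := exists_lop_solution ha hsm (g := fun m => -(h * coeffD k h m * g m))
    (G := |h| * ε * C) (fun m => by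
      rw [norm_neg, norm_mul, norm_mul, Complex.norm_real, Real.norm_eq_abs]
      have := norm_coeffD_le hk hh m
      have := hC m
      have : 0 ≤ ε := (norm_nonneg _).trans (norm_coeffD_le hk hh m)
      gcongr)
  have hq0 : q 0 = 0 := by rw [hq 0, lop_coeff_zero, coeffD_zero]; simp
  set F := n * p 0 + Complex.I * k * conv a p 0 with hFdef
  set c := (h * g 0 - Complex.I * k * conv a q 0) / F with hc
  have hcp : ∀ m, ‖c * p m‖ ≤ ‖c‖ * (2 * 1) := fun m => by
    rw [norm_mul]; exact mul_le_mul_of_nonneg_left (hpB m) (norm_nonneg _)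
  have hyB : ∀ m, ‖c * p m + q m‖ ≤ ‖c‖ * (2 * 1) + 2 * (|h| * ε * C) := fun m =>
    (norm_add_le _ _).trans (add_le_add (hcp m) (hqB m))
  have hy : ∀ m, resSeq k a κ (eigenvalue k κ n) (fun m => c * p m + q m) m = g m := by
    refine (resSeq_iff hk hκ (fun m => c * p m + q m) g).mpr ⟨fun m => ?_, ?_⟩
    · rw [lop_add ha hcp hqB, lop_const_mul, hp0, hq0]
      conv_lhs => rw [hp m, hq m]
      ring
    · rw [conv_add ha hcp hqB, conv_const_mul, hq0]
      have : c * F = h * g 0 - Complex.I * k * conv a q 0 := div_mul_cancel₀ _ hF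
      rw [hFdef] at this
      linear_combination this
  refine ⟨fun m => c * p m + q m, ⟨⟨_, hyB⟩, hy⟩, ?_⟩
  · rintro z ⟨⟨B, hB⟩, hz⟩
    have hd : ∀ m, resSeq k a κ (eigenvalue k κ n) (fun m => z m - (c * p m + q m)) m = 0 :=
      fun m => by rw [resSeq_sub ha hB hyB, hz, hy, sub_self]
    have hdB : ∀ m, ‖z m - (c * p m + q m)‖ ≤ B + (‖c‖ * (2 * 1) + 2 * (|h| * ε * C)) := fun m =>
      (norm_sub_le _ _).trans (add_le_add (hB m) (hyB m))
    have hker := bounded_kernel ha hk hh hN hn hκ hpB hp hdB hd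
    have hz0 := ((resSeq_iff hk hκ _ 0).mp hd).2
    rw [hker, conv_const_mul] at hz0
    simp only [hp0, mul_one, Pi.zero_apply, mul_zero] at hz0
    have h0 : (z 0 - (c * p 0 + q 0)) * F = 0 := by
      rw [hFdef, hp0]; linear_combination hz0
    have h0' := (mul_eq_zero.mp h0).resolve_right hF
    ext m
    have := congrFun hker m
    simp only [h0', zero_mul] at this
    exact sub_eq_zero.mp this

section eigen

variable {w : ℤ → ℂ}

lemma correction_zero
    (hfix : ∀ m, corrMap a (-Complex.I * k) (coeffD k h) (coeffE k h) w m = w m) : w 0 = 0 := by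
  rw [← hfix 0]; simp [corrMap, coeffD_zero, coeffE_zero]

lemma norm_delta_add_le (hw : ∀ m, ‖w m‖ ≤ 1) (m : ℤ) : ‖delta m + w m‖ ≤ 1 + 1 :=
  (norm_add_le _ _).trans (add_le_add (norm_delta_le m) (hw m))

lemma scal_eq (ha : RapidSeq a) (hw : ∀ m, ‖w m‖ ≤ 1) (K : ℂ) :
    scal a K w = K * conv a (fun m => delta m + w m) 0 := by
  rw [conv_add ha norm_delta_le hw, conv_delta]; rfl

lemma eigen_lop (ha : RapidSeq a) (hw : ∀ m, ‖w m‖ ≤ 1)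
    (hfix : ∀ m, corrMap a (-Complex.I * k) (coeffD k h) (coeffE k h) w m = w m) (m : ℤ) :
    delta m + w m = lop a (fun l => scal a (-Complex.I * k) w * coeffD k h l) (coeffE k h) 0
      (fun m => delta m + w m) m + delta m := by
  have e : (fun m => delta m + w m - delta m) = w := by ext m; ring
  refine (corrMap_fixed_iff (n := scal a (-Complex.I * k) w) ha (p := fun m => delta m + w m)
    (norm_delta_add_le hw) ?_ ?_).mpr ?_ m
  · simp [correction_zero hfix, delta_zero]
  · rw [scal_eq ha hw, correction_zero hfix, delta_zero]; ring
  · rw [e]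
    intro m
    rw [hfix]; ring

lemma eigen_resSeq (ha : RapidSeq a) (hk : 0 < k) (hκ : κ * h = 1) (hw : ∀ m, ‖w m‖ ≤ 1)
    (hfix : ∀ m, corrMap a (-Complex.I * k) (coeffD k h) (coeffE k h) w m = w m) (m : ℤ) :
    resSeq k a κ (eigenvalue k κ (scal a (-Complex.I * k) w)) (fun m => delta m + w m) m = 0 := by
  refine (resSeq_iff hk hκ (fun m => delta m + w m) 0).mpr ⟨fun m => ?_, ?_⟩ m
  · rw [correction_zero hfix, delta_zero]
    have := eigen_lop ha hw hfix m
    simpa using this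
  · rw [scal_eq ha hw, correction_zero hfix, delta_zero, Pi.zero_apply]; ring

/-- The eigenvector is not in the range: there is no Jordan block. -/
lemma eigen_not_range (ha : RapidSeq a) (hk : 0 < k) (hh : |h| ≤ h₀) (hs : SmallRange a k h₀)
    {N : ℝ} (hN : h₀ * (1 / k ^ 3 + 1 / k ^ 2) * (N + ∑' l, ‖a l‖) ≤ 1 / 2)
    (hn : ‖scal a (-Complex.I * k) w‖ ≤ N) (hκ : κ * h = 1) (hw : ∀ m, ‖w m‖ ≤ 1)
    (hfix : ∀ m, corrMap a (-Complex.I * k) (coeffD k h) (coeffE k h) w m = w m)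
    {y : ℤ → ℂ} {B : ℝ} (hyB : ∀ m, ‖y m‖ ≤ B) :
    ¬ ∀ m, resSeq k a κ (eigenvalue k κ (scal a (-Complex.I * k) w)) y m = -(delta m + w m) := by
  intro H
  obtain ⟨h1, h2⟩ := (resSeq_iff hk hκ y fun m => -(delta m + w m)).mp H
  have w0 := correction_zero hfix
  set p : ℤ → ℂ := fun m => delta m + w m with hp
  have hpB : ∀ m, ‖p m‖ ≤ 1 + 1 := norm_delta_add_le hw
  have hpl := eigen_lop ha hw hfix
  have hyp : ∀ m, ‖y 0 * p m‖ ≤ ‖y 0‖ * (1 + 1) := fun m => by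
    rw [norm_mul]; exact mul_le_mul_of_nonneg_left (hpB m) (norm_nonneg _)
  have hA : 0 ≤ ∑' l, ‖a l‖ := tsum_nonneg fun _ => norm_nonneg _
  set ε := h₀ * (1 / k ^ 3 + 1 / k ^ 2) with hε
  -- A generalized eigenvector differs from a multiple of `p` by at most `2 |h| ε`, because `coeffD
  -- * delta = 0` leaves only `coeffD * w` in the source. The scalar condition then requires `|h| ≤
  -- 2 k ε |h| ∑ ‖a l‖ ≤ |h| / 4`, which is absurd.
  have hq := lop_solution_le ha (lop_coeff_small hk hh hN hn) (y := fun m => y m - y 0 * p m)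
    (g := fun m => h * (coeffD k h m * w m)) (G := |h| * ε)
    (fun m => by
      rw [norm_mul, norm_mul, Complex.norm_real, Real.norm_eq_abs]
      have := (mul_le_of_le_one_right (norm_nonneg _) (hw m)).trans (norm_coeffD_le hk hh m)
      gcongr)
    (fun m => (norm_sub_le _ _).trans (add_le_add (hyB m) (hyp m)))
    (fun m => by
      rw [lop_sub ha hyB hyp, lop_const_mul]
      have e1 := h1 m
      have e2 := hpl m
      have e3 := coeffD_mul_delta (k := k) (h := h) m
      linear_combination e1 - y 0 * e2 + h * e3)
  have hc := conv_le_sup ha hq 0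
  rw [conv_sub ha hyB hyp, conv_const_mul] at hc
  have hsc := scal_eq ha hw (-Complex.I * k)
  have e : Complex.I * k * (conv a y 0 - y 0 * conv a p 0) = -h := by
    rw [hsc] at h2
    rw [w0, delta_zero] at h2
    linear_combination h2
  have e' := congrArg norm e
  rw [norm_mul, norm_mul, Complex.norm_I, one_mul, norm_neg, Complex.norm_real, Complex.norm_real,
    Real.norm_of_nonneg hk.le, Real.norm_eq_abs] at e'
  have hpos : 0 < |h| := abs_pos.mpr (right_ne_zero_of_mul_eq_one hκ)
  have hs' : ε * ((4 * k + 4) * ∑' l, ‖a l‖) ≤ 1 / 2 := by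
    have := hs
    unfold SmallRange at this
    rwa [norm_mul, norm_neg, Complex.norm_I, one_mul, Complex.norm_real,
      Real.norm_of_nonneg hk.le] at this
  have hε0 : 0 ≤ ε := (norm_nonneg _).trans (norm_coeffD_le hk hh 0)
  have h3 : |h| ≤ k * ((∑' l, ‖a l‖) * (2 * (|h| * ε))) := by
    exact e'.symm.le.trans (mul_le_mul_of_nonneg_left hc hk.le)
  have h4 : ε * (k * ∑' l, ‖a l‖) ≤ 1 / 8 := by
    have : 0 ≤ ε * ∑' l, ‖a l‖ := mul_nonneg hε0 hA
    nlinarith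
  nlinarith

end eigen

end near

/-- Far from the spectrum of the unperturbed operator, the equation is uniquely solvable. -/
lemma uniquelySolvable_far {k : ℝ} (hk : 0 < k) {a : ℤ → ℂ} (ha : RapidSeq a) {ξ : ℝ} {μ : ℂ}
    (hμ : ∀ m, (2 * k * (∑' l, ‖a l‖) + 1) * (1 + |freq m + ξ|) ≤
      ‖μ - Complex.I * k ^ 3 * (freq m + ξ) ^ 3‖) : UniquelySolvable k a ξ μ := by
  have hA : 0 ≤ ∑' l, ‖a l‖ := tsum_nonneg fun _ => norm_nonneg _
  set d : ℤ → ℂ := fun m => μ - Complex.I * k ^ 3 * (freq m + ξ) ^ 3 with hd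
  have hd1 : ∀ m, 1 + |freq m + ξ| ≤ ‖d m‖ := fun m => by
    refine le_trans ?_ (hμ m)
    have : 0 ≤ 2 * k * (∑' l, ‖a l‖) := by positivity
    nlinarith [abs_nonneg (freq m + ξ)]
  have hd0 : ∀ m, d m ≠ 0 := fun m => norm_pos_iff.mp (by
    have := abs_nonneg (freq m + ξ); linarith [hd1 m])
  -- After division by the diagonal symbol, the assumed distance makes the potential term a
  -- half-contraction; this is the origin of the factor `2 k ∑ ‖a l‖`.
  have hsm : ∀ m, ‖(0 : ℤ → ℂ) m‖ + ‖-(Complex.I * k * (freq m + ξ)) / d m‖ * (∑' l, ‖a l‖) +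
      ‖(0 : ℤ → ℂ) m‖ * (∑' l, ‖a l‖) ≤ 1 / 2 := fun m => by
    have hc : ‖((freq m : ℂ) + ξ)‖ = |freq m + ξ| := by
      rw [← Complex.ofReal_add, Complex.norm_real, Real.norm_eq_abs]
    rw [Pi.zero_apply, norm_zero, zero_mul, zero_add, add_zero, norm_div, norm_neg, norm_mul, norm_mul,
      Complex.norm_I, one_mul, Complex.norm_real, Real.norm_of_nonneg hk.le, hc, div_mul_eq_mul_div,
      div_le_iff₀ (norm_pos_iff.mpr (hd0 m))]
    have h1 := hμ m
    have h2 := abs_nonneg (freq m + ξ)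
    have h3 : 0 ≤ k * (∑' l, ‖a l‖) := by positivity
    have h4 : 0 ≤ k * (∑' l, ‖a l‖) * |freq m + ξ| := by positivity
    simp only [hd]
    nlinarith
  have hiff : ∀ y g : ℤ → ℂ, (∀ m, resSeq k a ξ μ y m = g m) ↔
      ∀ m, y m = lop a 0 (fun m => -(Complex.I * k * (freq m + ξ)) / d m) 0 y m + g m / d m := by
    intro y g
    refine forall_congr' fun m => ?_
    have e : resSeq k a ξ μ y m = d m * y m + Complex.I * k * (freq m + ξ) * conv a y m := rfl
    have := hd0 m
    rw [e]
    unfold lop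
    simp only [Pi.zero_apply, zero_mul, zero_add, add_zero]
    rw [div_mul_eq_mul_div, ← add_div, eq_div_iff this]
    constructor
    · intro H; linear_combination H
    · intro H; linear_combination H
  rintro g ⟨C, hC⟩
  have hC0 : 0 ≤ C := (norm_nonneg _).trans (hC 0)
  obtain ⟨y, hyB, hy⟩ := exists_lop_solution ha hsm (g := fun m => g m / d m) (G := C) fun m => by
    rw [norm_div]
    exact (div_le_self (norm_nonneg _) (by
      have := abs_nonneg (freq m + ξ); linarith [hd1 m])).trans (hC m)
  refine ⟨y, ⟨⟨_, hyB⟩, (hiff y g).mpr hy⟩, ?_⟩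
  rintro z ⟨⟨B, hB⟩, hz⟩
  exact lop_solution_unique ha hsm hB hyB ((hiff z g).mp hz) hy

/-- The term with `freq m ^ 3` is isolated in the equation; what is left of the symbol is at most
quadratic in `m`. The constants 147 and 21 are `3 * 7 ^ 2` and `3 * 7`, from `abs_freq_le_wt`. -/
lemma norm_cube_mul_le {k : ℝ} (hk : 0 < k) {a : ℤ → ℂ} (ha : RapidSeq a) {ξ : ℝ} {μ : ℂ}
    {y g : ℤ → ℂ} (h : ∀ m, resSeq k a ξ μ y m = g m) {C : ℝ} {t : ℤ}
    (hC : ∀ m, ‖y m‖ ≤ C * wt m ^ t) :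
    ∃ C', 0 ≤ C' ∧ ∀ m, k ^ 3 * ‖(freq m : ℂ) ^ 3 * y m‖ ≤ ‖g m‖ + C' * wt m ^ (t + 2) := by
  set S := ∑' l, ‖a l‖ * wt l ^ t.natAbs
  have hS : 0 ≤ S := tsum_nonneg fun l => mul_nonneg (norm_nonneg _) (pow_nonneg (wt_pos l).le _)
  have hC0 : 0 ≤ C := by simpa [wt_zero] using (norm_nonneg _).trans (hC 0)
  set K := ‖μ‖ + k ^ 3 * (147 * |ξ| + 21 * |ξ| ^ 2 + |ξ| ^ 3) with hK
  refine ⟨K * C + k * (7 + |ξ|) * (S * C), by positivity, fun m => ?_⟩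
  have hw := one_le_wt m
  have hw2 : (1 : ℝ) ≤ wt m ^ 2 := one_le_pow₀ hw
  have hf := abs_freq_le_wt m
  have hx := abs_nonneg ξ
  have e : Complex.I * k ^ 3 * (freq m ^ 3 * y m) = -g m + (μ - Complex.I * k ^ 3 *
      (3 * freq m ^ 2 * ξ + 3 * freq m * ξ ^ 2 + ξ ^ 3)) * y m +
      Complex.I * k * (freq m + ξ) * conv a y m := by
    rw [← h m]; unfold resSeq; ring
  have e' := congrArg norm e
  rw [norm_mul, norm_mul, norm_pow, Complex.norm_I, one_mul, Complex.norm_real,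
    Real.norm_of_nonneg hk.le] at e'
  rw [e']
  have b1 : ‖μ - Complex.I * k ^ 3 * (3 * freq m ^ 2 * ξ + 3 * freq m * ξ ^ 2 + ξ ^ 3)‖ ≤
      K * wt m ^ 2 := by
    have hr : ((3 * freq m ^ 2 * ξ + 3 * freq m * ξ ^ 2 + ξ ^ 3 : ℂ)) =
        ((3 * freq m ^ 2 * ξ + 3 * freq m * ξ ^ 2 + ξ ^ 3 : ℝ) : ℂ) := by push_cast; ring
    refine (norm_sub_le _ _).trans ?_
    rw [hr, norm_mul, norm_mul, norm_pow, Complex.norm_I, one_mul, Complex.norm_real,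
      Complex.norm_real, Real.norm_of_nonneg hk.le, Real.norm_eq_abs]
    have h1 : |3 * freq m ^ 2 * ξ + 3 * freq m * ξ ^ 2 + ξ ^ 3| ≤
        3 * (7 * wt m) ^ 2 * |ξ| + 3 * (7 * wt m) * |ξ| ^ 2 + |ξ| ^ 3 := by
      refine (abs_add_three _ _ _).trans ?_
      simp only [abs_mul, abs_pow, Nat.abs_ofNat]
      gcongr
    have h2 : 3 * (7 * wt m) ^ 2 * |ξ| + 3 * (7 * wt m) * |ξ| ^ 2 + |ξ| ^ 3 ≤
        (147 * |ξ| + 21 * |ξ| ^ 2 + |ξ| ^ 3) * wt m ^ 2 := by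
      have h3 : wt m * |ξ| ^ 2 ≤ wt m ^ 2 * |ξ| ^ 2 := by gcongr; nlinarith
      have h4 : 1 * |ξ| ^ 3 ≤ wt m ^ 2 * |ξ| ^ 3 := by gcongr
      nlinarith
    have h5 : ‖μ‖ * 1 ≤ ‖μ‖ * wt m ^ 2 := by gcongr
    have h6 := mul_le_mul_of_nonneg_left (h1.trans h2) (pow_pos hk 3).le
    rw [hK]; nlinarith
  have b2 : ‖Complex.I * k * (freq m + ξ)‖ ≤ k * (7 + |ξ|) * wt m := by
    rw [norm_mul, norm_mul, Complex.norm_I, one_mul, Complex.norm_real, Real.norm_of_nonneg hk.le,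
      ← Complex.ofReal_add, Complex.norm_real, Real.norm_eq_abs, mul_assoc]
    gcongr
    refine (abs_add_le _ _).trans ?_
    nlinarith
  have b3 := conv_le ha hC m
  have hz : wt m ^ (t + 2) = wt m ^ 2 * wt m ^ t := by
    rw [zpow_add₀ (wt_pos m).ne', mul_comm]; norm_cast
  have hz' : wt m * wt m ^ t ≤ wt m ^ 2 * wt m ^ t := by
    have := (wt_zpow_pos m t).le
    gcongr; nlinarith
  have hwt := (wt_zpow_pos m t).le
  refine norm_add₃_le.trans ?_
  rw [norm_neg, norm_mul, norm_mul (Complex.I * k * (freq m + ξ))]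
  calc _ ≤ ‖g m‖ + (K * wt m ^ 2) * (C * wt m ^ t) + (k * (7 + |ξ|) * wt m) * (S * C * wt m ^ t) := by
        gcongr
        exact hC m
    _ = ‖g m‖ + K * C * (wt m ^ 2 * wt m ^ t) + k * (7 + |ξ|) * (S * C) * (wt m * wt m ^ t) := by ring
    _ ≤ ‖g m‖ + K * C * (wt m ^ 2 * wt m ^ t) + k * (7 + |ξ|) * (S * C) * (wt m ^ 2 * wt m ^ t) := by
        gcongr
    _ = _ := by rw [hz]; ring

/-- Regularity of the bounded solutions. -/
lemma summable_cube_of_resSeq {k : ℝ} (hk : 0 < k) {a : ℤ → ℂ} (ha : RapidSeq a) {ξ : ℝ} {μ : ℂ}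
    {y g : ℤ → ℂ} (hg : Summable fun m => ‖g m‖ ^ 2) {B : ℝ} (hB : ∀ m, ‖y m‖ ≤ B)
    (h : ∀ m, resSeq k a ξ μ y m = g m) : Summable fun m => ‖(freq m : ℂ) ^ 3 * y m‖ ^ 2 := by
  obtain ⟨G, hG⟩ : ∃ G, ∀ m, ‖g m‖ ≤ G := by
    refine ⟨1 + ∑' m, ‖g m‖ ^ 2, fun m => ?_⟩
    have := hg.le_tsum m fun _ _ => sq_nonneg _
    nlinarith [sq_nonneg (‖g m‖ - 1)]
  have hG0 : 0 ≤ G := (norm_nonneg _).trans (hG 0)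
  have hB0 : 0 ≤ B := (norm_nonneg _).trans (hB 0)
  have k3 : 0 < k ^ 3 := pow_pos hk 3
  -- Each use of `norm_cube_mul_le` gains one power. It stops at 3 because `g` is merely bounded:
  -- beyond that, `wt m ^ (-s + 2)` no longer dominates it.
  have step : ∀ s : ℕ, s ≤ 3 → ∃ C, ∀ m, ‖y m‖ ≤ C * wt m ^ (-(s : ℤ)) := by
    intro s
    induction s with
    | zero => intro _; exact ⟨B, by simpa using hB⟩
    | succ s ih =>
      intro hs
      obtain ⟨C, hC⟩ := ih (by omega)
      obtain ⟨C', hC'0, hC'⟩ := norm_cube_mul_le hk ha h hC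
      refine ⟨B + (G + C') / k ^ 3, fun m => ?_⟩
      by_cases hm : m = 0
      · subst hm
        rw [wt_zero, one_zpow, mul_one]
        have : 0 ≤ (G + C') / k ^ 3 := by positivity
        linarith [hB 0]
      · have h1 := hC' m
        have h2 : (1 : ℝ) ≤ wt m ^ (-(s : ℤ) + 2) := one_le_zpow₀ (one_le_wt m) (by omega)
        have h3 : wt m ^ 3 * ‖y m‖ ≤ ‖(freq m : ℂ) ^ 3 * y m‖ := by
          rw [norm_mul, norm_pow, Complex.norm_real, Real.norm_eq_abs]
          have := wt_pos m
          have := three_wt_le_abs_freq hm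
          gcongr
          linarith
        have h4 : k ^ 3 * (wt m ^ 3 * ‖y m‖) ≤ (G + C') * wt m ^ (-(s : ℤ) + 2) := by
          refine (mul_le_mul_of_nonneg_left h3 k3.le).trans (h1.trans ?_)
          have := mul_le_mul_of_nonneg_left h2 hG0
          have := hG m
          linarith
        have h5 : wt m ^ (-(s : ℤ) + 2) = wt m ^ 3 * wt m ^ (-((s + 1 : ℕ) : ℤ)) := by
          rw [← zpow_natCast, ← zpow_add₀ (wt_pos m).ne']; congr 1; push_cast; ring
        have h6 : ‖y m‖ ≤ (G + C') / k ^ 3 * wt m ^ (-((s + 1 : ℕ) : ℤ)) := by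
          rw [h5] at h4
          have hw3 := pow_pos (wt_pos m) 3
          rw [div_mul_eq_mul_div, le_div_iff₀ k3]
          refine le_of_mul_le_mul_left ?_ hw3
          linarith
        refine h6.trans (mul_le_mul_of_nonneg_right ?_ (wt_zpow_pos _ _).le)
        linarith
  obtain ⟨C, hC⟩ := step 3 le_rfl
  obtain ⟨C', hC'0, hC'⟩ := norm_cube_mul_le hk ha h hC
  refine Summable.of_nonneg_of_le (fun m => sq_nonneg _) (fun m => ?_)
    (((hg.mul_left 2).add (summable_wt.mul_left (2 * C' ^ 2))).mul_left (1 / k ^ 6))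
  have h1 := hC' m
  have h2 : wt m ^ (-2 : ℤ) = (wt m ^ (-((3 : ℕ) : ℤ) + 2)) ^ 2 := by
    rw [← zpow_natCast, ← zpow_mul]; norm_num
  rw [h2]
  set u := wt m ^ (-((3 : ℕ) : ℤ) + 2)
  rw [one_div, inv_mul_eq_div, le_div_iff₀ (by positivity)]
  have h3 := pow_le_pow_left₀ (by positivity) h1 2
  calc _ = (k ^ 3 * ‖(freq m : ℂ) ^ 3 * y m‖) ^ 2 := by ring
    _ ≤ (‖g m‖ + C' * u) ^ 2 := h3
    _ ≤ _ := by nlinarith [sq_nonneg (‖g m‖ - C' * u)]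

/-! ### Transfer to the torus: invertibility, kernel, range, and the dual eigenvalue problem. -/

lemma fc_mode_mul (g : ℝ → ℂ) (j m : ℤ) : fc (fun x => mode j x * g x) m = fc g (m - j) := by
  unfold fc
  congr 1; ext x
  rw [← mul_assoc, ← mode_add]
  congr 2; ring

section

variable {k : ℝ} {A : ℝ → ℝ}

/-- Unique solvability for bounded sequences implies invertibility on the torus. -/
lemma existsUnique_of_uniquelySolvable (hk : 0 < k) (hA : ContDiff ℝ ∞ A) (pA : Periodic A 1)
    {ξ : ℝ} {μ : ℂ} (h : UniquelySolvable k (fc fun x => (A x : ℂ)) ξ μ) {g : ℝ → ℂ}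
    (hg : MemL2per g) :
    ∃! w : ℝ → ℂ, MemH3per w ∧ (fun x => μ * w x - blochOp k A ξ w x) =ᵐ[volume] g := by
  have ha : RapidSeq (fc fun x => (A x : ℂ)) :=
    rapidSeq_fc (ofReal_contDiff hA) fun x => by simp only [pA x]
  have hs := hg.summable_sq_fc
  obtain ⟨y, ⟨⟨B, hB⟩, hy⟩, hu⟩ := h (fc g) (by
    refine ⟨1 + ∑' m, ‖fc g m‖ ^ 2, fun m => ?_⟩
    have := hs.le_tsum m fun _ _ => sq_nonneg _
    nlinarith [sq_nonneg (‖fc g m‖ - 1)])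
  obtain ⟨w, hw, hwy⟩ := exists_memH3per_fc (summable_cube_of_resSeq hk ha hs hB hy)
  have hwy' : fc w = y := funext hwy
  refine ⟨w, ⟨hw, (hw.equation_iff hA pA hg ξ μ).mpr (by rw [hwy']; exact hy)⟩, ?_⟩
  rintro z ⟨hz, hze⟩
  have h1 := hu (fc z) ⟨hz.bounded, (hz.equation_iff hA pA hg ξ μ).mp hze⟩
  exact eq_of_fc_eq hz.2.1.continuous hz.1 hw.2.1.continuous hw.1 fun m => by rw [h1, hwy']

/-- The kernel on the torus is spanned by the function with the given Fourier coefficients. -/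
lemma eq_const_mul_of_kernel {ξ κ : ℝ} {μ : ℂ} {j : ℤ} (hA : ContDiff ℝ ∞ A) (pA : Periodic A 1)
    (hκ : freq j + ξ = κ) {P : ℝ → ℂ} (cP : Continuous P) (pP : Periodic P 1)
    (hker : ∀ y : ℤ → ℂ, (∃ B, ∀ m, ‖y m‖ ≤ B) →
      (∀ m, resSeq k (fc fun x => (A x : ℂ)) κ μ y m = 0) → y = fun m => y 0 * fc P m)
    {w : ℝ → ℂ} (hw : MemH3per w) (he : blochOp k A ξ w =ᵐ[volume] fun x => μ * w x) :
    ∃ z : ℂ, ∀ x, w x = z * (mode j x * P x) := by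
  have h0 : MemL2per fun _ => (0 : ℂ) := memL2per_of_continuous continuous_const fun _ => rfl
  have h1 := (hw.equation_iff hA pA h0 ξ μ).mp (by
    filter_upwards [he] with x hx
    rw [hx, sub_self])
  have f0 : ∀ m, fc (fun _ => (0 : ℂ)) m = 0 := fun m => by simp [fc]
  obtain ⟨B, hB⟩ := hw.bounded
  have h2 := hker (fun m => fc w (m + j)) ⟨B, fun m => hB _⟩ fun m => by
    rw [← hκ, resSeq_shift, h1, f0]
  refine ⟨fc w (0 + j), fun x => ?_⟩
  refine congrFun (eq_of_fc_eq (h := fun x => fc w (0 + j) * (mode j x * P x))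
    hw.2.1.continuous hw.1 (continuous_const.mul ((continuous_mode j).mul cP))
    (fun x => by simp only [mode_periodic j x, pP x]) fun m => ?_) x
  rw [fc_const_mul, fc_mode_mul]
  have := congrFun h2 (m - j)
  simpa using this

lemma not_range_of_resSeq {ξ κ : ℝ} {μ : ℂ} {j : ℤ} (hA : ContDiff ℝ ∞ A) (pA : Periodic A 1)
    (hκ : freq j + ξ = κ) {P : ℝ → ℂ} (cP : Continuous P) (pP : Periodic P 1)
    (hran : ∀ y : ℤ → ℂ, (∃ B, ∀ m, ‖y m‖ ≤ B) →
      ¬ ∀ m, resSeq k (fc fun x => (A x : ℂ)) κ μ y m = -fc P m) :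
    ¬ ∃ w : ℝ → ℂ, MemH3per w ∧
      (fun x => blochOp k A ξ w x - μ * w x) =ᵐ[volume] fun x => mode j x * P x := by
  rintro ⟨w, hw, he⟩
  have hP : MemL2per fun x => (-1 : ℂ) * (mode j x * P x) :=
    memL2per_of_continuous (continuous_const.mul ((continuous_mode j).mul cP))
      fun x => by simp only [mode_periodic j x, pP x]
  have h1 := (hw.equation_iff hA pA hP ξ μ).mp (by
    filter_upwards [he] with x hx
    rw [← hx]; ring)
  obtain ⟨B, hB⟩ := hw.bounded
  refine hran (fun m => fc w (m + j)) ⟨B, fun m => hB _⟩ fun m => ?_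
  rw [← hκ, resSeq_shift, h1, fc_const_mul, fc_mode_mul, add_sub_cancel_right]; ring

/-- A smooth function whose Fourier coefficients solve the eigenvalue equation is an
eigenfunction. -/
lemma blochOp_eq_of_resSeq {κ : ℝ} {μ : ℂ} (hA : ContDiff ℝ ∞ A) (pA : Periodic A 1) {P : ℝ → ℂ}
    (hP : ContDiff ℝ ∞ P) (pP : Periodic P 1)
    (h : ∀ m, resSeq k (fc fun x => (A x : ℂ)) κ μ (fc P) m = 0) (x : ℝ) :
    blochOp k A κ P x = μ * P x := by
  have h0 : MemL2per fun _ => (0 : ℂ) := memL2per_of_continuous continuous_const fun _ => rfl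
  have hw : MemH3per P := memH3per_of_contDiff (contDiff_infty.mp hP 3) pP
  have f0 : ∀ m, fc (fun _ => (0 : ℂ)) m = 0 := fun m => by simp [fc]
  have h1 := (hw.equation_iff hA pA h0 κ μ).mpr fun m => by rw [h, f0]
  have h2 := (Continuous.ae_eq_iff_eq volume
    ((continuous_const.mul hP.continuous).sub (blochOp_smooth hA hP κ).continuous)
    continuous_const).mp h1
  exact (sub_eq_zero.mp (congrFun h2 x)).symm

lemma conj_innerPer (g h : ℝ → ℂ) : (starRingEnd ℂ) (innerPer g h) = innerPer h g := by
  unfold innerPer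
  rw [← intervalIntegral.intervalIntegral_conj]
  congr 1; ext x
  rw [map_mul, Complex.conj_conj, mul_comm]

/-- Eigenvalues with an eigenfunction which is not isotropic for the form of `k² (∂ₓ + iξ)² + A`
are imaginary. -/
lemma eigenvalue_re_eq_zero {κ : ℝ} {μ : ℂ} (hA : ContDiff ℝ ∞ A) (pA : Periodic A 1) {P : ℝ → ℂ}
    (hP : ContDiff ℝ ∞ P) (pP : Periodic P 1) (h : ∀ x, blochOp k A κ P x = μ * P x)
    (hne : innerPer (hillOp k A κ P) P ≠ 0) : μ.re = 0 := by
  have hH := hillOp_smooth (k := k) hA hP κ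
  have pH := hillOp_periodic (k := k) pA pP κ
  have P2 := contDiff_infty.mp hP 2
  -- With `T = ∂ₓ + iκ` and `H = hillOp`, pairing `-k T H P = μ P` with `H P` gives `μ ⟨HP, P⟩ = -k
  -- ⟨HP, T HP⟩`. The right side is imaginary since `T` is skew-adjoint, and `⟨HP, P⟩` is real since
  -- `H` is symmetric.
  have h1 : μ * innerPer (hillOp k A κ P) P =
      -k * innerPer (hillOp k A κ P) (twistedDeriv κ (hillOp k A κ P)) := by
    rw [← innerPer_const_mul_right, ← innerPer_const_mul_right]
    congr 1; ext x
    exact (h x).symm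
  have h2 := innerPer_twistedDeriv (contDiff_infty.mp hH 1) pH (contDiff_infty.mp hH 1) pH κ
  have h3 : innerPer (hillOp k A κ P) P = innerPer P (hillOp k A κ P) :=
    (innerPer_hillOp hA.continuous P2 pP P2 pP κ).symm
  have h4 := congrArg (starRingEnd ℂ) h1
  rw [map_mul, map_mul, conj_innerPer, conj_innerPer, ← h3] at h4
  simp only [map_neg, Complex.conj_ofReal] at h4
  have h5 : (μ + (starRingEnd ℂ) μ) * innerPer (hillOp k A κ P) P = 0 := by
    linear_combination h1 + h4 - k * h2
  have h6 := (mul_eq_zero.mp h5).resolve_right hne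
  rw [Complex.add_conj] at h6
  have : (2 * μ.re : ℝ) = 0 := by exact_mod_cast h6
  linarith

lemma innerPer_hillOp_self_im {κ : ℝ} (hA : ContDiff ℝ ∞ A) {P : ℝ → ℂ}
    (hP : ContDiff ℝ ∞ P) (pP : Periodic P 1) :
    (innerPer (hillOp k A κ P) P).im = 0 := by
  have P2 := contDiff_infty.mp hP 2
  have h3 := innerPer_hillOp (k := k) hA.continuous P2 pP P2 pP κ
  rw [← conj_innerPer, Complex.conj_eq_iff_im] at h3
  exact h3

/-- The dual eigenfunction. -/
lemma hillOp_dual {κ : ℝ} {μ : ℂ} (hμ : μ.re = 0) {P : ℝ → ℂ}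
    (h : ∀ x, blochOp k A κ P x = μ * P x) (c : ℂ) (x : ℝ) :
    (k : ℂ) * hillOp k A κ (twistedDeriv κ (fun x => c * hillOp k A κ P x)) x =
      (starRingEnd ℂ) μ * (c * hillOp k A κ P x) := by
  have h1 : (fun x => -(k : ℂ) * twistedDeriv κ (hillOp k A κ P) x) = fun x => μ * P x := funext h
  -- `H` intertwines `L = -k T H` with minus its adjoint `k H T`, so applying `H` to the eigenvalue
  -- equation gives the adjoint one with `-μ`, which is the conjugate of `μ`.
  have h2 := congrFun (congrArg (hillOp k A κ) h1) x
  rw [hillOp_const_mul, hillOp_const_mul] at h2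
  have h3 : (starRingEnd ℂ) μ = -μ := by
    apply Complex.ext <;> simp [hμ]
  rw [twistedDeriv_const_mul, hillOp_const_mul, h3]
  linear_combination -c * h2

/-- The adjoint eigenvalue equation, for smooth functions. -/
lemma innerPer_blochOp_of_dual {ξ κ : ℝ} {μ : ℂ} {j : ℤ} (hA : ContDiff ℝ ∞ A) (pA : Periodic A 1)
    (hκ : freq j + ξ = κ) {ψ : ℝ → ℂ} (hψ : ContDiff ℝ ∞ ψ) (pψ : Periodic ψ 1)
    (h : ∀ x, (k : ℂ) * hillOp k A κ (twistedDeriv κ ψ) x = (starRingEnd ℂ) μ * ψ x)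
    {w : ℝ → ℂ} (hw : MemH3per w) :
    innerPer (fun x => mode j x * ψ x) (blochOp k A ξ w) =
      innerPer (fun x => (starRingEnd ℂ) μ * (mode j x * ψ x)) w := by
  rw [hw.innerPer_blochOp hA pA ((contDiff_mode j).mul hψ)
    (fun x => by simp only [mode_periodic j x, pψ x]),
    twistedDeriv_mode_mul (hψ.differentiable (by simp)), hκ,
    hillOp_mode_mul (twistedDeriv_smooth hψ κ), hκ]
  congr 1; ext x
  linear_combination mode j x * h x

end

/-! ### Partial derivatives and integrals of smooth families. -/

section parametric

/-- Partial derivatives of a smooth function are smooth. -/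
lemma contDiff_deriv_fst {F : ℝ × ℝ → ℂ} (hF : ContDiff ℝ ∞ F) :
    ContDiff ℝ ∞ fun q : ℝ × ℝ => deriv (fun t => F (t, q.2)) q.1 := by
  have : (fun q : ℝ × ℝ => deriv (fun t => F (t, q.2)) q.1) = fun q => fderiv ℝ F q (1, 0) := by
    ext q
    have h1 : HasDerivAt (fun t : ℝ => (t, q.2)) (1, 0) q.1 :=
      (hasDerivAt_id q.1).prodMk (hasDerivAt_const _ _)
    exact ((hF.differentiable (by simp) q).hasFDerivAt.comp_hasDerivAt q.1 h1).deriv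
  rw [this]
  exact (hF.fderiv_right (m := ∞) (by simp)).clm_apply contDiff_const

lemma contDiff_deriv_snd {F : ℝ × ℝ → ℂ} (hF : ContDiff ℝ ∞ F) :
    ContDiff ℝ ∞ fun q : ℝ × ℝ => deriv (fun x => F (q.1, x)) q.2 := by
  have := contDiff_deriv_fst (hF.comp (contDiff_snd.prodMk contDiff_fst))
  exact this.comp (contDiff_snd.prodMk contDiff_fst)

lemma hasDerivAt_parametric_integral {F : ℝ × ℝ → ℂ} (hF : ContDiff ℝ ∞ F) (t : ℝ) :
    HasDerivAt (fun t => ∫ x in (0 : ℝ)..1, F (t, x))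
      (∫ x in (0 : ℝ)..1, deriv (fun t => F (t, x)) t) t := by
  have hd := (contDiff_deriv_fst hF).continuous
  obtain ⟨C, hC⟩ := ((isCompact_closedBall t 1).prod (isCompact_Icc (a := (0 : ℝ)) (b := 1))).exists_bound_of_continuousOn
    hd.continuousOn
  refine (intervalIntegral.hasDerivAt_integral_of_dominated_loc_of_deriv_le
    (F := fun t x => F (t, x)) (F' := fun t x => deriv (fun t => F (t, x)) t)
    (bound := fun _ => C) (Metric.closedBall_mem_nhds t one_pos) ?_ ?_ ?_ ?_ ?_ ?_).2
  · exact Filter.Eventually.of_forall fun s =>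
      (hF.continuous.comp (Continuous.prodMk_right s)).aestronglyMeasurable
  · exact (hF.continuous.comp (Continuous.prodMk_right t)).intervalIntegrable _ _
  · exact (hd.comp (Continuous.prodMk_right t)).aestronglyMeasurable
  · refine Filter.Eventually.of_forall fun x hx s hs => hC (s, x) ⟨hs, ?_⟩
    rw [uIoc_of_le zero_le_one] at hx
    exact Ioc_subset_Icc_self hx
  · exact intervalIntegrable_const
  · refine Filter.Eventually.of_forall fun x _ s _ => ?_
    have : Differentiable ℝ fun t => F (t, x) :=
      (hF.comp (contDiff_id.prodMk contDiff_const)).differentiable (by simp)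
    exact (this s).hasDerivAt

lemma contDiff_parametric_integral {F : ℝ × ℝ → ℂ} (hF : ContDiff ℝ ∞ F) :
    ContDiff ℝ ∞ fun t => ∫ x in (0 : ℝ)..1, F (t, x) := by
  have key : ∀ (n : ℕ) {F : ℝ × ℝ → ℂ}, ContDiff ℝ ∞ F →
      ContDiff ℝ n fun t => ∫ x in (0 : ℝ)..1, F (t, x) := by
    intro n
    induction n with
    | zero =>
      intro F hF
      refine contDiff_zero.mpr (Differentiable.continuous (𝕜 := ℝ) fun t => ?_)
      exact (hasDerivAt_parametric_integral hF t).differentiableAt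
    | succ n ih =>
      intro F hF
      rw [Nat.cast_succ, contDiff_succ_iff_deriv]
      refine ⟨fun t => (hasDerivAt_parametric_integral hF t).differentiableAt, by simp, ?_⟩
      rw [show deriv (fun t => ∫ x in (0 : ℝ)..1, F (t, x)) =
        fun t => ∫ x in (0 : ℝ)..1, deriv (fun t => F (t, x)) t from
        funext fun t => (hasDerivAt_parametric_integral hF t).deriv]
      exact ih (contDiff_deriv_fst hF)
  exact contDiff_infty.mpr fun n => key n hF

end parametric

/-! ### The profile of the eigenfunctions as a smooth function of `(h, x)`. -/

/-- `P (h, ·)` is, for `κ = 1 / h` large, an eigenfunction of the Bloch operator of exponent `κ`,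
for the eigenvalue `i k³ κ³ + κ n(h)`, and there is no other element of the spectrum at distance
`N |κ|` from `i k³ κ³`. -/
structure IsProfile (k : ℝ) (A : ℝ → ℝ) (N h₁ : ℝ) (n : ℝ → ℂ) (P : ℝ × ℝ → ℂ) : Prop where
  pos : 0 < h₁
  smooth_n : ContDiff ℝ ∞ n
  smooth : ContDiff ℝ ∞ P
  periodic : ∀ h, Periodic (fun x => P (h, x)) 1
  at_zero : ∀ x, P (0, x) = 1
  conj : ∀ h, |h| ≤ h₁ → ∀ x, (starRingEnd ℂ) (P (h, x)) = P (-h, x)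
  conj_n : ∀ h, |h| ≤ h₁ → n (-h) = -(starRingEnd ℂ) (n h)
  n_le : ∀ h, |h| ≤ h₁ → ‖n h‖ ≤ N
  fc_zero : ∀ h, |h| ≤ h₁ → fc (fun x => P (h, x)) 0 = 1
  eigen : ∀ κ h, |h| ≤ h₁ → κ * h = 1 → ∀ x,
    blochOp k A κ (fun x => P (h, x)) x = eigenvalue k κ (n h) * P (h, x)
  kernel : ∀ κ h, |h| ≤ h₁ → κ * h = 1 → ∀ y : ℤ → ℂ, (∃ B, ∀ m, ‖y m‖ ≤ B) →
    (∀ m, resSeq k (fc fun x => (A x : ℂ)) κ (eigenvalue k κ (n h)) y m = 0) →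
    y = fun m => y 0 * fc (fun x => P (h, x)) m
  not_range : ∀ κ h, |h| ≤ h₁ → κ * h = 1 → ∀ y : ℤ → ℂ, (∃ B, ∀ m, ‖y m‖ ≤ B) →
    ¬ ∀ m, resSeq k (fc fun x => (A x : ℂ)) κ (eigenvalue k κ (n h)) y m =
      -fc (fun x => P (h, x)) m
  unique : ∀ κ h, |h| ≤ h₁ → κ * h = 1 → ∀ ν : ℂ, ‖ν‖ ≤ N → ν ≠ n h →
    UniquelySolvable k (fc fun x => (A x : ℂ)) κ (eigenvalue k κ ν)

lemma fc_one (m : ℤ) : fc (fun _ => (1 : ℂ)) m = delta m := by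
  unfold fc delta
  simp only [mul_one, integral_mode, neg_eq_zero]

lemma conj_fc_ofReal (A : ℝ → ℝ) (m : ℤ) :
    (starRingEnd ℂ) (fc (fun x => (A x : ℂ)) (-m)) = fc (fun x => (A x : ℂ)) m := by
  unfold fc
  rw [← intervalIntegral.intervalIntegral_conj]
  congr 1; ext x
  rw [map_mul, conj_mode, Complex.conj_ofReal]; simp

lemma conv_conj {a y : ℤ → ℂ} (ha : ∀ m, (starRingEnd ℂ) (a (-m)) = a m) (m : ℤ) :
    conv a (fun l => (starRingEnd ℂ) (y (-l))) m = (starRingEnd ℂ) (conv a y (-m)) := by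
  unfold conv
  rw [Complex.conj_tsum, ← (Equiv.neg ℤ).tsum_eq]
  refine tsum_congr fun l => ?_
  simp only [Equiv.neg_apply, map_mul]
  rw [← ha (-l), neg_neg]
  congr 3; ring

/-- As the potential is real, complex conjugation on functions exchanges the equations for `h` and
`-h`. Combined with uniqueness of the fixed point, this yields the reality symmetry of the profile.
-/
lemma corrMap_conj {a w : ℤ → ℂ} (ha : ∀ m, (starRingEnd ℂ) (a (-m)) = a m) (k h : ℝ) (m : ℤ) :
    corrMap a (-Complex.I * k) (coeffD k (-h)) (coeffE k (-h))
      (fun l => (starRingEnd ℂ) (w (-l))) m =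
    (starRingEnd ℂ) (corrMap a (-Complex.I * k) (coeffD k h) (coeffE k h) w (-m)) := by
  have hD : (starRingEnd ℂ) (coeffD k h (-m)) = -coeffD k (-h) m := by
    unfold coeffD
    rw [map_mul, Complex.conj_ofReal, freq_neg, neg_mul, mul_neg, map_neg, Complex.conj_I]
    simp only [mul_neg, neg_mul, neg_div, div_neg]
  have hE : (starRingEnd ℂ) (coeffE k h (-m)) = coeffE k (-h) m := by
    unfold coeffE
    rw [Complex.conj_ofReal, freq_neg]
    simp only [mul_neg, neg_mul, neg_div, div_neg]
  unfold corrMap scal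
  rw [conv_conj ha, conv_conj ha, ← ha m]
  have h0 := ha 0
  rw [neg_zero] at h0 ⊢
  simp only [map_add, map_mul, map_neg, Complex.conj_I, Complex.conj_ofReal, hD, hE, h0]
  ring

lemma scal_conj {a w : ℤ → ℂ} (ha : ∀ m, (starRingEnd ℂ) (a (-m)) = a m) (k : ℝ) :
    scal a (-Complex.I * k) (fun l => (starRingEnd ℂ) (w (-l))) =
      -(starRingEnd ℂ) (scal a (-Complex.I * k) w) := by
  unfold scal
  rw [conv_conj ha]
  have h0 := ha 0
  rw [neg_zero] at h0 ⊢
  simp only [map_add, map_mul, map_neg, Complex.conj_I, Complex.conj_ofReal, h0]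
  ring

theorem exists_isProfile {k : ℝ} {A : ℝ → ℝ} (hk : 0 < k) (hA : ContDiff ℝ ∞ A) (pA : Periodic A 1)
    {N : ℝ} (hN : 2 * k * (∑' m, ‖fc (fun x => (A x : ℂ)) m‖) ≤ N) :
    ∃ h₁ n P, IsProfile k A N h₁ n P := by
  have cA := ofReal_contDiff hA
  have pA' : Periodic (fun x => (A x : ℂ)) 1 := fun x => by simp only [pA x]
  have ha : RapidSeq (fc fun x => (A x : ℂ)) := rapidSeq_fc cA pA'
  have hac := conj_fc_ofReal A
  set a := fc fun x => (A x : ℂ) with hadef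
  have hS : 0 ≤ ∑' m, ‖a m‖ := tsum_nonneg fun _ => norm_nonneg _
  have nK : ‖-Complex.I * (k : ℂ)‖ = k := by
    rw [norm_mul, norm_neg, Complex.norm_I, one_mul, Complex.norm_real, Real.norm_of_nonneg hk.le]
  have hN0 : 0 ≤ N := le_trans (by positivity) hN
  -- Two smallness conditions are met at once by taking for `Q` the sum of the two constants; the
  -- added 1 keeps `Q` positive when the potential vanishes.
  obtain ⟨h₀, h0, hs, hN'⟩ : ∃ h₀ : ℝ, 0 < h₀ ∧ SmallRange a k h₀ ∧
      h₀ * (1 / k ^ 3 + 1 / k ^ 2) * (N + ∑' l, ‖a l‖) ≤ 1 / 2 := by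
    set Q := (4 * k + 4) * (∑' m, ‖a m‖) + (N + ∑' m, ‖a m‖) + 1 with hQ
    have hQ0 : 0 < Q := by positivity
    have e : 1 / (2 * (1 / k ^ 3 + 1 / k ^ 2) * Q) * (1 / k ^ 3 + 1 / k ^ 2) * Q = 1 / 2 := by
      have : 0 < 1 / k ^ 3 + 1 / k ^ 2 := by positivity
      field_simp
    have hc : 0 ≤ 1 / (2 * (1 / k ^ 3 + 1 / k ^ 2) * Q) * (1 / k ^ 3 + 1 / k ^ 2) := by positivity
    refine ⟨1 / (2 * (1 / k ^ 3 + 1 / k ^ 2) * Q), by positivity, ?_, ?_⟩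
    · unfold SmallRange
      rw [nK, ← e]
      refine mul_le_mul_of_nonneg_left ?_ hc
      rw [hQ]; linarith
    · conv_rhs => rw [← e]
      refine mul_le_mul_of_nonneg_left ?_ hc
      have : 0 ≤ (4 * k + 4) * (∑' m, ‖a m‖) := by positivity
      rw [hQ]; linarith
  obtain ⟨w, hR, hw1, hw⟩ := exists_smooth_correction ha hk h0 hs
  set P : ℝ × ℝ → ℂ := fun q => 1 + ∑' m, w m q.1 * mode m q.2 with hP
  have sP : ContDiff ℝ ∞ P := contDiff_const.add (contDiff_fourierSeries hR)
  have sPh : ∀ h, ContDiff ℝ ∞ fun x => P (h, x) := fun h =>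
    sP.comp (contDiff_const.prodMk contDiff_id)
  have pP : ∀ h, Periodic (fun x => P (h, x)) 1 := fun h x => by
    simp only [hP, mode_periodic _ x]
  have sw : ∀ h, Summable fun m => ‖w m h‖ := fun h => by
    obtain ⟨C, hC⟩ := Rap.iteratedDeriv_bound 0 hR (-2)
    exact Summable.of_nonneg_of_le (fun _ => norm_nonneg _)
      (fun m => by simpa using hC h m) (summable_wt.mul_left C)
  have fP : ∀ h m, fc (fun x => P (h, x)) m = delta m + w m h := fun h m => by
    have := fc_add (g := fun _ => (1 : ℂ)) (h := fun x => ∑' m, w m h * mode m x)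
      (continuous_const.intervalIntegrable _ _)
      ((continuous_series (sw h)).intervalIntegrable _ _) m
    rw [fc_one, fc_series (sw h)] at this
    exact this
  -- The integral form of `scal`, chosen because its smoothness in `h` is immediate from that of
  -- `P`.
  set n : ℝ → ℂ := fun h => -Complex.I * k * ∫ x in (0 : ℝ)..1, (A x : ℂ) * P (h, x) with hn
  have sn : ContDiff ℝ ∞ n := contDiff_const.mul (contDiff_parametric_integral
    (F := fun q => (A q.2 : ℂ) * P q) ((cA.comp contDiff_snd).mul sP))
  have en : ∀ h, n h = scal a (-Complex.I * k) fun m => w m h := fun h => by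
    rw [scal_eq ha (hw1 h), hn]
    have e1 : (fun m => delta m + w m h) = fc fun x => P (h, x) := funext fun m => (fP h m).symm
    rw [e1, ← fc_mul hA pA (sPh h).continuous]
    simp [fc, mode_zero]
  have nle : ∀ h, ‖n h‖ ≤ N := fun h => by
    rw [en]
    refine (scal_le ha _ (hw1 h)).trans (le_trans (le_of_eq ?_) hN)
    rw [nK]; ring
  have hle : ∀ h, |h| ≤ h₀ / 2 → |h| ≤ h₀ := fun h hh => by linarith
  have symm : ∀ h, |h| ≤ h₀ / 2 → (fun l => (starRingEnd ℂ) (w (-l) h)) = fun l => w l (-h) := by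
    intro h hh
    refine (hw (-h) (by rwa [abs_neg])).2 _ (fun m => ?_) fun m => ?_
    · rw [RCLike.norm_conj]; exact hw1 h _
    · rw [corrMap_conj hac k h m (w := fun l => w l h), (hw h hh).1]
  have efP : ∀ h, fc (fun x => P (h, x)) = fun m => delta m + w m h := fun h => funext (fP h)
  refine ⟨h₀ / 2, n, P, by positivity, sn, sP, pP, fun x => ?_, fun h hh x => ?_, fun h hh => ?_,
    fun h _ => nle h, fun h hh => ?_, fun κ h hh hκ x => ?_, fun κ h hh hκ y hy hy0 => ?_,
    fun κ h hh hκ y hy => ?_, fun κ h hh hκ ν hν hne => ?_⟩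
  · have : ∀ m, w m 0 = 0 := fun m => by
      rw [← (hw 0 (by rw [abs_zero]; positivity)).1 m]
      simp [corrMap, coeffD, coeffE]
    simp [hP, this]
  · simp only [hP, map_add, map_one, Complex.conj_tsum]
    congr 1
    rw [← (Equiv.neg ℤ).tsum_eq]
    refine tsum_congr fun m => ?_
    have := congrFun (symm h hh) m
    rw [Equiv.neg_apply, map_mul, conj_mode, neg_neg, this]
  · rw [en, en, ← symm h hh]
    exact scal_conj hac k (w := fun l => w l h)
  · rw [fP, correction_zero (hw h hh).1, delta_zero, add_zero]
  · refine blochOp_eq_of_resSeq hA pA (sPh h) (pP h) (fun m => ?_) x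
    rw [efP, en]
    exact eigen_resSeq ha hk hκ (hw1 h) (hw h hh).1 m
  · obtain ⟨B, hB⟩ := hy
    rw [efP]
    rw [en] at hy0
    exact bounded_kernel ha hk (hle h hh) hN' (by rw [← en]; exact nle h) hκ
      (norm_delta_add_le (hw1 h)) (eigen_lop ha (hw1 h) (hw h hh).1) hB hy0
  · obtain ⟨B, hB⟩ := hy
    rw [efP, en]
    exact eigen_not_range ha hk (hle h hh) hs hN' (by rw [← en]; exact nle h) hκ (hw1 h)
      (hw h hh).1 hB
  · rw [en] at hne
    exact uniquelySolvable_near ha hk (hle h hh) hN' hν hκ (hw h hh).2 hne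

/-! ### The dual profile and the normalization of the pair. -/

/-- Normalized profiles of direct and dual eigenfunctions. -/
structure IsNormalizedPair (k : ℝ) (A : ℝ → ℝ) (δ : ℝ) (n : ℝ → ℂ) (Φ Ψ : ℝ × ℝ → ℂ) : Prop where
  smooth : ContDiff ℝ ∞ Φ
  smooth' : ContDiff ℝ ∞ Ψ
  periodic : ∀ h, Periodic (fun x => Φ (h, x)) 1
  periodic' : ∀ h, Periodic (fun x => Ψ (h, x)) 1
  at_zero : ∀ x, Φ (0, x) = 1
  at_zero' : ∀ x, Ψ (0, x) = 1
  deriv_eq : ∀ x, deriv (fun t => Φ (t, x)) 0 = deriv (fun t => Ψ (t, x)) 0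
  conj : ∀ h, |h| ≤ δ → ∀ x, (starRingEnd ℂ) (Φ (h, x)) = Φ (-h, x)
  conj' : ∀ h, |h| ≤ δ → ∀ x, (starRingEnd ℂ) (Ψ (h, x)) = Ψ (-h, x)
  re_eq : ∀ κ h, |h| ≤ δ → κ * h = 1 → (eigenvalue k κ (n h)).re = 0
  eigen : ∀ κ h, |h| ≤ δ → κ * h = 1 → ∀ x,
    blochOp k A κ (fun x => Φ (h, x)) x = eigenvalue k κ (n h) * Φ (h, x)
  dual : ∀ κ h, |h| ≤ δ → κ * h = 1 → ∀ x,
    (k : ℂ) * hillOp k A κ (twistedDeriv κ fun x => Ψ (h, x)) x =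
      (starRingEnd ℂ) (eigenvalue k κ (n h)) * Ψ (h, x)
  norm_eq : ∀ h, |h| ≤ δ → normPer (fun x => Φ (h, x)) = normPer (fun x => Ψ (h, x))
  pairing : ∀ h, |h| ≤ δ → innerPer (fun x => Ψ (h, x)) (fun x => Φ (h, x)) = 1

lemma deriv_zero_of_even {f : ℝ → ℝ} {δ : ℝ} (hδ : 0 < δ) (h : ∀ t, |t| ≤ δ → f (-t) = f t) :
    deriv f 0 = 0 := by
  have h1 : (fun t => f (-t)) =ᶠ[nhds 0] f := by
    filter_upwards [Metric.closedBall_mem_nhds (0 : ℝ) hδ] with t ht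
    exact h t (by simpa using ht)
  have h2 := h1.deriv_eq
  rw [deriv_comp_neg, neg_zero] at h2
  linarith

lemma innerPer_self (g : ℝ → ℂ) : innerPer g g = ((∫ x in (0 : ℝ)..1, ‖g x‖ ^ 2 : ℝ) : ℂ) := by
  unfold innerPer
  rw [← intervalIntegral.integral_ofReal]
  congr 1; ext x
  rw [Complex.conj_mul']; push_cast; rfl

lemma normPer_eq (g : ℝ → ℂ) : normPer g = Real.sqrt (innerPer g g).re := by
  rw [innerPer_self, Complex.ofReal_re]; rfl

/-- The profile of the dual eigenfunctions, which is `-(h² / k²) (k² (∂ₓ + i κ)² + A) P` for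
`h = 1 / κ`. -/
def dualProfile (k : ℝ) (A : ℝ → ℝ) (P : ℝ × ℝ → ℂ) (q : ℝ × ℝ) : ℂ :=
  P q - 2 * Complex.I * q.1 * deriv (fun x => P (q.1, x)) q.2 - q.1 ^ 2 *
    (deriv (fun x => deriv (fun x => P (q.1, x)) x) q.2 + (A q.2 : ℂ) / k ^ 2 * P q)

section

variable {k : ℝ} {A : ℝ → ℝ} {N h₁ : ℝ} {n : ℝ → ℂ} {P : ℝ × ℝ → ℂ}

lemma contDiff_slice {F : ℝ × ℝ → ℂ} (hF : ContDiff ℝ ∞ F) (h : ℝ) :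
    ContDiff ℝ ∞ fun x => F (h, x) := hF.comp (contDiff_const.prodMk contDiff_id)

lemma contDiff_slice' {F : ℝ × ℝ → ℂ} (hF : ContDiff ℝ ∞ F) (x : ℝ) :
    ContDiff ℝ ∞ fun h => F (h, x) := hF.comp (contDiff_id.prodMk contDiff_const)

lemma dualProfile_smooth (hA : ContDiff ℝ ∞ A) (hP : ContDiff ℝ ∞ P) :
    ContDiff ℝ ∞ (dualProfile k A P) := by
  have h1 := contDiff_deriv_snd hP
  have h2 := contDiff_deriv_snd h1
  have hq : ContDiff ℝ ∞ fun q : ℝ × ℝ => (q.1 : ℂ) := Complex.ofRealCLM.contDiff.comp contDiff_fst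
  have hA' : ContDiff ℝ ∞ fun q : ℝ × ℝ => (A q.2 : ℂ) := (ofReal_contDiff hA).comp contDiff_snd
  exact (hP.sub ((contDiff_const.mul hq).mul h1)).sub
    ((hq.pow 2).mul (h2.add ((hA'.div_const _).mul hP)))

lemma dualProfile_periodic (pA : Periodic A 1) (pP : ∀ h, Periodic (fun x => P (h, x)) 1) (h : ℝ) :
    Periodic (fun x => dualProfile k A P (h, x)) 1 := fun x => by
  have h1 := periodic_deriv (pP h)
  simp only [dualProfile, pP h x, h1 x, periodic_deriv h1 x, pA x]

/-- The factor `h²` turns the powers of `κ` in the operator into nonnegative powers of `h`, so the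
formula of `dualProfile` makes sense and is smooth at `h = 0` as well. -/
lemma dualProfile_eq (hk : 0 < k) (hP : ContDiff ℝ ∞ P) {κ h : ℝ} (hκ : κ * h = 1) (x : ℝ) :
    dualProfile k A P (h, x) = -(h ^ 2 / k ^ 2 : ℂ) * hillOp k A κ (fun x => P (h, x)) x := by
  have hs := contDiff_slice hP h
  have d1 : DifferentiableAt ℝ (fun x => P (h, x)) x := hs.differentiable (by simp) x
  have d2 : DifferentiableAt ℝ (deriv fun x => P (h, x)) x :=
    (contDiff_infty_iff_deriv.mp hs).2.differentiable (by simp) x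
  have hkc : (k : ℂ) ≠ 0 := by exact_mod_cast hk.ne'
  have hκ' : (κ : ℂ) * h = 1 := by exact_mod_cast hκ
  unfold hillOp
  rw [show twistedDeriv κ (fun x => P (h, x)) =
    fun x => deriv (fun x => P (h, x)) x + Complex.I * κ * P (h, x) from rfl]
  unfold twistedDeriv
  rw [deriv_fun_add d2 (d1.const_mul _), deriv_const_mul_field]
  unfold dualProfile
  have e : ∀ z : ℂ, (h ^ 2 / k ^ 2 : ℂ) * ((k : ℂ) ^ 2 * z) = h ^ 2 * z := fun z => by
    field_simp
  rw [mul_add (-(h ^ 2 / k ^ 2 : ℂ)), neg_mul (h ^ 2 / k ^ 2 : ℂ) ((k : ℂ) ^ 2 * _), e]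
  linear_combination (2 * Complex.I * h * deriv (fun x => P (h, x)) x + Complex.I ^ 2 *
    P (h, x) * (κ * h + 1)) * hκ' + P (h, x) * Complex.I_sq

lemma dualProfile_zero (x : ℝ) : dualProfile k A P (0, x) = P (0, x) := by
  simp [dualProfile]

lemma dualProfile_conj (hP : ContDiff ℝ ∞ P) {h : ℝ}
    (hc : ∀ x, (starRingEnd ℂ) (P (h, x)) = P (-h, x)) (x : ℝ) :
    (starRingEnd ℂ) (dualProfile k A P (h, x)) = dualProfile k A P (-h, x) := by
  have hs := contDiff_slice hP h
  have d1 : Differentiable ℝ (fun x => P (h, x)) := hs.differentiable (by simp)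
  have d2 : Differentiable ℝ (deriv fun x => P (h, x)) :=
    (contDiff_infty_iff_deriv.mp hs).2.differentiable (by simp)
  have e1 : ∀ x, deriv (fun x => P (-h, x)) x = (starRingEnd ℂ) (deriv (fun x => P (h, x)) x) :=
    fun x => by
      rw [← deriv_conj (d1 x)]
      simp only [hc]
  have e2 := deriv_conj (d2 x)
  unfold dualProfile
  simp only [map_sub, map_mul, map_add, map_pow, map_div₀, Complex.conj_ofReal, Complex.conj_I, hc,
    e1, e2, map_ofNat]
  push_cast; ring

/-- The only term that could alter the first order is `-2 i h ∂ₓP`, and `∂ₓP` vanishes at `h = 0`.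
This is the source of `r_1 = r̃_1`. -/
lemma deriv_dualProfile (hA : ContDiff ℝ ∞ A) (hP : ContDiff ℝ ∞ P) (h0 : ∀ x, P (0, x) = 1) (x : ℝ) :
    deriv (fun t => dualProfile k A P (t, x)) 0 = deriv (fun t => P (t, x)) 0 := by
  have h1 := contDiff_deriv_snd hP
  have h2 := contDiff_deriv_snd h1
  have hA' : ContDiff ℝ ∞ fun q : ℝ × ℝ => (A q.2 : ℂ) := (ofReal_contDiff hA).comp contDiff_snd
  have e1 := ((contDiff_slice' h1 x).differentiable (by simp) 0).hasDerivAt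
  have e2 := ((contDiff_slice' (h2.add ((hA'.div_const ((k : ℂ) ^ 2)).mul hP)) x).differentiable
    (by simp) 0).hasDerivAt
  have e0 := ((contDiff_slice' hP x).differentiable (by simp) 0).hasDerivAt
  have ht : HasDerivAt (fun t : ℝ => (t : ℂ)) 1 0 := Complex.ofRealCLM.hasDerivAt
  have hz : deriv (fun x => P ((0 : ℝ), x)) x = 0 := by simp [h0]
  have h3 := (e0.fun_sub ((ht.const_mul (2 * Complex.I)).fun_mul e1)).fun_sub ((ht.fun_pow 2).fun_mul e2)
  refine (h3.congr_deriv ?_).deriv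
  simp [hz]

/-- The scalar product of smooth families is smooth. -/
lemma contDiff_innerPer {F G : ℝ × ℝ → ℂ} (hF : ContDiff ℝ ∞ F) (hG : ContDiff ℝ ∞ G) :
    ContDiff ℝ ∞ fun h => (innerPer (fun x => F (h, x)) fun x => G (h, x)).re :=
  Complex.reCLM.contDiff.comp (contDiff_parametric_integral
    (F := fun q => (starRingEnd ℂ) (F q) * G q)
    (((Complex.conjCLE : ℂ →L[ℝ] ℂ).contDiff.comp hF).mul hG))

/-- Real parts of pairings are even in `h`; hence so are the normalizing factors, whose first
derivative at 0 must vanish. -/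
lemma innerPer_conj_re {F G : ℝ × ℝ → ℂ} {h : ℝ}
    (hF : ∀ x, (starRingEnd ℂ) (F (h, x)) = F (-h, x))
    (hG : ∀ x, (starRingEnd ℂ) (G (h, x)) = G (-h, x)) :
    (innerPer (fun x => F (-h, x)) fun x => G (-h, x)).re =
      (innerPer (fun x => F (h, x)) fun x => G (h, x)).re := by
  rw [← conj_innerPer (fun x => G (h, x)), Complex.conj_re]
  unfold innerPer
  simp only [← hF, ← hG, Complex.conj_conj]
  congr 2; ext x; ring

theorem IsProfile.exists_isNormalizedPair (hk : 0 < k) (hA : ContDiff ℝ ∞ A) (pA : Periodic A 1)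
    (hP : IsProfile k A N h₁ n P) : ∃ δ Φ Ψ, 0 < δ ∧ δ ≤ h₁ ∧ IsNormalizedPair k A δ n Φ Ψ := by
  set Q := dualProfile k A P with hQ
  have sQ : ContDiff ℝ ∞ Q := dualProfile_smooth hA hP.smooth
  have pQ : ∀ h, Periodic (fun x => Q (h, x)) 1 := dualProfile_periodic pA hP.periodic
  have cQ : ∀ h, |h| ≤ h₁ → ∀ x, (starRingEnd ℂ) (Q (h, x)) = Q (-h, x) := fun h hh =>
    dualProfile_conj hP.smooth (hP.conj h hh)
  have Q0 : ∀ x, Q (0, x) = 1 := fun x => by rw [hQ, dualProfile_zero, hP.at_zero]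
  set N1 : ℝ → ℝ := fun h => (innerPer (fun x => P (h, x)) fun x => P (h, x)).re with hN1
  set N2 : ℝ → ℝ := fun h => (innerPer (fun x => Q (h, x)) fun x => Q (h, x)).re with hN2
  set Z : ℝ → ℝ := fun h => (innerPer (fun x => Q (h, x)) fun x => P (h, x)).re with hZ
  have sN1 : ContDiff ℝ ∞ N1 := contDiff_innerPer hP.smooth hP.smooth
  have sN2 : ContDiff ℝ ∞ N2 := contDiff_innerPer sQ sQ
  have sZ : ContDiff ℝ ∞ Z := contDiff_innerPer sQ hP.smooth
  have N10 : N1 0 = 1 := by simp [hN1, innerPer, hP.at_zero]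
  have N20 : N2 0 = 1 := by simp [hN2, innerPer, Q0]
  have Z0 : Z 0 = 1 := by simp [hZ, innerPer, hP.at_zero, Q0]
  have ev1 : ∀ h, |h| ≤ h₁ → N1 (-h) = N1 h := fun h hh =>
    innerPer_conj_re (hP.conj h hh) (hP.conj h hh)
  have ev2 : ∀ h, |h| ≤ h₁ → N2 (-h) = N2 h := fun h hh => innerPer_conj_re (cQ h hh) (cQ h hh)
  have evZ : ∀ h, |h| ≤ h₁ → Z (-h) = Z h := fun h hh => innerPer_conj_re (cQ h hh) (hP.conj h hh)
  obtain ⟨h₂, h2, h21, hpos⟩ : ∃ h₂ : ℝ, 0 < h₂ ∧ h₂ ≤ h₁ ∧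
      ∀ h, |h| ≤ h₂ → 0 < N1 h ∧ 0 < N2 h ∧ 0 < Z h := by
    have e1 := sN1.continuous.continuousAt.eventually (lt_mem_nhds (by rw [N10]; exact one_pos))
    have e2 := sN2.continuous.continuousAt.eventually (lt_mem_nhds (by rw [N20]; exact one_pos))
    have e3 := sZ.continuous.continuousAt.eventually (lt_mem_nhds (by rw [Z0]; exact one_pos))
    obtain ⟨r, hr, H⟩ := Metric.nhds_basis_closedBall.eventually_iff.mp (e1.and (e2.and e3))
    refine ⟨min r h₁, lt_min hr hP.pos, min_le_right _ _, fun h hh => H ?_⟩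
    simpa using hh.trans (min_le_left _ _)
  -- With `χ h` in place of `h` the three quantities are positive for all `h`, so the roots and
  -- quotients are smooth on the whole line.
  obtain ⟨χ, sχ, -, bχ, eχ⟩ := exists_cutoff h2
  have q1 : ∀ h, 0 < N1 (χ h) := fun h => (hpos _ (bχ h)).1
  have q2 : ∀ h, 0 < N2 (χ h) := fun h => (hpos _ (bχ h)).2.1
  have q3 : ∀ h, 0 < Z (χ h) := fun h => (hpos _ (bχ h)).2.2
  -- The factors `t` of `P` and `s` of `Q` must satisfy `t s Z = 1` and `t² N1 = s² N2`. Eliminating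
  -- `s` gives `t⁴ = N2 / (N1 Z²)`.
  set t : ℝ → ℝ := fun h => (N2 (χ h) / (N1 (χ h) * Z (χ h) ^ 2)) ^ (1 / 4 : ℝ) with ht
  have qb : ∀ h, 0 < N2 (χ h) / (N1 (χ h) * Z (χ h) ^ 2) := fun h =>
    div_pos (q2 h) (mul_pos (q1 h) (pow_pos (q3 h) 2))
  have tpos : ∀ h, 0 < t h := fun h => Real.rpow_pos_of_pos (qb h) _
  have t4 : ∀ h, t h ^ 4 = N2 (χ h) / (N1 (χ h) * Z (χ h) ^ 2) := fun h => by
    rw [ht, ← Real.rpow_natCast, ← Real.rpow_mul (qb h).le]; norm_num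
  have st : ContDiff ℝ ∞ t := by
    refine ContDiff.rpow_const_of_ne ?_ fun h => (qb h).ne'
    exact (sN2.comp sχ).div ((sN1.comp sχ).mul ((sZ.comp sχ).pow 2))
      fun h => (mul_pos (q1 h) (pow_pos (q3 h) 2)).ne'
  set s : ℝ → ℝ := fun h => (t h * Z (χ h))⁻¹ with hs
  have ss : ContDiff ℝ ∞ s := (st.mul (sZ.comp sχ)).inv fun h => (mul_pos (tpos h) (q3 h)).ne'
  have χ0 : χ 0 = 0 := eχ 0 (by rw [abs_zero]; positivity)
  have t0 : t 0 = 1 := by simp [ht, χ0, N10, N20, Z0]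
  have s0 : s 0 = 1 := by simp [hs, χ0, t0, Z0]
  have evt : ∀ h, |h| ≤ h₂ / 2 → t (-h) = t h := fun h hh => by
    have hh1 : |h| ≤ h₁ := by linarith
    simp only [ht, eχ h hh, eχ (-h) (by rwa [abs_neg]), ev1 h hh1, ev2 h hh1, evZ h hh1]
  have evs : ∀ h, |h| ≤ h₂ / 2 → s (-h) = s h := fun h hh => by
    have hh1 : |h| ≤ h₁ := by linarith
    simp only [hs, evt h hh, eχ h hh, eχ (-h) (by rwa [abs_neg]), evZ h hh1]
  have dt : deriv t 0 = 0 := deriv_zero_of_even (by positivity) evt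
  have ds : deriv s 0 = 0 := deriv_zero_of_even (by positivity) evs
  have Zim : ∀ h, |h| ≤ h₁ → innerPer (fun x => Q (h, x)) (fun x => P (h, x)) = Z h := by
    intro h hh
    refine Complex.ext rfl ?_
    rw [Complex.ofReal_im]
    by_cases h0 : h = 0
    · subst h0; simp [innerPer, hP.at_zero, Q0]
    · have hκ : h⁻¹ * h = 1 := inv_mul_cancel₀ h0
      have e : (fun x => Q (h, x)) = fun x => (((-(h ^ 2 / k ^ 2) : ℝ)) : ℂ) *
          hillOp k A h⁻¹ (fun x => P (h, x)) x := by
        ext x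
        rw [hQ, dualProfile_eq hk hP.smooth hκ]; push_cast; rfl
      rw [e, innerPer_const_mul_left, Complex.conj_ofReal, Complex.im_ofReal_mul,
        innerPer_hillOp_self_im hA (contDiff_slice hP.smooth h) (hP.periodic h), mul_zero]
  -- The form `⟨HP, P⟩` is a nonzero multiple of `Z h`, which is positive, so the criterion for
  -- imaginary eigenvalues applies.
  have re0 : ∀ κ h, |h| ≤ h₂ → κ * h = 1 → (eigenvalue k κ (n h)).re = 0 := by
    intro κ h hh hκ
    refine eigenvalue_re_eq_zero hA pA (contDiff_slice hP.smooth h) (hP.periodic h)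
      (hP.eigen κ h (hh.trans h21) hκ) fun h0 => ?_
    have e : (fun x => Q (h, x)) = fun x => -(h ^ 2 / k ^ 2 : ℂ) *
        hillOp k A κ (fun x => P (h, x)) x := by
      ext x
      rw [hQ, dualProfile_eq hk hP.smooth hκ]
    have := Zim h (hh.trans h21)
    rw [e, innerPer_const_mul_left, h0, mul_zero] at this
    exact (hpos h hh).2.2.ne (by exact_mod_cast this)
  have sr : ∀ {τ : ℝ → ℝ}, ContDiff ℝ ∞ τ → ContDiff ℝ ∞ fun q : ℝ × ℝ => (τ q.1 : ℂ) :=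
    fun hτ => (ofReal_contDiff hτ).comp contDiff_fst
  have dmul : ∀ {τ : ℝ → ℝ} {F : ℝ × ℝ → ℂ}, ContDiff ℝ ∞ τ → ContDiff ℝ ∞ F → τ 0 = 1 →
      deriv τ 0 = 0 → ∀ x, deriv (fun h => (τ h : ℂ) * F (h, x)) 0 = deriv (fun h => F (h, x)) 0 := by
    intro τ F hτ hF h0 h1 x
    have e1 : HasDerivAt (fun h => (τ h : ℂ)) ((deriv τ 0 : ℝ) : ℂ) 0 :=
      (hτ.differentiable (by simp) 0).hasDerivAt.ofReal_comp
    have e2 := ((contDiff_slice' hF x).differentiable (by simp) 0).hasDerivAt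
    rw [(e1.fun_mul e2).deriv, h1, h0]; simp
  refine ⟨h₂ / 2, fun q => (t q.1 : ℂ) * P q, fun q => (s q.1 : ℂ) * Q q, by positivity,
    by linarith, (sr st).mul hP.smooth, (sr ss).mul sQ, fun h x => ?_, fun h x => ?_, fun x => ?_,
    fun x => ?_, fun x => ?_, fun h hh x => ?_, fun h hh x => ?_, fun κ h hh hκ => ?_,
    fun κ h hh hκ x => ?_, fun κ h hh hκ x => ?_, fun h hh => ?_, fun h hh => ?_⟩
  · simp only [hP.periodic h x]
  · simp only [pQ h x]
  · simp only [t0, hP.at_zero]; simp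
  · simp only [s0, Q0]; simp
  · simp only
    rw [dmul st hP.smooth t0 dt, dmul ss sQ s0 ds, hQ, deriv_dualProfile hA hP.smooth hP.at_zero]
  · simp only
    rw [map_mul, Complex.conj_ofReal, hP.conj h (by linarith), evt h hh]
  · simp only
    rw [map_mul, Complex.conj_ofReal, cQ h (by linarith), evs h hh]
  · exact re0 κ h (by linarith) hκ
  · simp only
    rw [blochOp_const_mul]
    simp only [hP.eigen κ h (by linarith) hκ]; ring
  · have e : (fun x => (s h : ℂ) * Q (h, x)) = fun x => ((s h : ℂ) * -(h ^ 2 / k ^ 2 : ℂ)) *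
        hillOp k A κ (fun x => P (h, x)) x := by
      ext x
      rw [hQ, dualProfile_eq hk hP.smooth hκ, mul_assoc]
    have e' := congrFun e x
    simp only at e e' ⊢
    rw [e, e']
    exact hillOp_dual (re0 κ h (by linarith) hκ) (hP.eigen κ h (by linarith) hκ) _ x
  · rw [normPer_eq, normPer_eq]
    congr 1
    simp only [innerPer_const_mul_left, innerPer_const_mul_right, Complex.conj_ofReal,
      Complex.re_ofReal_mul]
    change t h * (t h * N1 h) = s h * (s h * N2 h)
    have p1 := q1 h; have p2 := q2 h; have p3 := q3 h; have p4 := tpos h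
    have e := t4 h
    simp only [hs]
    rw [eχ h hh] at *
    rw [eq_div_iff (by positivity)] at e
    field_simp
    linarith
  · simp only [innerPer_const_mul_left, innerPer_const_mul_right, Complex.conj_ofReal]
    rw [Zim h (by linarith)]
    have p3 := q3 h; have p4 := tpos h
    simp only [hs]
    rw [eχ h hh] at *
    norm_cast
    field_simp

end

/-! ### Taylor expansion at `h = 0` and derivatives with respect to `κ = 1/h`. -/

/-- The partial derivative with respect to the first variable. -/
def derivFst (F : ℝ × ℝ → ℂ) (q : ℝ × ℝ) : ℂ := deriv (fun t => F (t, q.2)) q.1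

/-- The partial derivative with respect to the second variable. -/
def derivSnd (F : ℝ × ℝ → ℂ) (q : ℝ × ℝ) : ℂ := deriv (fun x => F (q.1, x)) q.2

lemma contDiff_derivFst_iterate {F : ℝ × ℝ → ℂ} (hF : ContDiff ℝ ∞ F) (n : ℕ) :
    ContDiff ℝ ∞ (derivFst^[n] F) := by
  induction n generalizing F with
  | zero => exact hF
  | succ n ih => exact ih (contDiff_deriv_fst hF)

lemma contDiff_derivSnd_iterate {F : ℝ × ℝ → ℂ} (hF : ContDiff ℝ ∞ F) (n : ℕ) :
    ContDiff ℝ ∞ (derivSnd^[n] F) := by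
  induction n generalizing F with
  | zero => exact hF
  | succ n ih => exact ih (contDiff_deriv_snd hF)

lemma iteratedDeriv_fst (F : ℝ × ℝ → ℂ) (n : ℕ) (t x : ℝ) :
    iteratedDeriv n (fun t => F (t, x)) t = derivFst^[n] F (t, x) := by
  induction n generalizing F with
  | zero => simp
  | succ n ih =>
    rw [iteratedDeriv_succ', iterate_succ_apply]
    exact ih (derivFst F)

lemma iteratedDeriv_snd (F : ℝ × ℝ → ℂ) (n : ℕ) (t x : ℝ) :
    iteratedDeriv n (fun x => F (t, x)) x = derivSnd^[n] F (t, x) := by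
  induction n generalizing F with
  | zero => simp
  | succ n ih =>
    rw [iteratedDeriv_succ', iterate_succ_apply]
    exact ih (derivSnd F)

lemma derivFst_eq_fderiv {F : ℝ × ℝ → ℂ} (hF : ContDiff ℝ ∞ F) :
    derivFst F = fun q => fderiv ℝ F q (1, 0) := by
  ext q
  have h1 : HasDerivAt (fun t : ℝ => (t, q.2)) (1, 0) q.1 :=
    (hasDerivAt_id q.1).prodMk (hasDerivAt_const _ _)
  exact ((hF.differentiable (by simp) q).hasFDerivAt.comp_hasDerivAt q.1 h1).deriv

lemma derivSnd_eq_fderiv {F : ℝ × ℝ → ℂ} (hF : ContDiff ℝ ∞ F) :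
    derivSnd F = fun q => fderiv ℝ F q (0, 1) := by
  ext q
  have h1 : HasDerivAt (fun x : ℝ => (q.1, x)) (0, 1) q.2 :=
    (hasDerivAt_const _ _).prodMk (hasDerivAt_id q.2)
  exact ((hF.differentiable (by simp) q).hasFDerivAt.comp_hasDerivAt q.2 h1).deriv

lemma derivFst_derivSnd {F : ℝ × ℝ → ℂ} (hF : ContDiff ℝ ∞ F) :
    derivFst (derivSnd F) = derivSnd (derivFst F) := by
  have h2 : ContDiff ℝ ∞ (fderiv ℝ F) := hF.fderiv_right (m := ∞) (by simp)
  have key : ∀ (v w : ℝ × ℝ) q, fderiv ℝ (fun q => fderiv ℝ F q v) q w = fderiv ℝ (fderiv ℝ F) q w v := by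
    intro v w q
    rw [fderiv_clm_apply (h2.differentiable (by simp) q) (differentiableAt_const _)]
    simp
  rw [derivFst_eq_fderiv (F := derivSnd F) (contDiff_deriv_snd hF),
    derivSnd_eq_fderiv (F := derivFst F) (contDiff_deriv_fst hF),
    derivSnd_eq_fderiv hF, derivFst_eq_fderiv hF]
  ext q
  rw [key, key]
  exact ((contDiff_infty.mp hF 2).contDiffAt.isSymmSndFDerivAt (by simp)).eq _ _

lemma derivFst_iterate_derivSnd {F : ℝ × ℝ → ℂ} (hF : ContDiff ℝ ∞ F) (n : ℕ) :
    derivFst^[n] (derivSnd F) = derivSnd (derivFst^[n] F) := by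
  induction n generalizing F with
  | zero => rfl
  | succ n ih =>
    rw [iterate_succ_apply, iterate_succ_apply, derivFst_derivSnd hF]
    exact ih (contDiff_deriv_fst hF)

lemma derivSnd_periodic {F : ℝ × ℝ → ℂ} (hF : ∀ t, Periodic (fun x => F (t, x)) 1) (n : ℕ) (t : ℝ) :
    Periodic (fun x => derivSnd^[n] F (t, x)) 1 := by
  induction n generalizing F with
  | zero => exact hF t
  | succ n ih => exact ih fun t => periodic_deriv (hF t)

lemma derivFst_periodic {F : ℝ × ℝ → ℂ} (hF : ∀ t, Periodic (fun x => F (t, x)) 1) (n : ℕ) (t : ℝ) :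
    Periodic (fun x => derivFst^[n] F (t, x)) 1 := by
  induction n generalizing F with
  | zero => exact hF t
  | succ n ih =>
    refine ih fun t x => ?_
    simp only [derivFst]
    congr 1
    exact funext fun t => hF t x

lemma exists_bound_of_periodic {F : ℝ × ℝ → ℂ} (cF : Continuous F)
    (hF : ∀ t, Periodic (fun x => F (t, x)) 1) (δ : ℝ) :
    ∃ C, ∀ t x, |t| ≤ δ → ‖F (t, x)‖ ≤ C := by
  obtain ⟨C, hC⟩ := ((isCompact_Icc (a := -δ) (b := δ)).prod
    (isCompact_Icc (a := (0 : ℝ)) (b := 1))).exists_bound_of_continuousOn cF.continuousOn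
  refine ⟨C, fun t x ht => ?_⟩
  obtain ⟨y, hy, e⟩ := (hF t).exists_mem_Ico₀ one_pos x
  rw [show F (t, x) = F (t, y) from e]
  exact hC (t, y) ⟨abs_le.mp ht, Ico_subset_Icc_self hy⟩

/-- A smooth family is flat of order `L` at `h = 0`. -/
def IsFlat (δ : ℝ) (L : ℤ) (F : ℝ × ℝ → ℂ) : Prop :=
  ∀ q : ℕ, ∃ C, ∀ h x, h ≠ 0 → |h| ≤ δ → ‖derivFst^[q] F (h, x)‖ ≤ C * |h| ^ (L - q)

/-- Induction on the order, through the derivative in `h`; the case `q = 0` integrates the bound by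
the mean value inequality. The value `h = 0` is excluded in `IsFlat` because a negative power of 0
is 0 by convention, which would make the bound false. -/
lemma isFlat_of_vanish {F : ℝ × ℝ → ℂ} (sF : ContDiff ℝ ∞ F)
    (pF : ∀ t, Periodic (fun x => F (t, x)) 1) {δ : ℝ} {L : ℕ}
    (h0 : ∀ q < L, ∀ x, derivFst^[q] F (0, x) = 0) : IsFlat δ L F := by
  induction L generalizing F with
  | zero =>
    intro q
    obtain ⟨C, hC⟩ := exists_bound_of_periodic (contDiff_derivFst_iterate sF q).continuous
      (derivFst_periodic pF q) δ
    refine ⟨C * δ ^ q, fun h x hh hδ => ?_⟩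
    have h1 := hC h x hδ
    have hp : 0 < |h| := abs_pos.mpr hh
    have hC0 : 0 ≤ C := (norm_nonneg _).trans h1
    rw [Nat.cast_zero, zero_sub, zpow_neg, zpow_natCast, mul_assoc]
    refine h1.trans (le_mul_of_one_le_right hC0 ?_)
    rw [← div_eq_mul_inv, one_le_div (pow_pos hp q)]
    gcongr
  | succ L ih =>
    have sF' : ContDiff ℝ ∞ (derivFst F) := contDiff_deriv_fst sF
    have ih' := ih sF' (derivFst_periodic pF 1) fun q hq x => h0 (q + 1) (by omega) x
    intro q
    rcases q with _ | q
    · obtain ⟨C, hC⟩ := ih' 0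
      simp only [iterate_zero, id_eq, Nat.cast_zero, sub_zero, zpow_natCast] at hC ⊢
      refine ⟨C, fun h x hh hδ => ?_⟩
      have hC0 : 0 ≤ C := by
        have := (norm_nonneg _).trans (hC h x hh hδ)
        exact nonneg_of_mul_nonneg_left this (pow_pos (abs_pos.mpr hh) L)
      have hz := h0 0 (by omega) x
      simp only [iterate_zero, id_eq] at hz
      -- Flatness says nothing at `t = 0`; there the bound passes to the limit by continuity.
      have hb : ∀ t ∈ Metric.closedBall (0 : ℝ) |h|, ‖deriv (fun t => F (t, x)) t‖ ≤ C * |h| ^ L := by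
        have hne : ∀ t ∈ Metric.closedBall (0 : ℝ) |h|, t ≠ 0 → ‖derivFst F (t, x)‖ ≤ C * |h| ^ L := by
          intro t ht ht0
          have ht' : |t| ≤ |h| := by simpa using ht
          refine (hC t x ht0 (ht'.trans hδ)).trans ?_
          gcongr
        intro t ht
        by_cases ht0 : t = 0
        · subst ht0
          have ctn : Continuous fun t => ‖derivFst F (t, x)‖ :=
            (sF'.continuous.comp (Continuous.prodMk_left x)).norm
          have ht0 : Filter.Tendsto (fun t => ‖derivFst F (t, x)‖) (nhdsWithin 0 {0}ᶜ)
              (nhds ‖derivFst F (0, x)‖) :=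
            ctn.continuousAt.tendsto.mono_left nhdsWithin_le_nhds
          refine le_of_tendsto ht0 ?_
          filter_upwards [self_mem_nhdsWithin, mem_nhdsWithin_of_mem_nhds
            (Metric.closedBall_mem_nhds (0 : ℝ) (abs_pos.mpr hh))] with s hs hs'
          exact hne s hs' hs
        · exact hne t ht ht0
      have hm := (convex_closedBall (0 : ℝ) |h|).norm_image_sub_le_of_norm_deriv_le
        (f := fun t => F (t, x)) (fun t _ => (contDiff_slice' sF x).differentiable (by simp) t) hb
        (x := 0) (y := h) (by simp) (by simp)
      rw [hz, sub_zero, sub_zero, Real.norm_eq_abs] at hm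
      refine hm.trans (le_of_eq ?_)
      rw [pow_succ]; ring
    · obtain ⟨C, hC⟩ := ih' q
      refine ⟨C, fun h x hh hδ => (hC h x hh hδ).trans (le_of_eq ?_)⟩
      congr 2; push_cast; ring

/-- Derivatives of `κ ↦ F (1 / κ, x)` for a flat family. -/
lemma IsFlat.iteratedDeriv_inv {F : ℝ × ℝ → ℂ} (sF : ContDiff ℝ ∞ F) {δ : ℝ} {L : ℤ}
    (hF : IsFlat δ L F) (α : ℕ) : ∀ p q : ℕ, ∃ C, ∀ κ x, κ ≠ 0 → |κ⁻¹| ≤ δ →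
      ‖iteratedDeriv α (fun κ : ℝ => (κ⁻¹ : ℂ) ^ p * derivFst^[q] F (κ⁻¹, x)) κ‖ ≤
        C * |κ| ^ (-(p + L - q + α)) := by
  -- Differentiation in `κ` sends `(p, q)` to `(p + 1, q)` and `(p + 2, q + 1)`, both of which
  -- increase `p - q` by one. Allowing all `p` and `q` is therefore what closes the induction on the
  -- number of derivatives.
  have hd : ∀ (p q : ℕ) (x κ : ℝ), κ ≠ 0 →
      HasDerivAt (fun κ : ℝ => (κ⁻¹ : ℂ) ^ p * derivFst^[q] F (κ⁻¹, x))
        (-(p : ℂ) * ((κ⁻¹ : ℂ) ^ (p + 1) * derivFst^[q] F (κ⁻¹, x)) -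
          (κ⁻¹ : ℂ) ^ (p + 2) * derivFst^[q + 1] F (κ⁻¹, x)) κ := by
    intro p q x κ hκ
    have hκc : (κ : ℂ) ≠ 0 := by exact_mod_cast hκ
    have e1 : HasDerivAt (fun κ : ℝ => (κ⁻¹ : ℂ)) (-((κ : ℂ) ^ 2)⁻¹) κ := by
      have := (hasDerivAt_inv hκ).ofReal_comp
      push_cast at this
      exact this
    have e2 : HasDerivAt (fun t => derivFst^[q] F (t, x)) (derivFst^[q + 1] F (κ⁻¹, x)) κ⁻¹ := by
      rw [iterate_succ_apply']
      exact ((contDiff_slice' (contDiff_derivFst_iterate sF q) x).differentiable (by simp) _).hasDerivAt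
    have e3 := e2.scomp κ (hasDerivAt_inv hκ)
    refine ((e1.fun_pow p).fun_mul e3).congr_deriv ?_
    rw [Complex.real_smul]
    push_cast
    rcases p with _ | p
    · simp only [comp_apply]; push_cast; ring
    · simp only [comp_apply, Nat.add_sub_cancel]; push_cast; ring
  have hs : ∀ (p q : ℕ) (x κ : ℝ), κ ≠ 0 →
      ContDiffAt ℝ ∞ (fun κ : ℝ => (κ⁻¹ : ℂ) ^ p * derivFst^[q] F (κ⁻¹, x)) κ := by
    intro p q x κ hκ
    have hi : ContDiffAt ℝ ∞ (fun κ : ℝ => κ⁻¹) κ := contDiffAt_inv ℝ hκ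
    have hi' : ContDiffAt ℝ ∞ (fun κ : ℝ => (κ⁻¹ : ℂ)) κ := by
      have := Complex.ofRealCLM.contDiff.contDiffAt.comp κ hi
      refine this.congr_of_eventuallyEq (Filter.Eventually.of_forall fun s => ?_)
      simp
    exact (hi'.pow p).mul
      ((contDiff_slice' (contDiff_derivFst_iterate sF q) x).contDiffAt.comp κ hi)
  induction α with
  | zero =>
    intro p q
    obtain ⟨C, hC⟩ := hF q
    refine ⟨C, fun κ x hκ hδ => ?_⟩
    have h1 := hC κ⁻¹ x (inv_ne_zero hκ) hδ
    rw [iteratedDeriv_zero, norm_mul, norm_pow, norm_inv, Complex.norm_real, Real.norm_eq_abs]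
    have hp : |κ| ≠ 0 := abs_ne_zero.mpr hκ
    calc _ ≤ |κ|⁻¹ ^ p * (C * |κ⁻¹| ^ (L - q)) := by gcongr
      _ = C * (|κ|⁻¹ ^ p * |κ|⁻¹ ^ (L - q)) := by rw [abs_inv]; ring
      _ = _ := by
        rw [← zpow_natCast, ← zpow_add₀ (inv_ne_zero hp), inv_zpow', Nat.cast_zero]
        congr 2; ring
  | succ α ih =>
    intro p q
    obtain ⟨C1, hC1⟩ := ih (p + 1) q
    obtain ⟨C2, hC2⟩ := ih (p + 2) (q + 1)
    refine ⟨p * C1 + C2, fun κ x hκ hδ => ?_⟩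
    have e : deriv (fun κ : ℝ => (κ⁻¹ : ℂ) ^ p * derivFst^[q] F (κ⁻¹, x)) =ᶠ[nhds κ]
        fun κ : ℝ => -(p : ℂ) * ((κ⁻¹ : ℂ) ^ (p + 1) * derivFst^[q] F (κ⁻¹, x)) -
          (κ⁻¹ : ℂ) ^ (p + 2) * derivFst^[q + 1] F (κ⁻¹, x) := by
      filter_upwards [isOpen_ne.mem_nhds hκ] with s hs
      exact (hd p q x s hs).deriv
    have c1 := (hs (p + 1) q x κ hκ).of_le (m := α) (by exact_mod_cast le_top)
    have c2 := (hs (p + 2) (q + 1) x κ hκ).of_le (m := α) (by exact_mod_cast le_top)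
    rw [iteratedDeriv_succ', e.iteratedDeriv_eq, iteratedDeriv_fun_sub (contDiffAt_const.mul c1) c2,
      iteratedDeriv_const_mul_field]
    have h1 := hC1 κ x hκ hδ
    have h2 := hC2 κ x hκ hδ
    have z1 : (-(((p + 1 : ℕ) : ℤ) + L - q + α)) = -(p + L - q + (α + 1 : ℕ)) := by push_cast; ring
    have z2 : (-(((p + 2 : ℕ) : ℤ) + L - (q + 1 : ℕ) + α)) = -(p + L - q + (α + 1 : ℕ)) := by
      push_cast; ring
    rw [z1] at h1
    rw [z2] at h2
    refine (norm_sub_le _ _).trans ?_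
    rw [norm_mul, norm_neg, Complex.norm_natCast, add_mul, mul_assoc]
    gcongr

/-- The remainder of the Taylor expansion at `h = 0`. -/
def taylorRem (M : ℕ) (F : ℝ × ℝ → ℂ) (q : ℝ × ℝ) : ℂ :=
  F q - ∑ l ∈ Finset.range (M + 1), q.1 ^ l • (derivFst^[l] F (0, q.2) / (l.factorial : ℂ))

lemma contDiff_taylorRem {F : ℝ × ℝ → ℂ} (hF : ContDiff ℝ ∞ F) (M : ℕ) :
    ContDiff ℝ ∞ (taylorRem M F) := by
  refine hF.sub (ContDiff.sum fun l _ => (contDiff_fst.pow l).smul (ContDiff.div_const ?_ _))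
  exact (contDiff_derivFst_iterate hF l).comp (contDiff_const.prodMk contDiff_snd)

lemma taylorRem_periodic {F : ℝ × ℝ → ℂ} (hF : ∀ t, Periodic (fun x => F (t, x)) 1) (M : ℕ) (t : ℝ) :
    Periodic (fun x => taylorRem M F (t, x)) 1 := fun x => by
  have h := fun l => derivFst_periodic hF l 0 x
  simp only at h
  simp only [taylorRem, hF t x, h]

lemma derivFst_taylorRem {F : ℝ × ℝ → ℂ} (hF : ContDiff ℝ ∞ F) {M q : ℕ} (hq : q < M + 1) (x : ℝ) :
    derivFst^[q] (taylorRem M F) (0, x) = 0 := by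
  rw [← iteratedDeriv_fst]
  have hle : ∀ j : ℕ, (j : WithTop ℕ∞) ≤ ∞ := fun j => by exact_mod_cast le_top
  have e : (fun t => taylorRem M F (t, x)) = fun t => F (t, x) -
      ∑ l ∈ Finset.range (M + 1), (t ^ l) • (derivFst^[l] F (0, x) / (l.factorial : ℂ)) := rfl
  have hs : ∀ l ∈ Finset.range (M + 1), ContDiffAt ℝ q
      (fun t : ℝ => (t ^ l) • (derivFst^[l] F (0, x) / (l.factorial : ℂ))) 0 := fun l _ =>
    (contDiff_id.pow l).contDiffAt.smul contDiffAt_const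
  rw [e, iteratedDeriv_fun_sub ((contDiff_slice' hF x).contDiffAt.of_le (hle q))
    (ContDiffAt.sum hs), iteratedDeriv_fun_sum hs, iteratedDeriv_fst,
    Finset.sum_eq_single_of_mem q (Finset.mem_range.mpr hq)]
  · rw [iteratedDeriv_smul_const (contDiff_id.pow q).contDiffAt, iteratedDeriv_fun_pow_zero,
      if_pos rfl, Complex.real_smul]
    have : (q.factorial : ℂ) ≠ 0 := by exact_mod_cast q.factorial_ne_zero
    push_cast
    field_simp
    simp
  · intro l _ hl
    rw [iteratedDeriv_smul_const (contDiff_id.pow l).contDiffAt, iteratedDeriv_fun_pow_zero,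
      if_neg (Ne.symm hl), Nat.cast_zero, zero_smul]

/-- Derivatives in `x` commute with those in `h`, so they preserve the order of vanishing at `h =
0`. -/
lemma isFlat_taylorRem {F : ℝ × ℝ → ℂ} (hF : ContDiff ℝ ∞ F)
    (pF : ∀ t, Periodic (fun x => F (t, x)) 1) (M i : ℕ) (δ : ℝ) :
    IsFlat δ (M + 1) (derivSnd^[i] (taylorRem M F)) := by
  have hs := contDiff_taylorRem hF M
  have hcomm : ∀ (i q : ℕ) {G : ℝ × ℝ → ℂ}, ContDiff ℝ ∞ G →
      derivFst^[q] (derivSnd^[i] G) = derivSnd^[i] (derivFst^[q] G) := by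
    intro i q
    induction i with
    | zero => intro G _; rfl
    | succ i ih =>
      intro G hG
      rw [iterate_succ_apply, iterate_succ_apply, ← derivFst_iterate_derivSnd hG]
      exact ih (contDiff_deriv_snd hG)
  have := isFlat_of_vanish (L := M + 1) (δ := δ) (contDiff_derivSnd_iterate hs i)
    (derivSnd_periodic (taylorRem_periodic pF M) i) fun q hq x => by
      rw [hcomm i q hs, ← iteratedDeriv_snd]
      simp only [derivFst_taylorRem hF hq]
      simp
  exact_mod_cast this

/-! ### Families indexed by `(j, ξ)`: coefficients, matching and remainders. -/

lemma floquet_uniqueDiffOn : UniqueDiffOn ℝ floquet :=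
  uniqueDiffOn_Icc (by linarith [Real.pi_pos])

lemma pi_mem_floquet : Real.pi ∈ floquet := ⟨by linarith [Real.pi_pos], le_rfl⟩

lemma neg_pi_mem_floquet : -Real.pi ∈ floquet := ⟨le_rfl, by linarith [Real.pi_pos]⟩

/-- A function of `κ = s + ξ` extends smoothly beyond the endpoints, so one-sided derivatives there
are ordinary derivatives in `κ`. -/
lemma iteratedDerivWithin_floquet {G : ℝ → ℂ} {s ξ : ℝ} (hξ : ξ ∈ floquet)
    (hG : ContDiffAt ℝ ∞ G (s + ξ)) (α : ℕ) :
    iteratedDerivWithin α (fun ζ => G (s + ζ)) floquet ξ = iteratedDeriv α G (s + ξ) := by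
  have h1 : ContDiffAt ℝ α (fun ζ => G (s + ζ)) ξ :=
    (hG.comp ξ (contDiffAt_const.add contDiffAt_id)).of_le (by exact_mod_cast le_top)
  rw [iteratedDerivWithin_eq_iteratedDeriv floquet_uniqueDiffOn h1 hξ, iteratedDeriv_comp_const_add]

/-- All matching conditions reduce to this: consecutive bands are adjacent pieces of one function of
`κ`. -/
lemma freq_add_pi (j : ℤ) : freq j + Real.pi = freq (j + 1) + -Real.pi := by
  unfold freq; push_cast; ring

/-- All exponents of index at least `j₀` are large. -/
structure IsLargeIndex (j₀ : ℕ) (δ : ℝ) : Prop where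
  one_le : 1 ≤ j₀
  inv_le : 1 ≤ δ * j₀

section index

variable {j₀ : ℕ} {δ : ℝ} {j : ℤ} {ξ : ℝ}

lemma IsLargeIndex.one_le_abs (H : IsLargeIndex j₀ δ) (hj : (j₀ : ℤ) ≤ |j|) : (1 : ℝ) ≤ |(j : ℝ)| := by
  have := H.one_le
  have : (1 : ℤ) ≤ |j| := by omega
  exact_mod_cast this

/-- As `|ξ| ≤ π` and `|j| ≥ 1`, the left exponent is at least `2π|j| - π ≥ π|j|`. -/
lemma IsLargeIndex.three_mul_le (H : IsLargeIndex j₀ δ) (hj : (j₀ : ℤ) ≤ |j|) (hξ : ξ ∈ floquet) :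
    3 * |(j : ℝ)| ≤ |freq j + ξ| := by
  have h1 := H.one_le_abs hj
  have h2 : |ξ| ≤ Real.pi := abs_le.mpr hξ
  have h3 : |freq j| = 2 * Real.pi * |(j : ℝ)| := by
    unfold freq; rw [abs_mul, abs_of_pos Real.two_pi_pos]
  have h4 := abs_sub_abs_le_abs_sub (freq j) (-ξ)
  rw [abs_neg, sub_neg_eq_add, h3] at h4
  nlinarith [Real.pi_gt_three]

lemma IsLargeIndex.le_mul (H : IsLargeIndex j₀ δ) (hj : (j₀ : ℤ) ≤ |j|) (hξ : ξ ∈ floquet) :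
    |freq j + ξ| ≤ 10 * |(j : ℝ)| := by
  have h1 := H.one_le_abs hj
  have h2 : |ξ| ≤ Real.pi := abs_le.mpr hξ
  have h3 : |freq j| = 2 * Real.pi * |(j : ℝ)| := by
    unfold freq; rw [abs_mul, abs_of_pos Real.two_pi_pos]
  have h4 := abs_add_le (freq j) ξ
  nlinarith [Real.pi_lt_d2]

lemma IsLargeIndex.ne_zero (H : IsLargeIndex j₀ δ) (hj : (j₀ : ℤ) ≤ |j|) (hξ : ξ ∈ floquet) : freq j + ξ ≠ 0 := by
  have h1 := H.one_le_abs hj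
  have h2 := H.three_mul_le hj hξ
  exact abs_pos.mp (by linarith)

lemma IsLargeIndex.abs_inv_le (H : IsLargeIndex j₀ δ) (hj : (j₀ : ℤ) ≤ |j|) (hξ : ξ ∈ floquet) : |(freq j + ξ)⁻¹| ≤ δ := by
  have h1 := H.one_le_abs hj
  have h2 := H.three_mul_le hj hξ
  have h3 : (j₀ : ℝ) ≤ |(j : ℝ)| := by exact_mod_cast hj
  have hδ : 0 < δ := by
    have h4 := H.inv_le
    by_contra hc
    have : δ * j₀ ≤ 0 := mul_nonpos_of_nonpos_of_nonneg (not_lt.mp hc) (by positivity)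
    linarith
  rw [abs_inv, inv_le_comm₀ (by linarith) hδ, inv_le_iff_one_le_mul₀ hδ]
  have h4 := H.inv_le
  nlinarith

lemma IsLargeIndex.zpow_le (H : IsLargeIndex j₀ δ) (hj : (j₀ : ℤ) ≤ |j|) (hξ : ξ ∈ floquet) (n : ℕ) :
    |freq j + ξ| ^ (-(n : ℤ)) ≤ |(j : ℝ)| ^ (-(n : ℤ)) := by
  have h1 := H.one_le_abs hj
  have h2 := H.three_mul_le hj hξ
  rw [zpow_neg, zpow_neg, zpow_natCast, zpow_natCast]
  exact inv_anti₀ (pow_pos (by linarith) _)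
    (pow_le_pow_left₀ (abs_nonneg _) (by linarith [abs_nonneg (j : ℝ)]) _)

end index

section families

variable {j₀ : ℕ} {δ : ℝ}

/-- The coefficients of the expansions. -/
def expCoeff (l : ℕ) (j : ℤ) (ξ : ℝ) : ℂ := ((freq j + ξ : ℝ) : ℂ)⁻¹ ^ l

lemma contDiffAt_ofReal_inv {κ : ℝ} (hκ : κ ≠ 0) :
    ContDiffAt ℝ ∞ (fun κ : ℝ => (κ : ℂ)⁻¹) κ := by
  have := Complex.ofRealCLM.contDiff.contDiffAt.comp κ (contDiffAt_inv (n := ∞) ℝ hκ)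
  refine this.congr_of_eventuallyEq (Filter.Eventually.of_forall fun s => ?_)
  simp

lemma coefficientBounds_expCoeff (H : IsLargeIndex j₀ δ) : CoefficientBounds j₀ expCoeff := by
  intro l _
  have hs : ∀ κ : ℝ, κ ≠ 0 → ContDiffAt ℝ ∞ (fun κ : ℝ => (κ : ℂ)⁻¹ ^ l) κ := fun κ hκ =>
    (contDiffAt_ofReal_inv hκ).pow l
  refine ⟨fun j hj ξ hξ => ?_, fun α => ?_⟩
  · exact ((hs _ (H.ne_zero hj hξ)).comp ξ (contDiffAt_const.add contDiffAt_id)).contDiffWithinAt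
  -- The powers `κ^{-l}` are treated by the lemma on flat families with the constant function 1, of
  -- order 0, and `p = l`.
  · have hflat : IsFlat δ (0 : ℕ) (fun _ => 1) :=
      isFlat_of_vanish contDiff_const (fun _ _ => rfl) (by simp)
    obtain ⟨C, hC⟩ := hflat.iteratedDeriv_inv contDiff_const α l 0
    refine ⟨|C|, fun j hj ξ hξ => ?_⟩
    have h0 := H.ne_zero hj hξ
    have h1 := hC _ 0 h0 (H.abs_inv_le hj hξ)
    simp only [iterate_zero, id_eq, mul_one] at h1
    change ‖iteratedDerivWithin α (fun ξ => (fun κ : ℝ => (κ : ℂ)⁻¹ ^ l) (freq j + ξ)) floquet ξ‖ ≤ _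
    rw [iteratedDerivWithin_floquet hξ (hs _ h0)]
    have e : (-((l : ℤ) + (0 : ℕ) - (0 : ℕ) + α)) = -((l + α : ℕ) : ℤ) := by push_cast; ring
    have e' : (-((l : ℤ) + α)) = -((l + α : ℕ) : ℤ) := by push_cast; ring
    rw [e] at h1
    rw [e']
    have h2 := H.zpow_le hj hξ (l + α)
    have h3 : 0 ≤ |freq j + ξ| ^ (-((l + α : ℕ) : ℤ)) := zpow_nonneg (abs_nonneg _) _
    calc _ ≤ C * |freq j + ξ| ^ (-((l + α : ℕ) : ℤ)) := h1
      _ ≤ |C| * |freq j + ξ| ^ (-((l + α : ℕ) : ℤ)) := by gcongr; exact le_abs_self C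
      _ ≤ _ := by gcongr

variable {Φ : ℝ × ℝ → ℂ}

/-- The family of functions `e^{2iπjx} Φ (1 / (2πj + ξ), x)`. -/
def modeFamily (Φ : ℝ × ℝ → ℂ) (j : ℤ) (ξ x : ℝ) : ℂ := mode j x * Φ ((freq j + ξ)⁻¹, x)

/-- The Taylor coefficients at `h = 0`. -/
def taylorCoeff (Φ : ℝ × ℝ → ℂ) (l : ℕ) (x : ℝ) : ℂ := derivFst^[l] Φ (0, x) / (l.factorial : ℂ)

lemma contDiffAt_inv_slice (hΦ : ContDiff ℝ ∞ Φ) {κ : ℝ} (hκ : κ ≠ 0) (x : ℝ) :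
    ContDiffAt ℝ ∞ (fun κ : ℝ => Φ (κ⁻¹, x)) κ :=
  (contDiff_slice' hΦ x).contDiffAt.comp κ (contDiffAt_inv ℝ hκ)

lemma isBlochFamily_modeFamily (H : IsLargeIndex j₀ δ) (hΦ : ContDiff ℝ ∞ Φ)
    (pΦ : ∀ h, Periodic (fun x => Φ (h, x)) 1)
    (cΦ : ∀ h, |h| ≤ δ → ∀ x, (starRingEnd ℂ) (Φ (h, x)) = Φ (-h, x)) :
    IsBlochFamily j₀ (modeFamily Φ) where
  smooth j hj := by
    rintro ⟨ξ, x⟩ ⟨hξ, -⟩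
    refine ContDiffAt.contDiffWithinAt ?_
    have h1 : ContDiffAt ℝ ∞ (fun q : ℝ × ℝ => (freq j + q.1)⁻¹) (ξ, x) :=
      (contDiffAt_const.add contDiffAt_fst).inv (H.ne_zero hj hξ)
    exact ((contDiff_mode j).contDiffAt.comp (ξ, x) contDiffAt_snd).mul
      (hΦ.contDiffAt.comp (ξ, x) (h1.prodMk contDiffAt_snd))
  periodic j hj ξ hξ x := by
    have := pΦ (freq j + ξ)⁻¹ x
    simp only at this
    unfold modeFamily
    rw [mode_periodic j x, this]
  conj j hj ξ hξ x := by
    unfold modeFamily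
    rw [map_mul, conj_mode, cΦ _ (H.abs_inv_le hj hξ), freq_neg, ← neg_add, inv_neg]
  matching j hj hj' m x := by
    have key : ∀ j : ℤ, (j₀ : ℤ) ≤ |j| → ∀ ξ ∈ floquet,
        iteratedDerivWithin m (fun ξ => modeFamily Φ j ξ x) floquet ξ =
          mode j x * iteratedDeriv m (fun κ => Φ (κ⁻¹, x)) (freq j + ξ) := by
      intro j hj ξ hξ
      have h1 := contDiffAt_inv_slice hΦ (H.ne_zero hj hξ) x
      have h2 := iteratedDerivWithin_floquet (G := fun κ => mode j x * Φ (κ⁻¹, x)) hξ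
        (contDiffAt_const.mul h1) m
      rw [iteratedDeriv_const_mul_field] at h2
      exact h2
    rw [key j hj _ pi_mem_floquet, key (j + 1) hj' _ neg_pi_mem_floquet, freq_add_pi,
      add_comm j 1, mode_add, ← mul_assoc]
    congr 2
    unfold mode; congr 1; push_cast; ring

lemma remainder_modeFamily (h0 : ∀ x, Φ (0, x) = 1) (M : ℕ) (j : ℤ) (ξ : ℝ) :
    remainder (modeFamily Φ) expCoeff (taylorCoeff Φ) M j ξ =
      fun x => mode j x * taylorRem M Φ ((freq j + ξ)⁻¹, x) := by
  ext x
  unfold remainder modeFamily taylorRem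
  have e : Finset.range (M + 1) = insert 0 (Finset.Icc 1 M) := by
    ext l; simp only [Finset.mem_range, Finset.mem_insert, Finset.mem_Icc]; omega
  rw [e, Finset.sum_insert (by simp)]
  simp only [iterate_zero, id_eq, h0, pow_zero, one_smul, Nat.factorial_zero, Nat.cast_one, div_one]
  have e2 : ∀ l, expCoeff l j ξ * taylorCoeff Φ l x =
      ((freq j + ξ)⁻¹) ^ l • (derivFst^[l] Φ (0, x) / (l.factorial : ℂ)) := fun l => by
    rw [Complex.real_smul]; unfold expCoeff taylorCoeff; push_cast; rfl
  simp only [e2]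
  rw [mul_sub]
  rfl

/-- The remainder is the mode times the Taylor remainder at `h = 1/κ`. Derivatives in `x` cost a
factor `|j|` when they fall on the mode and nothing otherwise; derivatives in `ξ` miss the mode and
each gain `1/|κ|`. -/
lemma remainderBounds_modeFamily (H : IsLargeIndex j₀ δ) (hΦ : ContDiff ℝ ∞ Φ)
    (pΦ : ∀ h, Periodic (fun x => Φ (h, x)) 1) (h0 : ∀ x, Φ (0, x) = 1) (M N : ℕ) :
    RemainderBounds j₀ (modeFamily Φ) expCoeff (taylorCoeff Φ) M N := by
  intro α β _ _
  set ρ := taylorRem M Φ with hρ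
  have sρ : ContDiff ℝ ∞ ρ := contDiff_taylorRem hΦ M
  have sρi := fun i => contDiff_derivSnd_iterate sρ i
  choose C hC using fun i => (isFlat_taylorRem hΦ pΦ M i δ).iteratedDeriv_inv (sρi i) α 0 0
  simp only [pow_zero, one_mul, iterate_zero, id_eq] at hC
  have hle : ∀ j : ℕ, (j : WithTop ℕ∞) ≤ ∞ := fun j => by exact_mod_cast le_top
  refine ⟨∑ i ∈ Finset.range (β + 1), (β.choose i : ℝ) * 7 ^ β * 2 ^ β * |C (β - i)|,
    fun j hj ξ hξ x => ?_⟩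
  have hκ := H.ne_zero hj hξ
  have hj1 := H.one_le_abs hj
  have e1 : (fun ζ => iteratedDeriv β (remainder (modeFamily Φ) expCoeff (taylorCoeff Φ) M j ζ) x) =
      fun ζ => (fun κ : ℝ => ∑ i ∈ Finset.range (β + 1),
        ((β.choose i : ℂ) * ((Complex.I * freq j) ^ i * mode j x)) *
          derivSnd^[β - i] ρ (κ⁻¹, x)) (freq j + ζ) := by
    ext ζ
    rw [remainder_modeFamily h0, iteratedDeriv_fun_mul ((contDiff_mode j).contDiffAt.of_le (hle β))
      ((contDiff_slice sρ _).contDiffAt.of_le (hle β))]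
    refine Finset.sum_congr rfl fun i _ => ?_
    rw [iteratedDeriv_mode, iteratedDeriv_snd]
  have hs : ∀ i, ContDiffAt ℝ ∞ (fun κ : ℝ => derivSnd^[i] ρ (κ⁻¹, x)) (freq j + ξ) := fun i =>
    contDiffAt_inv_slice (sρi i) hκ x
  have hs' : ∀ i ∈ Finset.range (β + 1), ContDiffAt ℝ ∞ (fun κ : ℝ =>
      ((β.choose i : ℂ) * ((Complex.I * freq j) ^ i * mode j x)) *
          derivSnd^[β - i] ρ (κ⁻¹, x)) (freq j + ξ) := fun i _ => contDiffAt_const.mul (hs _)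
  rw [e1, iteratedDerivWithin_floquet hξ (ContDiffAt.sum hs'),
    iteratedDeriv_fun_sum fun i hi => (hs' i hi).of_le (hle α), Finset.sum_mul]
  refine (norm_sum_le _ _).trans (Finset.sum_le_sum fun i hi => ?_)
  rw [iteratedDeriv_const_mul_field, norm_mul, norm_mul, norm_mul, norm_mode, mul_one, norm_pow,
    norm_mul, Complex.norm_I, one_mul, Complex.norm_real, Complex.norm_natCast, Real.norm_eq_abs]
  have h1 := hC (β - i) _ x hκ (H.abs_inv_le hj hξ)
  have e : (-(((0 : ℕ) : ℤ) + (M + 1) - (0 : ℕ) + α)) = -((M + 1 + α : ℕ) : ℤ) := by push_cast; ring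
  rw [e] at h1
  have h2 := H.zpow_le hj hξ (M + 1 + α)
  have h3 : 0 ≤ |freq j + ξ| ^ (-((M + 1 + α : ℕ) : ℤ)) := zpow_nonneg (abs_nonneg _) _
  have h4 : |freq j| ^ i ≤ 7 ^ β * 2 ^ β * |(j : ℝ)| ^ β := by
    have hiβ : i ≤ β := by simpa [Nat.lt_succ_iff] using hi
    have h5 : |freq j| ≤ 7 * 2 * |(j : ℝ)| := by
      refine (abs_freq_le_wt j).trans ?_
      unfold wt; linarith
    calc |freq j| ^ i ≤ (7 * 2 * |(j : ℝ)|) ^ i := by gcongr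
      _ ≤ (7 * 2 * |(j : ℝ)|) ^ β := pow_le_pow_right₀ (by linarith) hiβ
      _ = _ := by rw [mul_pow, mul_pow]
  have e3 : |(j : ℝ)| ^ (-((M : ℤ) + 1 + α - β)) = |(j : ℝ)| ^ β * |(j : ℝ)| ^ (-((M + 1 + α : ℕ) : ℤ)) := by
    rw [← zpow_natCast, ← zpow_add₀ (by linarith)]; congr 1; push_cast; ring
  rw [e3]
  calc _ ≤ (β.choose i : ℝ) * (7 ^ β * 2 ^ β * |(j : ℝ)| ^ β) *
        (|C (β - i)| * |(j : ℝ)| ^ (-((M + 1 + α : ℕ) : ℤ))) := by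
        gcongr
        refine h1.trans ?_
        calc _ ≤ |C (β - i)| * |freq j + ξ| ^ (-((M + 1 + α : ℕ) : ℤ)) := by
              gcongr; exact le_abs_self _
          _ ≤ _ := by gcongr
    _ = _ := by ring

end families

/-! ### Smoothness of the wave profile. -/

section wave

variable {f u : ℝ → ℝ} {c k : ℝ}

/-- The profile equation `-c u' + (u'' + f(u))' = 0`, read at time 0, is integrated once. The result
expresses `u''` through `u` and allows a bootstrap of regularity. -/
lemma IsPeriodicWave.exists_second_deriv (hf : ContDiff ℝ ∞ f) (hu : IsPeriodicWave f u c k) :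
    ∃ K : ℝ, ∀ x, deriv (deriv u) x = K + c * u x - f (u x) := by
  have u3 := hu.regular
  have u1 : Differentiable ℝ u := u3.differentiable (by norm_num)
  have e2 : iteratedDeriv 2 u = deriv (deriv u) := by rw [iteratedDeriv_succ, iteratedDeriv_one]
  have d2 : Differentiable ℝ (deriv (deriv u)) :=
    (ContDiff.deriv' (n := 1) (ContDiff.deriv' (n := 2) (by norm_num; exact u3))).differentiable
      (by norm_num)
  have df : Differentiable ℝ fun y => f (u y) := (hf.differentiable (by simp)).comp u1
  have key : ∀ x, deriv (fun y => deriv (deriv u) y + f (u y)) x = c * deriv u x := by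
    intro x
    have h := hu.solution 0 x
    have e : deriv (fun s => u (x - c * s)) 0 = -c * deriv u x := by
      have h1 : HasDerivAt (fun s : ℝ => x - c * s) (-c) 0 := by
        simpa using ((hasDerivAt_id (0 : ℝ)).const_mul c).const_sub x
      have h2 : HasDerivAt u (deriv u x) (x - c * 0) := by
        simpa using (u1 x).hasDerivAt
      exact (h2.comp 0 h1).deriv.trans (by ring)
    simp only [e, mul_zero, sub_zero, e2] at h
    linarith
  have hd : Differentiable ℝ fun y => deriv (deriv u) y + f (u y) - c * u y :=
    (d2.fun_add df).fun_sub (u1.const_mul c)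
  have hz : ∀ x, deriv (fun y => deriv (deriv u) y + f (u y) - c * u y) x = 0 := fun x => by
    rw [deriv_fun_sub ((d2 x).fun_add (df x)) ((u1 x).const_mul c), key x,
      deriv_const_mul_field, sub_self]
  refine ⟨deriv (deriv u) 0 + f (u 0) - c * u 0, fun x => ?_⟩
  have := is_const_of_deriv_eq_zero hd hz x 0
  linarith

/-- The profiles of travelling waves are smooth. -/
lemma IsPeriodicWave.contDiff (hf : ContDiff ℝ ∞ f) (hu : IsPeriodicWave f u c k) :
    ContDiff ℝ ∞ u := by
  obtain ⟨K, hK⟩ := hu.exists_second_deriv hf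
  have key : ∀ n : ℕ, ContDiff ℝ ((n + 2 : ℕ) : WithTop ℕ∞) u := by
    intro n
    induction n with
    | zero => exact hu.regular.of_le (by norm_num)
    | succ n ih =>
      have u1 : ContDiff ℝ ((n + 1 : ℕ) : WithTop ℕ∞) u := ih.of_le (by exact_mod_cast Nat.le_succ _)
      have h1 : ContDiff ℝ ((n + 1 : ℕ) : WithTop ℕ∞) (deriv (deriv u)) := by
        rw [funext hK]
        exact (contDiff_const.add (contDiff_const.mul u1)).sub
          ((contDiff_infty.mp hf (n + 1)).comp u1)
      have h2 : ContDiff ℝ ((n + 1 : ℕ) : WithTop ℕ∞) (deriv u) := ContDiff.deriv' (by exact_mod_cast ih)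
      have h3 : ContDiff ℝ (((n + 1 : ℕ) : WithTop ℕ∞) + 1) (deriv u) :=
        contDiff_succ_iff_deriv.mpr ⟨h2.differentiable (by simp), by simp, h1⟩
      have h4 : ContDiff ℝ (((n + 2 : ℕ) : WithTop ℕ∞) + 1) u :=
        contDiff_succ_iff_deriv.mpr ⟨ih.differentiable (by simp), by simp, by exact_mod_cast h3⟩
      exact_mod_cast h4
  exact contDiff_infty.mpr fun n => (key n).of_le (by exact_mod_cast Nat.le_add_right n 2)

lemma IsPeriodicWave.contDiff_potential (hf : ContDiff ℝ ∞ f) (hu : IsPeriodicWave f u c k) :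
    ContDiff ℝ ∞ fun y => deriv f (scaledProfile u k y) - c := by
  have h1 : ContDiff ℝ ∞ (scaledProfile u k) := (hu.contDiff hf).comp (contDiff_id.div_const k)
  have h2 : ContDiff ℝ ∞ (deriv f) := ContDiff.deriv' (by simpa using hf)
  exact (h2.comp h1).sub contDiff_const

lemma IsPeriodicWave.potential_periodic (hu : IsPeriodicWave f u c k) :
    Periodic (fun y => deriv f (scaledProfile u k y) - c) 1 := fun x => by
  have : scaledProfile u k (x + 1) = scaledProfile u k x := by
    unfold scaledProfile
    rw [add_div, hu.periodic]
  simp only [this]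

end wave

/-! ### The branches of eigenvalues: symmetry, separation, exhaustion and simplicity. -/

/-- The branch of eigenvalues of index `j`. -/
def eigenBranch (k : ℝ) (n : ℝ → ℂ) (j : ℤ) (ξ : ℝ) : ℂ :=
  eigenvalue k (freq j + ξ) (n (freq j + ξ)⁻¹)

section branches

variable {k : ℝ} {A : ℝ → ℝ} {N h₁ δ : ℝ} {n : ℝ → ℂ} {P Φ Ψ : ℝ × ℝ → ℂ} {j₀ : ℕ} {j : ℤ} {ξ : ℝ}

lemma contDiffAt_eigenvalue (hn : ContDiff ℝ ∞ n) {κ : ℝ} (hκ : κ ≠ 0) :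
    ContDiffAt ℝ ∞ (fun κ : ℝ => eigenvalue k κ (n κ⁻¹)) κ := by
  unfold eigenvalue
  have h1 : ContDiffAt ℝ ∞ (fun κ : ℝ => (κ : ℂ)) κ := Complex.ofRealCLM.contDiff.contDiffAt
  exact (contDiffAt_const.mul (h1.pow 3)).add
    (h1.mul (hn.contDiffAt.comp κ (contDiffAt_inv ℝ hκ)))

lemma mul_inv_index (H : IsLargeIndex j₀ δ) (hj : (j₀ : ℤ) ≤ |j|) (hξ : ξ ∈ floquet) :
    (freq j + ξ) * (freq j + ξ)⁻¹ = 1 := mul_inv_cancel₀ (H.ne_zero hj hξ)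

lemma eigenBranch_smooth (H : IsLargeIndex j₀ δ) (hn : ContDiff ℝ ∞ n) (hj : (j₀ : ℤ) ≤ |j|) :
    ContDiffOn ℝ ∞ (eigenBranch k n j) floquet := fun ξ hξ =>
  ((contDiffAt_eigenvalue (k := k) hn (H.ne_zero hj hξ)).comp ξ
    (contDiffAt_const.add contDiffAt_id)).contDiffWithinAt

lemma eigenBranch_matching (H : IsLargeIndex j₀ δ) (hn : ContDiff ℝ ∞ n) (hj : (j₀ : ℤ) ≤ |j|)
    (hj' : (j₀ : ℤ) ≤ |j + 1|) (m : ℕ) :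
    iteratedDerivWithin m (eigenBranch k n j) floquet Real.pi
      = iteratedDerivWithin m (eigenBranch k n (j + 1)) floquet (-Real.pi) := by
  have key : ∀ j : ℤ, (j₀ : ℤ) ≤ |j| → ∀ ξ ∈ floquet,
      iteratedDerivWithin m (eigenBranch k n j) floquet ξ =
        iteratedDeriv m (fun κ : ℝ => eigenvalue k κ (n κ⁻¹)) (freq j + ξ) := fun j hj ξ hξ =>
    iteratedDerivWithin_floquet hξ (contDiffAt_eigenvalue hn (H.ne_zero hj hξ)) m
  rw [key j hj _ pi_mem_floquet, key (j + 1) hj' _ neg_pi_mem_floquet, freq_add_pi]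

lemma norm_eigenBranch_sub_le (H : IsLargeIndex j₀ δ) (hδ : δ ≤ h₁) (hP : IsProfile k A N h₁ n P)
    (hj : (j₀ : ℤ) ≤ |j|) (hξ : ξ ∈ floquet) :
    ‖eigenBranch k n j ξ - Complex.I * k ^ 3 * ((freq j + ξ : ℝ) : ℂ) ^ 3‖ ≤ |freq j + ξ| * N := by
  unfold eigenBranch eigenvalue
  rw [add_sub_cancel_left, norm_mul, Complex.norm_real, Real.norm_eq_abs]
  gcongr
  exact hP.n_le _ ((H.abs_inv_le hj hξ).trans hδ)

lemma eigenBranch_re (H : IsLargeIndex j₀ δ) (hQ : IsNormalizedPair k A δ n Φ Ψ)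
    (hj : (j₀ : ℤ) ≤ |j|) (hξ : ξ ∈ floquet) : (eigenBranch k n j ξ).re = 0 :=
  hQ.re_eq _ _ (H.abs_inv_le hj hξ) (mul_inv_index H hj hξ)

/-- Changing `(j, ξ)` into its opposite conjugates the eigenvalue, and conjugation of an imaginary
number is a change of sign. -/
lemma eigenBranch_symm (H : IsLargeIndex j₀ δ) (hδ : δ ≤ h₁) (hP : IsProfile k A N h₁ n P)
    (hQ : IsNormalizedPair k A δ n Φ Ψ) (hj : (j₀ : ℤ) ≤ |j|) (hξ : ξ ∈ floquet) :
    eigenBranch k n j ξ = -eigenBranch k n (-j) (-ξ) := by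
  have h1 : eigenBranch k n (-j) (-ξ) = (starRingEnd ℂ) (eigenBranch k n j ξ) := by
    unfold eigenBranch eigenvalue
    rw [freq_neg, ← neg_add, inv_neg, hP.conj_n _ ((H.abs_inv_le hj hξ).trans hδ)]
    simp only [map_add, map_mul, map_pow, Complex.conj_I, Complex.conj_ofReal]
    push_cast; ring
  have h2 := eigenBranch_re H hQ hj hξ
  rw [h1]
  apply Complex.ext <;> simp [h2]

/-- Exponents of different indices differ by at least `2π`, so their cubes differ by at least `3 (κ²
+ τ²)`, whereas equality of the eigenvalues would bound `k³` times this difference by `(|κ| + |τ|)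
N`, which `hj₀` makes at most `k³ (κ² + τ²)`. -/
lemma eigenBranch_injective (H : IsLargeIndex j₀ δ) (hδ : δ ≤ h₁) (hP : IsProfile k A N h₁ n P)
    (hN : 0 < N) (hk : 0 < k) (hj₀ : N ≤ k ^ 3 * j₀) {l : ℤ} (hj : (j₀ : ℤ) ≤ |j|)
    (hl : (j₀ : ℤ) ≤ |l|) (hξ : ξ ∈ floquet) (h : eigenBranch k n j ξ = eigenBranch k n l ξ) :
    j = l := by
  by_contra hne
  set κ := freq j + ξ with hκ
  set τ := freq l + ξ with hτ
  have h1 := norm_eigenBranch_sub_le H hδ hP hj hξ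
  have h2 := norm_eigenBranch_sub_le H hδ hP hl hξ
  rw [← hκ] at h1
  rw [← hτ, ← h] at h2
  have h3 : k ^ 3 * |κ ^ 3 - τ ^ 3| ≤ (|κ| + |τ|) * N := by
    have e : k ^ 3 * |κ ^ 3 - τ ^ 3| = ‖(eigenBranch k n j ξ - Complex.I * k ^ 3 * (τ : ℂ) ^ 3) -
        (eigenBranch k n j ξ - Complex.I * k ^ 3 * (κ : ℂ) ^ 3)‖ := by
      have : (eigenBranch k n j ξ - Complex.I * k ^ 3 * (τ : ℂ) ^ 3) -
        (eigenBranch k n j ξ - Complex.I * k ^ 3 * (κ : ℂ) ^ 3) =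
          Complex.I * ((k ^ 3 * (κ ^ 3 - τ ^ 3) : ℝ) : ℂ) := by push_cast; ring
      rw [this, norm_mul, Complex.norm_I, one_mul, Complex.norm_real, Real.norm_eq_abs, abs_mul,
        abs_of_pos (pow_pos hk 3)]
    rw [e]
    exact (norm_sub_le _ _).trans (by linarith)
  have h4 : 6 ≤ |κ - τ| := by
    have e : κ - τ = 2 * Real.pi * ((j - l : ℤ) : ℝ) := by
      rw [hκ, hτ]; unfold freq; push_cast; ring
    have h5 : (1 : ℝ) ≤ |((j - l : ℤ) : ℝ)| := by
      have : (1 : ℤ) ≤ |j - l| := Int.one_le_abs (sub_ne_zero.mpr hne)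
      exact_mod_cast this
    rw [e, abs_mul, abs_of_pos Real.two_pi_pos]
    nlinarith [Real.pi_gt_three]
  have h5 : 3 * (κ ^ 2 + τ ^ 2) ≤ |κ ^ 3 - τ ^ 3| := by
    have e : κ ^ 3 - τ ^ 3 = (κ - τ) * (κ ^ 2 + κ * τ + τ ^ 2) := by ring
    have h6 : (κ ^ 2 + τ ^ 2) / 2 ≤ κ ^ 2 + κ * τ + τ ^ 2 := by nlinarith [sq_nonneg (κ + τ)]
    have h7 : 0 ≤ (κ ^ 2 + τ ^ 2) / 2 := by positivity
    rw [e, abs_mul, abs_of_nonneg (h7.trans h6)]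
    calc 3 * (κ ^ 2 + τ ^ 2) = 6 * ((κ ^ 2 + τ ^ 2) / 2) := by ring
      _ ≤ _ := mul_le_mul h4 h6 h7 (abs_nonneg _)
  have key : ∀ l : ℤ, (j₀ : ℤ) ≤ |l| → 0 < |freq l + ξ| ∧
      |freq l + ξ| * N ≤ k ^ 3 * (freq l + ξ) ^ 2 := by
    intro l hl
    have h6 := H.three_mul_le hl hξ
    have h7 : (j₀ : ℝ) ≤ |(l : ℝ)| := by exact_mod_cast hl
    have h8 := H.one_le_abs hl
    refine ⟨by linarith, ?_⟩
    have h9 : N ≤ k ^ 3 * |freq l + ξ| := hj₀.trans (by gcongr; linarith)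
    calc |freq l + ξ| * N ≤ |freq l + ξ| * (k ^ 3 * |freq l + ξ|) := by gcongr
      _ = k ^ 3 * |freq l + ξ| ^ 2 := by ring
      _ = _ := by rw [sq_abs]
  obtain ⟨p1, q1⟩ := key j hj
  obtain ⟨p2, q2⟩ := key l hl
  rw [← hκ] at p1 q1
  rw [← hτ] at p2 q2
  have h6 : k ^ 3 * (3 * (κ ^ 2 + τ ^ 2)) ≤ k ^ 3 * |κ ^ 3 - τ ^ 3| := by gcongr
  have h7 : 0 < |κ| * N := mul_pos p1 hN
  have h8 : 0 < |τ| * N := mul_pos p2 hN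
  nlinarith

lemma norm_asymptotics_le (H : IsLargeIndex j₀ δ) (hδ : δ ≤ h₁) (hP : IsProfile k A N h₁ n P)
    (hN : 0 < N) (hj : (j₀ : ℤ) ≤ |j|) (hξ : ξ ∈ floquet) :
    ‖eigenBranch k n j ξ - Complex.I * k ^ 3 * (2 * Real.pi * j + ξ) ^ 3‖ ≤
      10 * N * |(j : ℝ)| := by
  have h1 := norm_eigenBranch_sub_le H hδ hP hj hξ
  have h2 := H.le_mul hj hξ
  have e : (2 * Real.pi * j + ξ : ℂ) = ((freq j + ξ : ℝ) : ℂ) := by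
    unfold freq; push_cast; ring
  rw [e]
  refine h1.trans ?_
  nlinarith

/-- The eigenvalues of large modulus belong to the branches. -/
lemma eq_eigenBranch_of_not_uniquelySolvable (hk : 0 < k) {S : ℝ}
    (hS : S = ∑' l, ‖fc (fun x => (A x : ℂ)) l‖) (ha : RapidSeq (fc fun x => (A x : ℂ)))
    (H : IsLargeIndex j₀ δ) (hδ : δ ≤ h₁) (hP : IsProfile k A (2 * (2 * k * S + 1)) h₁ n P)
    (hξ : ξ ∈ floquet) {μ : ℂ} (hμ : ¬ UniquelySolvable k (fc fun x => (A x : ℂ)) ξ μ)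
    (hR : k ^ 3 * (7 * j₀ + 4) ^ 3 + (2 * k * S + 1) * (1 + (7 * j₀ + 4)) < ‖μ‖) :
    ∃ j : ℤ, (j₀ : ℤ) ≤ |j| ∧ μ = eigenBranch k n j ξ := by
  have hS0 : 0 ≤ S := hS ▸ tsum_nonneg fun _ => norm_nonneg _
  have hB : 0 ≤ 2 * k * S := by positivity
  -- Otherwise `μ` is far from all unperturbed eigenvalues and in the resolvent set.
  obtain ⟨m, hm⟩ : ∃ m, ‖μ - Complex.I * k ^ 3 * (freq m + ξ) ^ 3‖ <
      (2 * k * S + 1) * (1 + |freq m + ξ|) := by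
    by_contra! hc
    exact hμ (uniquelySolvable_far hk ha (hS ▸ hc))
  have hcast : ((freq m : ℂ) + ξ) = ((freq m + ξ : ℝ) : ℂ) := by push_cast; rfl
  rw [hcast] at hm
  -- A small index would give `|2πm + ξ| ≤ 7 j₀ + 4` and confine `μ` to the ball excluded by `hR`.
  have hj : (j₀ : ℤ) ≤ |m| := by
    by_contra! hc
    have h1 : |(m : ℝ)| ≤ j₀ := by exact_mod_cast hc.le
    have h2 : |freq m + ξ| ≤ 7 * j₀ + 4 := by
      have h3 : |ξ| ≤ Real.pi := abs_le.mpr hξ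
      have h4 : |freq m| = 2 * Real.pi * |(m : ℝ)| := by
        unfold freq; rw [abs_mul, abs_of_pos Real.two_pi_pos]
      have h5 := abs_add_le (freq m) ξ
      nlinarith [Real.pi_lt_d2, abs_nonneg (m : ℝ), Real.pi_pos]
    have h6 : ‖μ‖ ≤ ‖Complex.I * k ^ 3 * ((freq m + ξ : ℝ) : ℂ) ^ 3‖ +
        (2 * k * S + 1) * (1 + |freq m + ξ|) := by
      have := norm_add_le (Complex.I * k ^ 3 * ((freq m + ξ : ℝ) : ℂ) ^ 3)
        (μ - Complex.I * k ^ 3 * ((freq m + ξ : ℝ) : ℂ) ^ 3)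
      rw [add_sub_cancel] at this
      linarith
    rw [norm_mul, norm_mul, Complex.norm_I, one_mul, norm_pow, norm_pow, Complex.norm_real,
      Complex.norm_real, Real.norm_eq_abs, Real.norm_eq_abs, abs_of_pos hk] at h6
    have h7 : k ^ 3 * |freq m + ξ| ^ 3 ≤ k ^ 3 * (7 * j₀ + 4) ^ 3 := by gcongr
    have h8 : (2 * k * S + 1) * (1 + |freq m + ξ|) ≤ (2 * k * S + 1) * (1 + (7 * j₀ + 4)) := by
      gcongr
    linarith
  refine ⟨m, hj, ?_⟩
  have hκ := H.ne_zero hj hξ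
  have hκ' : ((freq m + ξ : ℝ) : ℂ) ≠ 0 := by exact_mod_cast hκ
  have hh := (H.abs_inv_le hj hξ).trans hδ
  set κ := freq m + ξ with hκe
  set ν : ℂ := (μ - Complex.I * k ^ 3 * (κ : ℂ) ^ 3) / κ with hν
  have e : eigenvalue k κ ν = μ := by
    unfold eigenvalue
    rw [hν, mul_div_cancel₀ _ hκ']; ring
  -- Since `1 + |κ| ≤ 2 |κ|`, the region not covered by the far estimate lies in the one covered by
  -- `IsProfile.unique`; this explains the choice `N = 2 (2 k S + 1)`.
  have hνN : ‖ν‖ ≤ 2 * (2 * k * S + 1) := by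
    have h1 : 3 ≤ |κ| := by linarith [H.three_mul_le hj hξ, H.one_le_abs hj]
    rw [hν, norm_div, Complex.norm_real, Real.norm_eq_abs, div_le_iff₀ (by linarith)]
    refine hm.le.trans ?_
    nlinarith
  by_contra hne
  refine hμ (UniquelySolvable.of_shift (j := m) ?_)
  rw [← hκe, ← e]
  refine hP.unique κ κ⁻¹ hh (mul_inv_cancel₀ hκ) ν hνN fun hc => hne ?_
  unfold eigenBranch
  rw [← hκe, ← hc, e]

lemma eigenBranch_simple (hA : ContDiff ℝ ∞ A) (pA : Periodic A 1) (H : IsLargeIndex j₀ δ)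
    (hδ : δ ≤ h₁) (hP : IsProfile k A N h₁ n P) (hj : (j₀ : ℤ) ≤ |j|) (hξ : ξ ∈ floquet) :
    ∃ p : ℝ → ℂ, MemH3per p ∧ p ≠ 0 ∧
      (blochOp k A ξ p =ᵐ[volume] fun x => eigenBranch k n j ξ * p x) ∧
      (∀ w : ℝ → ℂ, MemH3per w → (blochOp k A ξ w =ᵐ[volume] fun x => eigenBranch k n j ξ * w x) →
        ∃ z : ℂ, ∀ x, w x = z * p x) ∧
      ¬ ∃ w : ℝ → ℂ, MemH3per w ∧
        (fun x => blochOp k A ξ w x - eigenBranch k n j ξ * w x) =ᵐ[volume] p := by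
  have hh := (H.abs_inv_le hj hξ).trans hδ
  have hκ := mul_inv_index H hj hξ
  set h := (freq j + ξ)⁻¹ with hdef
  have sP := contDiff_slice hP.smooth h
  have pP := hP.periodic h
  have hs : ContDiff ℝ ∞ fun x => mode j x * P (h, x) := (contDiff_mode j).mul sP
  have hp : Periodic (fun x => mode j x * P (h, x)) 1 := fun x => by
    have := pP x
    simp only at this
    simp only [mode_periodic j x, this]
  refine ⟨fun x => mode j x * P (h, x), memH3per_of_contDiff (contDiff_infty.mp hs 3) hp, ?_, ?_, ?_, ?_⟩
  · intro h0
    have h1 : (fun x => P (h, x)) = fun _ => 0 := by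
      ext x
      have h2 := congrFun h0 x
      have h3 : mode j x ≠ 0 := by rw [← norm_ne_zero_iff, norm_mode]; exact one_ne_zero
      exact (mul_eq_zero.mp h2).resolve_left h3
    have h2 := hP.fc_zero h hh
    rw [h1] at h2
    simp [fc] at h2
  · refine Filter.Eventually.of_forall fun x => ?_
    rw [blochOp_mode_mul hA sP]
    simp only
    rw [hP.eigen _ _ hh hκ]
    unfold eigenBranch
    ring
  · intro w hw he
    exact eq_const_mul_of_kernel hA pA rfl sP.continuous pP (hP.kernel _ _ hh hκ) hw he
  · exact not_range_of_resSeq hA pA rfl sP.continuous pP (hP.not_range _ _ hh hκ)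

lemma innerPer_mode_mul (j : ℤ) (g h : ℝ → ℂ) :
    innerPer (fun x => mode j x * g x) (fun x => mode j x * h x) = innerPer g h := by
  unfold innerPer
  congr 1; ext x
  have : (starRingEnd ℂ) (mode j x) * mode j x = 1 := by
    rw [Complex.conj_mul', norm_mode]; norm_num
  rw [map_mul]
  linear_combination (starRingEnd ℂ) (g x) * h x * this

lemma normPer_mode_mul (j : ℤ) (g : ℝ → ℂ) : normPer (fun x => mode j x * g x) = normPer g := by
  rw [normPer_eq, normPer_eq, innerPer_mode_mul]

end branches

/-! ### Assembly of the eigenvalues, eigenfunctions and expansions. -/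

section operator

variable {f u : ℝ → ℝ} {c k : ℝ} {N h₁ δ : ℝ} {n : ℝ → ℂ} {P Φ Ψ : ℝ × ℝ → ℂ} {j₀ : ℕ}

lemma isLargeEigenvalues_eigenBranch (hf : ContDiff ℝ ∞ f) (hu : IsPeriodicWave f u c k)
    {A : ℝ → ℝ} (hAe : A = fun y => deriv f (scaledProfile u k y) - c) {S : ℝ}
    (hS : S = ∑' l, ‖fc (fun x => (A x : ℂ)) l‖)
    (H : IsLargeIndex j₀ δ) (hδ : δ ≤ h₁) (hP : IsProfile k A (2 * (2 * k * S + 1)) h₁ n P)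
    (hQ : IsNormalizedPair k A δ n Φ Ψ) (hj₀ : 2 * (2 * k * S + 1) ≤ k ^ 3 * j₀) :
    IsLargeEigenvalues f u c k j₀ (eigenBranch k n) := by
  have hA : ContDiff ℝ ∞ A := hAe ▸ hu.contDiff_potential hf
  have pA : Periodic A 1 := hAe ▸ hu.potential_periodic
  have hk := hu.k_pos
  have hS0 : 0 ≤ S := hS ▸ tsum_nonneg fun _ => norm_nonneg _
  have hN : 0 < 2 * (2 * k * S + 1) := by positivity
  have hB : blochSymbol f u c k = blochOp k A := by rw [blochSymbol_eq_blochOp, hAe]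
  refine ⟨fun j hj => eigenBranch_smooth H hP.smooth_n hj, fun j hj ξ hξ => eigenBranch_re H hQ hj hξ,
    fun j hj ξ hξ => ?_, fun j l hj hl ξ hξ h => eigenBranch_injective H hδ hP hN hk hj₀ hj hl hξ h,
    ⟨k ^ 3 * (7 * j₀ + 4) ^ 3 + (2 * k * S + 1) * (1 + (7 * j₀ + 4)), fun ξ hξ μ hμ hR => ?_⟩,
    ⟨_, fun j hj ξ hξ => norm_asymptotics_le H hδ hP hN hj hξ⟩,
    fun j hj ξ hξ => eigenBranch_symm H hδ hP hQ hj hξ,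
    fun j hj hj' m => eigenBranch_matching H hP.smooth_n hj hj' m⟩
  · unfold IsSimpleEigenvalue
    rw [hB]
    exact eigenBranch_simple hA pA H hδ hP hj hξ
  · have ha : RapidSeq (fc fun x => (A x : ℂ)) :=
      rapidSeq_fc (ofReal_contDiff hA) fun x => by simp only [pA x]
    refine eq_eigenBranch_of_not_uniquelySolvable hk hS ha H hδ hP hξ (fun hc => hμ fun g hg => ?_) hR
    rw [hB]
    exact existsUnique_of_uniquelySolvable hk hA pA hc hg

lemma isEigenfunctionPair_modeFamily (hf : ContDiff ℝ ∞ f) (hu : IsPeriodicWave f u c k)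
    {A : ℝ → ℝ} (hAe : A = fun y => deriv f (scaledProfile u k y) - c)
    (H : IsLargeIndex j₀ δ) (hQ : IsNormalizedPair k A δ n Φ Ψ) :
    IsEigenfunctionPair f u c k j₀ (eigenBranch k n) (modeFamily Φ) (modeFamily Ψ) := by
  have hA : ContDiff ℝ ∞ A := hAe ▸ hu.contDiff_potential hf
  have pA : Periodic A 1 := hAe ▸ hu.potential_periodic
  have hB : blochSymbol f u c k = blochOp k A := by rw [blochSymbol_eq_blochOp, hAe]
  refine ⟨isBlochFamily_modeFamily H hQ.smooth hQ.periodic hQ.conj,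
    isBlochFamily_modeFamily H hQ.smooth' hQ.periodic' hQ.conj', fun j hj ξ hξ x => ?_,
    fun j hj ξ hξ w hw => ?_, fun j hj ξ hξ => ?_, fun j hj ξ hξ => ?_⟩
  · have h := congrFun (blochOp_mode_mul (k := k) hA (contDiff_slice hQ.smooth (freq j + ξ)⁻¹) j ξ) x
    rw [hQ.eigen _ _ (H.abs_inv_le hj hξ) (mul_inv_index H hj hξ)] at h
    rw [hB]
    refine Eq.trans h ?_
    unfold eigenBranch modeFamily
    ring
  · rw [hB]
    exact innerPer_blochOp_of_dual hA pA rfl (contDiff_slice hQ.smooth' (freq j + ξ)⁻¹)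
      (hQ.periodic' _) (hQ.dual _ _ (H.abs_inv_le hj hξ) (mul_inv_index H hj hξ)) hw
  · exact (normPer_mode_mul j _).trans
      ((hQ.norm_eq _ (H.abs_inv_le hj hξ)).trans (normPer_mode_mul j _).symm)
  · exact (innerPer_mode_mul j _ _).trans (hQ.pairing _ (H.abs_inv_le hj hξ))

lemma taylorCoeff_smooth (hΦ : ContDiff ℝ ∞ Φ) (l : ℕ) : ContDiff ℝ ∞ (taylorCoeff Φ l) :=
  ((contDiff_derivFst_iterate hΦ l).comp (contDiff_const.prodMk contDiff_id)).div_const _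

lemma taylorCoeff_periodic (pΦ : ∀ h, Periodic (fun x => Φ (h, x)) 1) (l : ℕ) :
    Periodic (taylorCoeff Φ l) 1 := fun x => by
  have h := derivFst_periodic pΦ l 0 x
  simp only at h
  unfold taylorCoeff
  rw [h]

lemma exists_isLargeIndex (hδ : 0 < δ) (hk : 0 < k) (N : ℝ) :
    ∃ j₀ : ℕ, IsLargeIndex j₀ δ ∧ N ≤ k ^ 3 * j₀ := by
  obtain ⟨a, ha⟩ := exists_nat_ge (1 / δ)
  obtain ⟨b, hb⟩ := exists_nat_ge (N / k ^ 3)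
  rw [div_le_iff₀' hδ] at ha
  rw [div_le_iff₀' (pow_pos hk 3)] at hb
  refine ⟨a + b + 1, ⟨by omega, ha.trans ?_⟩, hb.trans ?_⟩
  · gcongr; omega
  · gcongr; omega

end operator

end GKdV

end

theorem proposition3 (f : ℝ → ℝ) (hf : ContDiff ℝ ∞ f) (u : ℝ → ℝ) (c k : ℝ)
    (hu : GKdV.IsPeriodicWave f u c k) :
    ∃ (j₀ : ℕ) (lam : ℤ → ℝ → ℂ), 1 ≤ j₀ ∧ GKdV.IsLargeEigenvalues f u c k j₀ lam ∧
      ∃ (r r' : ℕ → ℝ → ℂ) (b b' : ℕ → ℤ → ℝ → ℂ),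
        (∀ l : ℕ, 1 ≤ l → ContDiff ℝ ∞ (r l) ∧ Function.Periodic (r l) 1 ∧
          ContDiff ℝ ∞ (r' l) ∧ Function.Periodic (r' l) 1) ∧
        GKdV.CoefficientBounds j₀ b ∧ GKdV.CoefficientBounds j₀ b' ∧
        r 1 = r' 1 ∧
        (∀ j : ℤ, (j₀ : ℤ) ≤ |j| → ∀ ξ ∈ GKdV.floquet, b' 1 j ξ = b 1 j ξ) ∧
        ∀ M N : ℕ, 1 ≤ M → 1 ≤ N →
          ∃ φ φ' : ℤ → ℝ → ℝ → ℂ,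
            GKdV.IsEigenfunctionPair f u c k j₀ lam φ φ' ∧
            GKdV.RemainderBounds j₀ φ b r M N ∧
            GKdV.RemainderBounds j₀ φ' b' r' M N := by
  have hk := hu.k_pos
  obtain ⟨A, hAe⟩ : ∃ A : ℝ → ℝ, A = fun y => deriv f (GKdV.scaledProfile u k y) - c := ⟨_, rfl⟩
  have hA : ContDiff ℝ ∞ A := hAe ▸ hu.contDiff_potential hf
  have pA : Function.Periodic A 1 := hAe ▸ hu.potential_periodic
  obtain ⟨S, hS⟩ : ∃ S : ℝ, S = ∑' l, ‖GKdV.fc (fun x => (A x : ℂ)) l‖ := ⟨_, rfl⟩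
  have hS0 : 0 ≤ S := hS ▸ tsum_nonneg fun _ => norm_nonneg _
  have hkS : 0 ≤ k * S := by positivity
  obtain ⟨h₁, n, P, hP⟩ := GKdV.exists_isProfile (N := 2 * (2 * k * S + 1)) hk hA pA
    (by rw [← hS]; nlinarith)
  obtain ⟨δ, Φ, Ψ, hδ0, hδ, hQ⟩ := hP.exists_isNormalizedPair hk hA pA
  obtain ⟨j₀, H, hj₀⟩ := GKdV.exists_isLargeIndex hδ0 hk (2 * (2 * k * S + 1))
  -- The same eigenfunctions serve for all `M` and `N`, and direct and dual expansions share all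
  -- their coefficients `(2πj + ξ)^{-ℓ}`, so that `b_1 = b̃_1` holds by definition.
  refine ⟨j₀, GKdV.eigenBranch k n, H.one_le,
    GKdV.isLargeEigenvalues_eigenBranch hf hu hAe hS H hδ hP hQ hj₀,
    GKdV.taylorCoeff Φ, GKdV.taylorCoeff Ψ, GKdV.expCoeff, GKdV.expCoeff,
    fun l _ => ⟨GKdV.taylorCoeff_smooth hQ.smooth l, GKdV.taylorCoeff_periodic hQ.periodic l,
      GKdV.taylorCoeff_smooth hQ.smooth' l, GKdV.taylorCoeff_periodic hQ.periodic' l⟩,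
    GKdV.coefficientBounds_expCoeff H, GKdV.coefficientBounds_expCoeff H, ?_, fun _ _ _ _ => rfl,
    fun M N _ _ => ⟨GKdV.modeFamily Φ, GKdV.modeFamily Ψ,
      GKdV.isEigenfunctionPair_modeFamily hf hu hAe H hQ,
      GKdV.remainderBounds_modeFamily H hQ.smooth hQ.periodic hQ.at_zero M N,
      GKdV.remainderBounds_modeFamily H hQ.smooth' hQ.periodic' hQ.at_zero' M N⟩⟩
  ext x
  simp only [GKdV.taylorCoeff, Function.iterate_one]
  exact congrArg (· / _) (hQ.deriv_eq x)
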